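/- Consider a Markov decision process with measurable state space $\mathcal S$ (with measurable singletons) and action space $\mathcal A$, transition kernel $P(\cdot\mid s,a)$, measurable per-step reward $R_t=r(S_t,A_t,S_{t+1})$, discount factor $\gamma\in(0,1)$ and designated start state $S_0=s_0$. Let $\Theta\subseteq\mathbb R^d$ be closed and convex, contained in an open set $U$, and let $(\pi_\theta)_\theta$ be randomized stationary Markov policies which for $\theta\in U$ have densities $\pi_\theta(a\mid s)$ with respect to a fixed $\sigma$-finite measure on $\mathcal A$ (e.g. counting measure), measurable in $(s,a)$ and continuously differentiable in $\theta$. Let $J_\theta=\mathbb E_\theta[\sum_{t\ge0}\gamma^tR_t]$ and $\Lambda_t=\nabla_\theta\log\pi_\theta(A_t\mid S_t)$. Let $\tau^{(0)}=0$ and let $\tau^{(n)}$ be the time of the $n$-th return to $s_0$. For the $n$-th cycle and $\tau^{(n-1)}\le\sigma<\tau^{(n)}$ put $$\mathsf R^{(n)}_\sigma=\gamma^{-\tau^{(n-1)}}\sum_{t=\sigma}^{\tau^{(n)}-1}\gamma^tR_t,\qquad \mathsf T^{(n)}_\sigma=\gamma^{-\tau^{(n-1)}}\sum_{t=\sigma}^{\tau^{(n)}-1}\gamma^t,$$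 $\mathsf R^{(n)}=\mathsf R^{(n)}_{\tau^{(n-1)}}$, $\mathsf T^{(n)}=\mathsf T^{(n)}_{\tau^{(n-1)}}$, $\mathsf R_\theta=\mathbb E_\theta[\mathsf R^{(1)}]$, $\mathsf T_\theta=\mathbb E_\theta[\mathsf T^{(1)}]$ and $H_\theta=\mathsf T_\theta\nabla_\theta\mathsf R_\theta-\mathsf R_\theta\nabla_\theta\mathsf T_\theta$. The Renewal Monte Carlo (RMC) algorithm with likelihood-ratio gradient estimates starts from $\theta_0\in\Theta$. In iteration $m=0,1,\dots$, given the past, it generates two independent trajectories under $\pi_{\theta_m}$ from $s_0$. From the first $N\ge1$ cycles of the first trajectory it computes $\widehat{\mathsf R}_m=\frac1N\sum_{n\le N}\mathsf R^{(n)}$ and $\widehat{\mathsf T}_m=\frac1N\sum_{n\le N}\mathsf T^{(n)}$. From the first $N$ cycles of the second it computes $\widehat\nabla\mathsf R_m=\frac1N\sum_{n\le N}\sum_{\sigma=\tau^{(n-1)}}^{\tau^{(n)}-1}\mathsf R^{(n)}_\sigma\Lambda_\sigma$ and $\widehat\nabla\mathsf T_m=\frac1N\sum_{n\le N}\sum_{\sigma=\tau^{(n-1)}}^{\tau^{(n)}-1}\mathsf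 T^{(n)}_\sigma\Lambda_\sigma$. It then sets $$\theta_{m+1}=\big[\theta_m+\alpha_m\widehat H_m\big]_\Theta,\qquad \widehat H_m=\widehat{\mathsf T}_m\widehat\nabla\mathsf R_m-\widehat{\mathsf R}_m\widehat\nabla\mathsf T_m,$$ where $[\cdot]_\Theta$ is the Euclidean projection onto $\Theta$. Assume that $s_0$ is positive recurrent under $\pi_\theta$ for every $\theta\in\Theta$, and: 1. $\theta\mapsto H_\theta$ is locally Lipschitz on $\Theta$; 2. $\alpha_m>0$, $\sum_m\alpha_m=\infty$ and $\sum_m\alpha_m^2<\infty$; 3. every point of $\Theta$ has a neighbourhood on which the second moments under $\mathbb E_\theta$ of $\sum_{t<\tau^{(1)}}\gamma^t|R_t|$ and of $\sum_{t<\tau^{(1)}}\gamma^t(1+|R_t|)\sum_{\sigma\le t}\|\Lambda_\sigma\|$ are bounded; 4. almost surely the sequence $(\theta_m)$ is bounded (automatic if $\Theta$ is bounded). Call $\theta\in\Theta$ a (first-order) stationary point of $J$ over $\Theta$ if $\langle\nabla J_\theta,\theta'-\theta\rangle\le0$ for all $\theta'\in\Theta$; if $\theta$ is interior to $\Theta$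 this means $\nabla J_\theta=0$. Then $J$ is differentiable at every point of $\Theta$, and almost surely $[\theta_m+\nabla J_{\theta_m}]_\Theta-\theta_m\to0$; in particular, if $\Theta=\mathbb R^d$, then $\nabla J_{\theta_m}\to0$ almost surely. If moreover the set of stationary points of $J$ over $\Theta$ is totally disconnected (e.g. if the stationary points are isolated), then almost surely $(\theta_m)$ converges to a (possibly random) stationary point $\theta^*$ of $J$ over $\Theta$, with $\nabla J_{\theta_m}\to\nabla J_{\theta^*}$, and $\nabla J_{\theta^*}=0$ if $\theta^*$ is interior to $\Theta$. -/

import Mathlib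

open MeasureTheory ProbabilityTheory Filter Topology
open scoped ENNReal Gradient

noncomputable section

namespace RMC

/-- A discounted Markov decision process with designated start state `s₀`. The transition kernel
maps a state-action pair to the law of the next state; the reward of a step is
`r (s, a, s')`. -/
structure MDP (S A : Type*) [MeasurableSpace S] [MeasurableSpace A] where
  P : Kernel (S × A) S
  markov : IsMarkovKernel P
  r : S × A × S → ℝ
  measurable_r : Measurable r
  s₀ : S
  γ : ℝ
  γ_pos : 0 < γ
  γ_lt_one : γ < 1

/-- A family of randomized stationary Markov policies parameterized by a Euclidean space.
On the open set `U` the policies have densities `p θ s a` (written `π_θ(a | s)`; probability mass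
functions if `ν` is the counting measure) that are continuously differentiable in `θ`.
Outside `U` the family is arbitrary. -/
structure ParamPolicy (d : ℕ) (S A : Type*) [MeasurableSpace S] [MeasurableSpace A] where
  π : EuclideanSpace ℝ (Fin d) → Kernel S A
  markov : ∀ θ, IsMarkovKernel (π θ)
  U : Set (EuclideanSpace ℝ (Fin d))
  isOpen_U : IsOpen U
  ν : Measure A
  sigmaFinite : SigmaFinite ν
  p : EuclideanSpace ℝ (Fin d) → S → A → ℝ
  measurable_p : ∀ θ ∈ U, Measurable (fun z : S × A => p θ z.1 z.2)
  p_nonneg : ∀ θ ∈ U, ∀ s a, 0 ≤ p θ s a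
  density : ∀ θ ∈ U, ∀ s, π θ s = ν.withDensity (fun a => ENNReal.ofReal (p θ s a))
  contDiffOn : ∀ s a, ContDiffOn ℝ 1 (fun θ => p θ s a) U

attribute [instance] MDP.markov ParamPolicy.markov ParamPolicy.sigmaFinite

/-! ### Regenerative cycles of a trajectory `x t = (S_t, A_t)` -/

section Cycles

variable {S A : Type*}

/-- `returnTime s₀ x n` is the time of the `n`-th return to `s₀` (`∞` if there is none), with the
convention that the `0`-th return is at time `0`. -/
def returnTime (s₀ : S) (x : ℕ → S × A) : ℕ → ℕ∞
  | 0 => 0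
  | n + 1 => sInf {k : ℕ∞ | ∃ t : ℕ, k = t ∧ returnTime s₀ x n < t ∧ (x t).1 = s₀}

/-- The times belonging to the cycle between the `n`-th and the `(n+1)`-st return. -/
def cycle (s₀ : S) (x : ℕ → S × A) (n : ℕ) : Set ℕ :=
  {t : ℕ | returnTime s₀ x n ≤ t ∧ (t : ℕ∞) < returnTime s₀ x (n + 1)}

/-- The part from time `σ` on of the discounted sum of `f` over the cycle after the `n`-th
return, discounted back to the beginning of the cycle. -/
def cycleSum (γ : ℝ) (s₀ : S) (f : ℕ → ℝ) (x : ℕ → S × A) (n σ : ℕ) : ℝ :=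
  (γ ^ (returnTime s₀ x n).toNat)⁻¹ *
    ∑' t : ℕ, (cycle s₀ x n ∩ Set.Ici σ).indicator (fun t => γ ^ t * f t) t

end Cycles

variable {S A : Type*} [MeasurableSpace S] [MeasurableSpace A] {d : ℕ}

/-- The reward `R_t` along a trajectory. -/
def MDP.reward (M : MDP S A) (x : ℕ → S × A) (t : ℕ) : ℝ :=
  M.r ((x t).1, (x t).2, (x (t + 1)).1)

/-- The score `∇_θ log π_θ(a | s)`. -/
def ParamPolicy.score (Q : ParamPolicy d S A) (θ : EuclideanSpace ℝ (Fin d)) (z : S × A) :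
    EuclideanSpace ℝ (Fin d) :=
  gradient (fun θ' => Real.log (Q.p θ' z.1 z.2)) θ

/-- One step of the state-action process: draw the next state from the transition kernel, then
the next action from the policy. -/
def step (M : MDP S A) (Q : ParamPolicy d S A) (θ : EuclideanSpace ℝ (Fin d)) :
    Kernel (S × A) (S × A) :=
  M.P ⊗ₖ (Q.π θ).prodMkLeft (S × A)

instance (M : MDP S A) (Q : ParamPolicy d S A) (θ : EuclideanSpace ℝ (Fin d)) :
    IsMarkovKernel (step M Q θ) := by
  unfold step
  infer_instance

/-- The law of the trajectory `(S_t, A_t)_{t ≥ 0}` started at `S_0 = s₀` under the policy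
`π_θ`. -/
def trajLaw (M : MDP S A) (Q : ParamPolicy d S A) (θ : EuclideanSpace ℝ (Fin d)) :
    Measure (ℕ → S × A) :=
  Kernel.trajMeasure (X := fun _ => S × A) (Measure.dirac M.s₀ ⊗ₘ Q.π θ)
    (fun n => (step M Q θ).comap
      (fun h : (Π _ : Finset.Iic n, S × A) => h ⟨n, Finset.mem_Iic.2 le_rfl⟩)
      (measurable_pi_apply _))

/-- The performance `J_θ`: the expected total discounted reward. -/
def J (M : MDP S A) (Q : ParamPolicy d S A) (θ : EuclideanSpace ℝ (Fin d)) : ℝ :=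
  ∫ x, ∑' t : ℕ, M.γ ^ t * M.reward x t ∂(trajLaw M Q θ)

/-- `R_θ`: the expected discounted reward of a regenerative cycle. -/
def meanR (M : MDP S A) (Q : ParamPolicy d S A) (θ : EuclideanSpace ℝ (Fin d)) : ℝ :=
  ∫ x, cycleSum M.γ M.s₀ (M.reward x) x 0 0 ∂(trajLaw M Q θ)

/-- `T_θ`: the expected discounted time of a regenerative cycle. -/
def meanT (M : MDP S A) (Q : ParamPolicy d S A) (θ : EuclideanSpace ℝ (Fin d)) : ℝ :=
  ∫ x, cycleSum M.γ M.s₀ (fun _ => 1) x 0 0 ∂(trajLaw M Q θ)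

/-- `H_θ = T_θ ∇R_θ - R_θ ∇T_θ`. -/
def H (M : MDP S A) (Q : ParamPolicy d S A) (θ : EuclideanSpace ℝ (Fin d)) :
    EuclideanSpace ℝ (Fin d) :=
  meanT M Q θ • gradient (meanR M Q) θ - meanR M Q θ • gradient (meanT M Q) θ

/-- The start state is positive recurrent under `π_θ`: its mean return time is finite. -/
def PositiveRecurrent (M : MDP S A) (Q : ParamPolicy d S A)
    (θ : EuclideanSpace ℝ (Fin d)) : Prop :=
  ∫⁻ x, ((returnTime M.s₀ x 1 : ℕ∞) : ℝ≥0∞) ∂(trajLaw M Q θ) < ∞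

/-- The discounted sum of the absolute rewards over the first cycle. -/
def absReturn (M : MDP S A) (x : ℕ → S × A) : ℝ≥0∞ :=
  ∑' t : ℕ, (cycle M.s₀ x 0).indicator
    (fun t => ENNReal.ofReal (M.γ ^ t) * ‖M.reward x t‖ₑ) t

/-- The absolute version, over the first cycle, of the likelihood-ratio gradient estimates of the
discounted reward and of the discounted time together. -/
def absLR (M : MDP S A) (Q : ParamPolicy d S A) (θ : EuclideanSpace ℝ (Fin d))
    (x : ℕ → S × A) : ℝ≥0∞ :=
  ∑' t : ℕ, (cycle M.s₀ x 0).indicator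
    (fun t => ENNReal.ofReal (M.γ ^ t) * (1 + ‖M.reward x t‖ₑ) *
      ∑ σ ∈ Finset.range (t + 1), ‖Q.score θ (x σ)‖ₑ) t

/-- The cycle estimates are square integrable, with bounds that are locally uniform in `θ` around
every point of `Θ`. -/
def LocallyBoundedSecondMoments (M : MDP S A) (Q : ParamPolicy d S A)
    (Θ : Set (EuclideanSpace ℝ (Fin d))) : Prop :=
  ∀ θ₀ ∈ Θ, ∃ K : ℝ≥0∞, K < ∞ ∧ ∀ᶠ θ in 𝓝 θ₀,
    ∫⁻ x, absReturn M x ^ 2 ∂(trajLaw M Q θ) ≤ K ∧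
    ∫⁻ x, absLR M Q θ x ^ 2 ∂(trajLaw M Q θ) ≤ K

/-! ### The algorithm -/

/-- The average over the first `N` cycles of the trajectory of the discounted cycle sums
of `f`. -/
def avgEst (M : MDP S A) (N : ℕ) (f : ℕ → ℝ) (x : ℕ → S × A) : ℝ :=
  (N : ℝ)⁻¹ * ∑ n ∈ Finset.range N, cycleSum M.γ M.s₀ f x n 0

/-- The likelihood-ratio estimate, over the first `N` cycles of the trajectory, of the gradient
of the mean discounted cycle sum of `f`. -/
def gradEst (M : MDP S A) (Q : ParamPolicy d S A) (N : ℕ) (θ : EuclideanSpace ℝ (Fin d))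
    (f : ℕ → ℝ) (x : ℕ → S × A) : EuclideanSpace ℝ (Fin d) :=
  (N : ℝ)⁻¹ • ∑ n ∈ Finset.range N, ∑' σ : ℕ, (cycle M.s₀ x n).indicator
    (fun σ => cycleSum M.γ M.s₀ f x n σ • Q.score θ (x σ)) σ

/-- `Ĥ`: the estimate of `H_θ` from two trajectories, `x` for the values and `y` for the
gradients. -/
def estH (M : MDP S A) (Q : ParamPolicy d S A) (N : ℕ) (θ : EuclideanSpace ℝ (Fin d))
    (x y : ℕ → S × A) : EuclideanSpace ℝ (Fin d) :=
  avgEst M N (fun _ => 1) x • gradEst M Q N θ (M.reward y) y -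
    avgEst M N (M.reward x) x • gradEst M Q N θ (fun _ => 1) y

open Classical in
/-- The Euclidean projection onto `Θ` (used for closed convex nonempty `Θ`, where the nearest
point exists and is unique). -/
def proj (Θ : Set (EuclideanSpace ℝ (Fin d))) (u : EuclideanSpace ℝ (Fin d)) :
    EuclideanSpace ℝ (Fin d) :=
  if h : ∃ v ∈ Θ, ∀ w ∈ Θ, ‖u - v‖ ≤ ‖u - w‖ then h.choose else u

/-- A run of the algorithm with parameter space `Θ`, learning rates `α`, `N` cycles per estimate
and initial parameter `θ₀`. In iteration `m`, conditionally on the past `ℱ m`, the trajectories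
`x m` and `y m` are independent and both have the law of the process under `π_{θ m}`. -/
structure IsRun (M : MDP S A) (Q : ParamPolicy d S A) (Θ : Set (EuclideanSpace ℝ (Fin d)))
    (α : ℕ → ℝ) (N : ℕ) (θ₀ : EuclideanSpace ℝ (Fin d))
    {Ω : Type*} {mΩ : MeasurableSpace Ω} (μ : Measure Ω) (ℱ : Filtration ℕ mΩ)
    (x y : ℕ → Ω → ℕ → S × A) (θ : ℕ → Ω → EuclideanSpace ℝ (Fin d)) : Prop where
  init : ∀ ω, θ 0 ω = θ₀
  adapted : ∀ m, Measurable[ℱ m] (θ m)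
  measurable_traj : ∀ m, Measurable[ℱ (m + 1)] (fun ω => (x m ω, y m ω))
  law : ∀ m, ∀ F, MeasurableSet[ℱ m] F → ∀ B, MeasurableSet B →
    μ (F ∩ {ω | (x m ω, y m ω) ∈ B}) =
      ∫⁻ ω in F, ((trajLaw M Q (θ m ω)).prod (trajLaw M Q (θ m ω))) B ∂μ
  update : ∀ m ω, θ (m + 1) ω =
    proj Θ (θ m ω + α m • estH M Q N (θ m ω) (x m ω) (y m ω))

/-- First-order stationary points of `f` over `Θ`. At an interior point of `Θ` this says that the
gradient vanishes. -/
def IsStationaryOn (f : EuclideanSpace ℝ (Fin d) → ℝ) (Θ : Set (EuclideanSpace ℝ (Fin d)))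
    (θ : EuclideanSpace ℝ (Fin d)) : Prop :=
  θ ∈ Θ ∧ ∀ θ' ∈ Θ, inner ℝ (gradient f θ) (θ' - θ) ≤ 0

end RMC

end

/-!
The performance satisfies the renewal formula `J = R / ((1 - γ) T)`, where `R` and `T` are the mean
discounted reward and the mean discounted time of a cycle. Hence `∇J` is the positive multiple
`((1 - γ) T²)⁻¹` of `H = T ∇R - R ∇T`, and the algorithm is a projected stochastic ascent along a
positive multiple of `∇J`, with unbiased square integrable estimates.

*The gradients.* The law of a trajectory is described by its one-step recursion (`pathLaw`), which
gives the Markov property (`lintegral_mul_shift`) and, through a reference probability on the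
trajectories, the densities of the laws `trajLaw M Q θ` on finite horizons. Differentiating under
the integral is justified by the locally bounded second moments only
(`hasGradientAt_integral_density`): by `u ≤ ε u² + ε⁻¹`, an event of small probability contributes
little to the integral of a function `u` with bounded second moment. Summing over time
(`hasGradientAt_integral_cycleCost`) uses in the same way that long cycles are unlikely, uniformly
near a positive recurrent parameter. With the renewal equation
(`J_eq`) this gives `hasGradientAt_J`, and `∇J` is Lipschitz on compact convex subsets of `Θ`.

*The estimates.* By the strong Markov property the map `nextCycle`, which cuts off the first cycle,
preserves the law of the trajectory. So the cycles all look like the first one, and the estimate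
`Ĥ` has mean `H` and a second moment that is bounded on compact sets of parameters
(`integral_regenEst`, `lintegral_regenEst_sq_le`). Weighted with the learning rates, the centred
estimates form series of orthogonal martingale differences, which converge almost surely
(`ae_exists_tendsto_sum_sub_integral`).

*The ascent.* On the event that the parameters stay in a ball, let `C` be the intersection of `Θ`
with a slightly larger ball, `∇J` being `L`-Lipschitz on `C`. The Moreau envelope
`min_{y ∈ C} (-J y + 2 L ‖y - θ‖²)`, attained at `Y θ`, is a Lyapunov function: the step from `θ`
decreases it by a multiple of `α ‖θ - Y θ‖²` up to noise (`envelope_step`). This works because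
projecting onto `Θ` does not increase the distance to `Y θ ∈ Θ`, and because `Y θ - θ` is an ascent
direction. Hence `∑ α ‖θ - Y θ‖²` converges, and as the parameters move by `O(α)` on average,
`‖θ - Y θ‖` tends to zero (`tendsto_zero_of_summable_mul_sq`). This distance bounds the
projected-gradient residual (`norm_residual_le`). The increments of the parameters also tend to
zero, so that their limit points form a connected set of stationary points, which is a single point
if the set of stationary points is totally disconnected.
-/

noncomputable section

namespace RMC

/-! ### Markov chains on path space -/

section Chain

variable {Z : Type*} [MeasurableSpace Z]

/-- The path that starts with `z` and continues as `y`. -/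
def pathCons (z : Z) (y : ℕ → Z) : ℕ → Z
  | 0 => z
  | n + 1 => y n

omit [MeasurableSpace Z] in
@[simp] lemma pathCons_zero (z : Z) (y : ℕ → Z) : pathCons z y 0 = z := rfl
omit [MeasurableSpace Z] in
@[simp] lemma pathCons_succ (z : Z) (y : ℕ → Z) (n : ℕ) : pathCons z y (n + 1) = y n := rfl

@[fun_prop]
lemma measurable_pathCons : Measurable (fun w : Z × (ℕ → Z) => pathCons w.1 w.2) := by
  refine measurable_pi_lambda _ fun n => ?_
  cases n with
  | zero => exact measurable_fst
  | succ n => exact (measurable_pi_apply n).comp measurable_snd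

/-- The transition kernel `k` as a history-dependent kernel. -/
abbrev histKer (k : Kernel Z Z) (n : ℕ) : Kernel (Π _ : Finset.Iic n, Z) Z :=
  k.comap (fun h => h ⟨n, Finset.mem_Iic.2 le_rfl⟩) (measurable_pi_apply _)

/-- The law of the Markov chain with transition kernel `k`, as a kernel from the starting
point. -/
def chainLaw (k : Kernel Z Z) [IsMarkovKernel k] : Kernel Z (ℕ → Z) :=
  (Kernel.traj (X := fun _ => Z) (histKer k) 0).comap (fun z _ => z)
    (measurable_pi_lambda _ fun _ => measurable_id)

instance (k : Kernel Z Z) [IsMarkovKernel k] : IsMarkovKernel (chainLaw k) := by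
  unfold chainLaw; infer_instance

lemma trajMeasure_eq_bind (k : Kernel Z Z) [IsMarkovKernel k] (μ₀ : Measure Z) :
    Kernel.trajMeasure (X := fun _ => Z) μ₀ (histKer k) = μ₀.bind (chainLaw k) := by
  rw [Kernel.trajMeasure]
  ext s hs
  rw [Measure.bind_apply hs (Kernel.aemeasurable _), Measure.bind_apply hs (Kernel.aemeasurable _),
    lintegral_map (Kernel.measurable_coe _ hs) (by fun_prop)]
  rfl

lemma chainLaw_eq_trajMeasure (k : Kernel Z Z) [IsMarkovKernel k] (z : Z) :
    chainLaw k z = Kernel.trajMeasure (X := fun _ => Z) (Measure.dirac z) (histKer k) := by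
  rw [trajMeasure_eq_bind, Measure.dirac_bind (Kernel.measurable _)]

/-- The finite-dimensional laws of a Markov chain, one step at a time. -/
lemma lintegral_chainLaw_succ (k : Kernel Z Z) [IsMarkovKernel k] (z : Z) (n : ℕ)
    {g : (Π _ : Finset.Iic n, Z) × Z → ℝ≥0∞} (hg : Measurable g) :
    ∫⁻ x, g (Preorder.frestrictLe n x, x (n + 1)) ∂chainLaw k z =
      ∫⁻ x, ∫⁻ z', g (Preorder.frestrictLe n x, z') ∂k (x n) ∂chainLaw k z := by
  have h := Kernel.map_frestrictLe_trajMeasure_compProd_eq_map_trajMeasure (X := fun _ => Z)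
    (κ := histKer k) (μ₀ := Measure.dirac z) (a := n)
  rw [← chainLaw_eq_trajMeasure] at h
  have h2 := congrArg (fun ρ => ∫⁻ w, g w ∂ρ) h
  rw [lintegral_map hg (by fun_prop), Measure.lintegral_compProd hg, lintegral_map
    (by exact hg.lintegral_kernel_prod_right') (by fun_prop)] at h2
  exact h2.symm

lemma lintegral_chainLaw_zero (k : Kernel Z Z) [IsMarkovKernel k] (z : Z)
    {g : Z → ℝ≥0∞} (hg : Measurable g) :
    ∫⁻ x, g (x 0) ∂chainLaw k z = g z := by
  have h : (chainLaw k z).map (Preorder.frestrictLe (π := fun _ => Z) 0) =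
      Measure.dirac (fun _ => z) := by
    rw [chainLaw, Kernel.comap_apply, Kernel.traj_map_frestrictLe_apply, Kernel.partialTraj_zero,
      Kernel.deterministic_apply]
    rfl
  have h2 := congrArg (fun ρ => ∫⁻ w, g (w ⟨0, by simp⟩) ∂ρ) h
  rw [lintegral_map (by fun_prop) (by fun_prop), lintegral_dirac' _ (by fun_prop)] at h2
  exact h2

/-- A probability measure on paths is determined by its initial law and its one-step transition
laws. -/
lemma eq_of_transitions {ρ₁ ρ₂ : Measure (ℕ → Z)} [IsProbabilityMeasure ρ₁]
    [IsProbabilityMeasure ρ₂] (k : Kernel Z Z) [IsMarkovKernel k]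
    (h0 : ∀ g : Z → ℝ≥0∞, Measurable g → ∫⁻ x, g (x 0) ∂ρ₁ = ∫⁻ x, g (x 0) ∂ρ₂)
    (h₁ : ∀ n, ∀ g : (Π _ : Finset.Iic n, Z) × Z → ℝ≥0∞, Measurable g →
      ∫⁻ x, g (Preorder.frestrictLe n x, x (n + 1)) ∂ρ₁ =
        ∫⁻ x, ∫⁻ z', g (Preorder.frestrictLe n x, z') ∂k (x n) ∂ρ₁)
    (h₂ : ∀ n, ∀ g : (Π _ : Finset.Iic n, Z) × Z → ℝ≥0∞, Measurable g →
      ∫⁻ x, g (Preorder.frestrictLe n x, x (n + 1)) ∂ρ₂ =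
        ∫⁻ x, ∫⁻ z', g (Preorder.frestrictLe n x, z') ∂k (x n) ∂ρ₂) :
    ρ₁ = ρ₂ := by
  have key : ∀ n, ∀ g : (Π _ : Finset.Iic n, Z) → ℝ≥0∞, Measurable g →
      ∫⁻ x, g (Preorder.frestrictLe n x) ∂ρ₁ = ∫⁻ x, g (Preorder.frestrictLe n x) ∂ρ₂ := by
    intro n
    induction n with
    | zero =>
      intro g hg
      have : ∀ x : ℕ → Z, Preorder.frestrictLe (π := fun _ => Z) 0 x = fun _ => x 0 := by
        intro x; ext ⟨i, hi⟩
        have : i = 0 := by simpa using hi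
        subst this; rfl
      simp only [this]
      exact h0 (fun z => g fun _ => z) (hg.comp (by fun_prop))
    | succ n ih =>
      intro g hg
      let e : (Π _ : Finset.Iic n, Z) × Z → (Π _ : Finset.Iic (n + 1), Z) :=
        fun w i => if h : (i : ℕ) ≤ n then w.1 ⟨i, Finset.mem_Iic.2 h⟩ else w.2
      have he : Measurable e := by
        refine measurable_pi_lambda _ fun i => ?_
        by_cases h : (i : ℕ) ≤ n
        · simp only [e, h, dite_true]; fun_prop
        · simp only [e, h, dite_false]; fun_prop
      have hx : ∀ x : ℕ → Z, Preorder.frestrictLe (π := fun _ => Z) (n + 1) x =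
          e (Preorder.frestrictLe n x, x (n + 1)) := by
        intro x; ext ⟨i, hi⟩
        by_cases h : i ≤ n
        · simp [e, h]
        · have : i = n + 1 := by
            have := Finset.mem_Iic.1 hi; omega
          subst this; simp [e]
      simp only [hx]
      refine (h₁ n (g ∘ e) (hg.comp he)).trans (Eq.trans ?_ (h₂ n (g ∘ e) (hg.comp he)).symm)
      exact ih (fun h => ∫⁻ z', (g ∘ e) (h, z') ∂(histKer k n) h)
        ((hg.comp he).lintegral_kernel_prod_right' (κ := histKer k n))
  have hmap : ∀ n, ρ₁.map (Preorder.frestrictLe (π := fun _ => Z) n) =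
      ρ₂.map (Preorder.frestrictLe (π := fun _ => Z) n) := by
    intro n
    refine Measure.ext_of_lintegral _ fun g hg => ?_
    rw [lintegral_map hg (by fun_prop), lintegral_map hg (by fun_prop), key n g hg]
  refine IsProjectiveLimit.unique (P := fun I => ρ₂.map I.restrict) (fun I => ?_) (fun I => rfl)
  have hI : (I.restrict : (ℕ → Z) → _) =
      Finset.restrict₂ (π := fun _ => Z) (Finset.subset_Iic_sup_id I) ∘
        Preorder.frestrictLe (π := fun _ => Z) (I.sup id) := rfl
  have hr := Finset.measurable_restrict₂ (X := fun _ => Z) (Finset.subset_Iic_sup_id I)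
  change ρ₁.map I.restrict = ρ₂.map I.restrict
  rw [hI, ← Measure.map_map hr (by fun_prop), hmap, Measure.map_map hr (by fun_prop)]

/-- First-step decomposition of a Markov chain. -/
theorem lintegral_chainLaw (k : Kernel Z Z) [IsMarkovKernel k] (z : Z)
    {f : (ℕ → Z) → ℝ≥0∞} (hf : Measurable f) :
    ∫⁻ x, f x ∂chainLaw k z = ∫⁻ z', ∫⁻ y, f (pathCons z y) ∂chainLaw k z' ∂k z := by
  have hc : Measurable (pathCons z) := measurable_pathCons.comp measurable_prodMk_left
  have hev : ∀ g : (ℕ → Z) → ℝ≥0∞, Measurable g →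
      ∫⁻ x, g x ∂(((k z).bind (chainLaw k)).map (pathCons z)) =
        ∫⁻ z', ∫⁻ y, g (pathCons z y) ∂chainLaw k z' ∂k z := by
    intro g hg
    rw [lintegral_map hg hc]
    exact Measure.lintegral_bind (Kernel.aemeasurable _) (hg.comp hc).aemeasurable
  have hp : IsProbabilityMeasure (((k z).bind (chainLaw k)).map (pathCons z)) :=
    Measure.isProbabilityMeasure_map hc.aemeasurable
  rw [← hev f hf]
  congr 1
  refine eq_of_transitions k (fun g hg => ?_)
    (fun n g hg => lintegral_chainLaw_succ k z n hg) (fun n g hg => ?_)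
  · rw [lintegral_chainLaw_zero k z hg, hev _ (by fun_prop)]
    simp
  · rw [hev (fun x => g (Preorder.frestrictLe n x, x (n + 1))) (by fun_prop),
      hev (fun x => ∫⁻ z', g (Preorder.frestrictLe n x, z') ∂k (x n))]
    swap
    · exact (hg.lintegral_kernel_prod_right' (κ := histKer k n)).comp
        (Preorder.measurable_frestrictLe (X := fun _ => Z) n)
    cases n with
    | zero =>
      have hfr : ∀ y : ℕ → Z, Preorder.frestrictLe (π := fun _ => Z) 0 (pathCons z y) =
          fun _ => z := by
        intro y; ext ⟨i, hi⟩
        have : i = 0 := by simpa using hi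
        subst this; rfl
      simp only [hfr, zero_add, pathCons_succ, pathCons_zero]
      have h1 : ∀ z', ∫⁻ y, g (fun _ => z, y 0) ∂chainLaw k z' = g (fun _ => z, z') := fun z' =>
        lintegral_chainLaw_zero k z' (g := fun w => g (fun _ => z, w)) (by fun_prop)
      simp [h1]
    | succ n =>
      let e : (Π _ : Finset.Iic n, Z) → (Π _ : Finset.Iic (n + 1), Z) :=
        fun w i => if h : (i : ℕ) = 0 then z else w ⟨i - 1, Finset.mem_Iic.2 (by
          have := Finset.mem_Iic.1 i.2; omega)⟩
      have he : Measurable e := by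
        refine measurable_pi_lambda _ fun i => ?_
        by_cases h : (i : ℕ) = 0
        · simp only [e, h, dite_true]; fun_prop
        · simp only [e, h, dite_false]; fun_prop
      have hfr : ∀ y : ℕ → Z, Preorder.frestrictLe (π := fun _ => Z) (n + 1) (pathCons z y) =
          e (Preorder.frestrictLe n y) := by
        intro y; ext ⟨i, hi⟩
        cases i with
        | zero => simp [e]
        | succ i => simp [e]
      simp only [hfr, pathCons_succ]
      refine lintegral_congr fun z' => ?_
      exact lintegral_chainLaw_succ k z' n (g := fun w => g (e w.1, w.2)) (by fun_prop)

end Chain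

/-! ### The law of a trajectory as a kernel of its first state -/

section PathLaw

variable {S A : Type*} [MeasurableSpace S] [MeasurableSpace A]

/-- The law of the state-action process as a kernel from the first state. -/
def pathLaw (P : Kernel (S × A) S) [IsMarkovKernel P] (π : Kernel S A) [IsMarkovKernel π] :
    Kernel S (ℕ → S × A) :=
  chainLaw (P ⊗ₖ π.prodMkLeft (S × A)) ∘ₖ (Kernel.id ×ₖ π)

variable (P : Kernel (S × A) S) [IsMarkovKernel P] (π : Kernel S A) [IsMarkovKernel π]

instance : IsMarkovKernel (pathLaw P π) := by unfold pathLaw; infer_instance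

lemma trajLaw_eq_pathLaw {d : ℕ} (M : MDP S A) (Q : ParamPolicy d S A)
    (θ : EuclideanSpace ℝ (Fin d)) : trajLaw M Q θ = pathLaw M.P (Q.π θ) M.s₀ := by
  have h1 : trajLaw M Q θ = (Measure.dirac M.s₀ ⊗ₘ Q.π θ).bind (chainLaw (step M Q θ)) :=
    trajMeasure_eq_bind (step M Q θ) _
  have h2 : (Measure.dirac M.s₀ ⊗ₘ Q.π θ) = (Kernel.id ×ₖ Q.π θ) M.s₀ := by
    refine Measure.ext_of_lintegral _ fun f hf => ?_
    rw [Measure.lintegral_compProd hf, lintegral_dirac' _ hf.lintegral_kernel_prod_right',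
      Kernel.prod_apply, Kernel.id_apply, lintegral_prod _ hf.aemeasurable,
      lintegral_dirac' _ hf.lintegral_prod_right']
  rw [h1, h2, pathLaw, Kernel.comp_apply]
  rfl

/-- First-step decomposition of the law of a trajectory. -/
theorem lintegral_pathLaw (s : S) {f : (ℕ → S × A) → ℝ≥0∞} (hf : Measurable f) :
    ∫⁻ x, f x ∂pathLaw P π s =
      ∫⁻ a, ∫⁻ s', ∫⁻ y, f (pathCons (s, a) y) ∂pathLaw P π s' ∂P (s, a) ∂π s := by
  have hc : ∀ z : S × A, Measurable (fun y => f (pathCons z y)) := fun z =>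
    hf.comp (measurable_pathCons.comp measurable_prodMk_left)
  have hprod : ∀ (s : S) {g : S × A → ℝ≥0∞}, Measurable g →
      ∫⁻ z, g z ∂(Kernel.id ×ₖ π) s = ∫⁻ a, g (s, a) ∂π s := by
    intro s g hg
    rw [Kernel.prod_apply, Kernel.id_apply, lintegral_prod _ hg.aemeasurable,
      lintegral_dirac' _ hg.lintegral_prod_right']
  have hrec : ∀ (s : S) {g : (ℕ → S × A) → ℝ≥0∞}, Measurable g → ∫⁻ x, g x ∂pathLaw P π s =
      ∫⁻ a, ∫⁻ x, g x ∂chainLaw (P ⊗ₖ π.prodMkLeft (S × A)) (s, a) ∂π s := by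
    intro s g hg
    rw [pathLaw, Kernel.lintegral_comp _ _ _ hg, hprod s hg.lintegral_kernel]
  rw [hrec s hf]
  refine lintegral_congr fun a => ?_
  rw [lintegral_chainLaw _ _ hf, Kernel.lintegral_compProd _ _ _ (by
    exact (hc (s, a)).lintegral_kernel)]
  refine lintegral_congr fun s' => ?_
  rw [hrec s' (hc (s, a))]
  rfl

lemma lintegral_pathLaw_congr (s : S) {f g : (ℕ → S × A) → ℝ≥0∞} (hf : Measurable f)
    (hg : Measurable g) (h : ∀ a y, f (pathCons (s, a) y) = g (pathCons (s, a) y)) :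
    ∫⁻ x, f x ∂pathLaw P π s = ∫⁻ x, g x ∂pathLaw P π s := by
  rw [lintegral_pathLaw P π s hf, lintegral_pathLaw P π s hg]
  simp [h]

/-- `g` is a function of the first `n` state-action pairs and of the state that follows them. -/
def DeterminedBy {β : Type*} (n : ℕ) (g : (ℕ → S × A) → β) : Prop :=
  ∀ ⦃x x' : ℕ → S × A⦄, (∀ i < n, x i = x' i) → (x n).1 = (x' n).1 → g x = g x'

omit [MeasurableSpace S] [MeasurableSpace A] in
lemma DeterminedBy.mono {β : Type*} {n m : ℕ} {g : (ℕ → S × A) → β} (h : DeterminedBy n g)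
    (hnm : n ≤ m) : DeterminedBy m g := by
  intro x x' h1 h2
  refine h (fun i hi => h1 i (hi.trans_le hnm)) ?_
  rcases hnm.lt_or_eq with h' | rfl
  · rw [h1 n h']
  · exact h2

omit [MeasurableSpace S] [MeasurableSpace A] in
lemma DeterminedBy.tail {β : Type*} {n : ℕ} {g : (ℕ → S × A) → β} (h : DeterminedBy (n + 1) g)
    (z : S × A) : DeterminedBy n (fun y => g (pathCons z y)) := by
  intro y y' h1 h2
  refine h (fun i hi => ?_) h2
  cases i with
  | zero => rfl
  | succ i => exact h1 i (by omega)

/-- The trajectory from time `n` on. -/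
def shift (n : ℕ) (x : ℕ → S × A) : ℕ → S × A := fun t => x (t + n)

@[fun_prop]
lemma measurable_shift (n : ℕ) : Measurable (shift n : (ℕ → S × A) → _) :=
  measurable_pi_lambda _ fun t => measurable_pi_apply (t + n)

omit [MeasurableSpace S] [MeasurableSpace A] in
lemma DeterminedBy.exists_eq_of_zero {g : (ℕ → S × A) → ℝ≥0∞} (hg : DeterminedBy 0 g) (s : S) :
    ∃ c, ∀ a y, g (pathCons (s, a) y) = c := by
  by_cases h : Nonempty A
  · obtain ⟨a₀⟩ := h
    refine ⟨g (fun _ => (s, a₀)), fun a y => hg (fun i hi => absurd hi (by simp)) rfl⟩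
  · exact ⟨0, fun a => (h ⟨a⟩).elim⟩

/-- **Markov property** of the state-action process, at a fixed time. -/
theorem lintegral_mul_shift (n : ℕ) (s : S) {g f : (ℕ → S × A) → ℝ≥0∞} (hg : Measurable g)
    (hgn : DeterminedBy n g) (hf : Measurable f) :
    ∫⁻ x, g x * f (shift n x) ∂pathLaw P π s =
      ∫⁻ x, g x * ∫⁻ y, f y ∂pathLaw P π (x n).1 ∂pathLaw P π s := by
  have hF : Measurable fun s => ∫⁻ y, f y ∂pathLaw P π s := hf.lintegral_kernel
  induction n generalizing s g with
  | zero =>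
    obtain ⟨c, hc⟩ := hgn.exists_eq_of_zero s
    rw [lintegral_pathLaw_congr P π s (g := fun x => c * f x) (by fun_prop) (by fun_prop)
        (fun a y => by rw [hc]; rfl),
      lintegral_pathLaw_congr P π s (f := fun x => g x * ∫⁻ y, f y ∂pathLaw P π (x 0).1)
        (g := fun x => c * ∫⁻ y, f y ∂pathLaw P π s) (by fun_prop) (by fun_prop)
        (fun a y => by rw [hc]; rfl)]
    rw [lintegral_const_mul _ hf]
    simp
  | succ n ih =>
    rw [lintegral_pathLaw P π s (by fun_prop), lintegral_pathLaw P π s (by fun_prop)]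
    refine lintegral_congr fun a => lintegral_congr fun s' => ?_
    exact ih s' (hg.comp (measurable_pathCons.comp measurable_prodMk_left)) (hgn.tail (s, a))

/-- **Change of measure.** If the policy `π` has the density `q` with respect to the policy `π'`,
then on functions of the first `n` state-action pairs and of the next state the law of the
trajectory under `π` has the likelihood ratio `∏ i < n, q (S_i, A_i)` with respect to the law
under `π'`. -/
theorem lintegral_pathLaw_withDensity (π' : Kernel S A) [IsMarkovKernel π'] {q : S × A → ℝ≥0∞}
    (hq : Measurable q) (hπ : ∀ s, π s = (π' s).withDensity (fun a => q (s, a)))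
    (n : ℕ) (s : S) {g : (ℕ → S × A) → ℝ≥0∞} (hg : Measurable g) (hgn : DeterminedBy n g) :
    ∫⁻ x, g x ∂pathLaw P π s =
      ∫⁻ x, (∏ i ∈ Finset.range n, q (x i)) * g x ∂pathLaw P π' s := by
  have hqn : ∀ n, Measurable fun x : ℕ → S × A => ∏ i ∈ Finset.range n, q (x i) := fun n =>
    Finset.measurable_prod _ fun i _ => hq.comp (measurable_pi_apply i)
  induction n generalizing s g with
  | zero =>
    obtain ⟨c, hc⟩ := hgn.exists_eq_of_zero s
    rw [lintegral_pathLaw_congr P π s (g := fun x => c) hg (by fun_prop) hc,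
      lintegral_pathLaw_congr P π' s (g := fun x => c) (by fun_prop) (by fun_prop)
        (fun a y => by rw [hc]; simp)]
    simp
  | succ n ih =>
    have hgc : ∀ z : S × A, Measurable (fun y => g (pathCons z y)) := fun z =>
      hg.comp (measurable_pathCons.comp measurable_prodMk_left)
    have hqg : ∀ z : S × A, Measurable
        (fun y => (∏ i ∈ Finset.range n, q (y i)) * g (pathCons z y)) := fun z =>
      (hqn n).mul (hgc z)
    rw [lintegral_pathLaw P π s hg, lintegral_pathLaw P π' s
        (f := fun x => (∏ i ∈ Finset.range (n + 1), q (x i)) * g x) ((hqn _).mul hg), hπ s,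
      lintegral_withDensity_eq_lintegral_mul₀]
    · refine lintegral_congr fun a => ?_
      simp only [Pi.mul_apply]
      rw [← lintegral_const_mul _ (hgc (s, a)).lintegral_kernel]
      refine lintegral_congr fun s' => ?_
      rw [ih s' (hgc (s, a)) (hgn.tail (s, a)), ← lintegral_const_mul _ (hqg (s, a))]
      refine lintegral_congr fun y => ?_
      rw [Finset.prod_range_succ']
      simp only [pathCons_succ, pathCons_zero]
      ring
    · exact (hq.comp measurable_prodMk_left).aemeasurable
    · have h2 : Measurable (fun w : (S × A) × S => ∫⁻ y, g (pathCons w.1 y) ∂pathLaw P π w.2) := by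
        have : Measurable (fun w : ((S × A) × S) × (ℕ → S × A) => g (pathCons w.1.1 w.2)) :=
          hg.comp ((measurable_pathCons (Z := S × A)).comp
            (f := fun w : ((S × A) × S) × (ℕ → S × A) => (w.1.1, w.2)) (by fun_prop))
        exact this.lintegral_kernel_prod_right' (κ := (pathLaw P π).comap Prod.snd measurable_snd)
      exact ((h2.lintegral_kernel_prod_right' (κ := P)).comp measurable_prodMk_left).aemeasurable

end PathLaw

/-! ### Differentiation of expectations with respect to a density -/

section ScoreDifferentiation

lemma _root_.ENNReal.le_mul_sq_add_inv {ε : ℝ≥0∞} (h0 : ε ≠ 0) (h1 : ε ≠ ∞) (u : ℝ≥0∞) :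
    u ≤ ε * u ^ 2 + ε⁻¹ := by
  rcases le_total u ε⁻¹ with h | h
  · exact h.trans le_add_self
  · refine le_trans ?_ le_self_add
    calc u = 1 * u := (one_mul u).symm
      _ ≤ (ε * u) * u := by
        gcongr
        calc (1 : ℝ≥0∞) = ε * ε⁻¹ := (ENNReal.mul_inv_cancel h0 h1).symm
          _ ≤ ε * u := by gcongr
      _ = ε * u ^ 2 := by ring

/-- A second moment bounds the contribution to the first moment of an event of small weight. -/
lemma setLIntegral_le_of_sq {X : Type*} [MeasurableSpace X] {m : Measure X} (s : Set X)
    {w u : X → ℝ≥0∞} (hw : Measurable w) (hu : Measurable u) {K ε : ℝ≥0∞} (h0 : ε ≠ 0)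
    (h1 : ε ≠ ∞) (hK : ∫⁻ x, w x * u x ^ 2 ∂m ≤ K) :
    ∫⁻ x in s, w x * u x ∂m ≤ ε * K + ε⁻¹ * ∫⁻ x in s, w x ∂m := by
  calc ∫⁻ x in s, w x * u x ∂m
      ≤ ∫⁻ x in s, (ε * (w x * u x ^ 2) + ε⁻¹ * w x) ∂m := by
        refine lintegral_mono fun x => ?_
        calc w x * u x ≤ w x * (ε * u x ^ 2 + ε⁻¹) := by
              gcongr; exact ENNReal.le_mul_sq_add_inv h0 h1 _
          _ = _ := by ring
    _ = ε * ∫⁻ x in s, w x * u x ^ 2 ∂m + ε⁻¹ * ∫⁻ x in s, w x ∂m := by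
        rw [lintegral_add_left (by fun_prop), lintegral_const_mul _ (by fun_prop),
          lintegral_const_mul _ hw]
    _ ≤ _ := by
        gcongr
        exact (setLIntegral_le_lintegral _ _).trans hK

lemma exists_small_coeffs {K η : ℝ≥0∞} (hK : K ≠ ∞) (hη : η ≠ 0) :
    ∃ ε δ : ℝ≥0∞, ε ≠ 0 ∧ ε ≠ ∞ ∧ 0 < δ ∧ ∀ t ≤ δ, ε * K + ε⁻¹ * t ≤ η := by
  rcases eq_or_ne η ∞ with rfl | hη'
  · exact ⟨1, 1, by simp, by simp, by simp, fun t _ => le_top⟩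
  have h2 : η / 2 ≠ 0 := by simp [hη]
  have h2' : η / 2 ≠ ∞ := ENNReal.div_ne_top hη' (by simp)
  have hε0 : η / 2 / (K + 1) ≠ 0 := by
    rw [Ne, ENNReal.div_eq_zero_iff]; simp [h2, hK]
  have hε1 : η / 2 / (K + 1) ≠ ∞ := ENNReal.div_ne_top h2' (by simp)
  refine ⟨η / 2 / (K + 1), (η / 2 / (K + 1)) * (η / 2), hε0, hε1, ?_, fun t ht => ?_⟩
  · exact pos_iff_ne_zero.2 (mul_ne_zero hε0 h2)
  · calc η / 2 / (K + 1) * K + (η / 2 / (K + 1))⁻¹ * t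
        ≤ η / 2 / (K + 1) * (K + 1) + (η / 2 / (K + 1))⁻¹ * ((η / 2 / (K + 1)) * (η / 2)) := by
          gcongr; exact le_self_add
      _ = η / 2 + η / 2 := by
          rw [ENNReal.div_mul_cancel (by simp) (by simp [hK]), ← mul_assoc,
            ENNReal.inv_mul_cancel hε0 hε1, one_mul]
      _ = η := ENNReal.add_halves η

/-- **Differentiation under the integral sign with score functions.** Let `L θ` be probability
densities with respect to `m`, continuously differentiable in `θ`, with scores `s θ`, that is
`∇ L θ = L θ • s θ`. If `g` and `g • s θ` have locally bounded second moments, then the gradient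
of the expectation of `g` is the expectation of `g • s θ`. No local domination is required: the
second moments control the integrals outside of sets on which everything is bounded. -/
theorem hasGradientAt_integral_density {X : Type*} [MeasurableSpace X] {m : Measure X}
    [IsProbabilityMeasure m] {E : Type*} [NormedAddCommGroup E] [InnerProductSpace ℝ E]
    [FiniteDimensional ℝ E] [MeasurableSpace E] [BorelSpace E]
    {L : E → X → ℝ} {s : E → X → E} {g : X → ℝ} {θ₀ : E} {V : Set E} (hV : V ∈ 𝓝 θ₀)
    (hL0 : ∀ θ ∈ V, ∀ x, 0 ≤ L θ x) (hLm : ∀ θ ∈ V, Measurable (L θ))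
    (hsm : ∀ θ ∈ V, Measurable (s θ))
    (hder : ∀ θ ∈ V, ∀ x, HasGradientAt (fun θ => L θ x) (L θ x • s θ x) θ)
    (hcont : ∀ x, ContinuousOn (fun θ => L θ x • s θ x) V)
    (hone : ∀ θ ∈ V, ∫⁻ x, ENNReal.ofReal (L θ x) ∂m = 1) (hg : Measurable g)
    {K : ℝ≥0∞} (hK : K ≠ ∞)
    (hgK : ∀ θ ∈ V, ∫⁻ x, ENNReal.ofReal (L θ x) * ‖g x‖ₑ ^ 2 ∂m ≤ K)
    (hsK : ∀ θ ∈ V, ∫⁻ x, ENNReal.ofReal (L θ x) * (‖g x‖ₑ * ‖s θ x‖ₑ) ^ 2 ∂m ≤ K) :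
    HasGradientAt (fun θ => ∫ x, L θ x * g x ∂m) (∫ x, (L θ₀ x * g x) • s θ₀ x ∂m) θ₀ := by
  obtain ⟨r, hr, hrV⟩ := Metric.nhds_basis_closedBall.mem_iff.1 hV
  set B := Metric.closedBall θ₀ r with hB
  have hθ₀B : θ₀ ∈ B := Metric.mem_closedBall_self hr.le
  have hball : Metric.ball θ₀ r ⊆ B := Metric.ball_subset_closedBall
  -- the sets on which everything is bounded
  let Φ : E → X → ℝ := fun θ x => L θ x * (1 + |g x|) + |g x| * ‖L θ x • s θ x‖
  have hLc : ∀ x, ContinuousOn (fun θ => L θ x) B := fun x θ hθ =>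
    (hder θ (hrV hθ) x).continuousAt.continuousWithinAt
  have hΦc : ∀ x, ContinuousOn (fun θ => Φ θ x) B := fun x =>
    ((hLc x).mul continuousOn_const).add
      (continuousOn_const.mul ((hcont x).mono hrV).norm)
  have hΦm : ∀ θ ∈ B, Measurable (Φ θ) := fun θ hθ => by
    have h1 := hLm θ (hrV hθ)
    have h2 := hsm θ (hrV hθ)
    have h3 : Measurable fun x => |g x| := by fun_prop
    exact (h1.mul (measurable_const.add h3)).add (h3.mul (h1.smul h2).norm)
  let Xs : ℕ → Set X := fun k => {x | ∀ θ ∈ B, Φ θ x ≤ k}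
  have hXm : ∀ k, MeasurableSet (Xs k) := by
    intro k
    obtain ⟨D, hDB, hDc, hDd⟩ :=
      (TopologicalSpace.IsSeparable.of_separableSpace B).exists_countable_dense_subset
    have hcl : closure D ⊆ B := closure_minimal hDB Metric.isClosed_closedBall
    have : Xs k = ⋂ θ ∈ D, {x | Φ θ x ≤ k} := by
      ext x
      simp only [Xs, Set.mem_ofPred_eq, Set.mem_iInter]
      refine ⟨fun h θ hθ => h θ (hDB hθ), fun h θ hθ => ?_⟩
      exact le_on_closure (s := D) h ((hΦc x).mono hcl) continuousOn_const (hDd hθ)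
    rw [this]
    exact MeasurableSet.biInter hDc fun θ hθ => measurableSet_le (hΦm θ (hDB hθ)) measurable_const
  have hXmono : Monotone Xs := fun i j hij x hx θ hθ =>
    (hx θ hθ).trans (Nat.cast_le.2 hij)
  have hXU : ⋃ k, Xs k = Set.univ := by
    refine Set.eq_univ_of_forall fun x => ?_
    obtain ⟨C, hC⟩ := (isCompact_closedBall θ₀ r).bddAbove_image (hΦc x)
    obtain ⟨k, hk⟩ := exists_nat_ge C
    exact Set.mem_iUnion.2 ⟨k, fun θ hθ => (hC ⟨θ, hθ, rfl⟩).trans hk⟩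
  have hb1 : ∀ k, ∀ x ∈ Xs k, ∀ θ ∈ B, ‖L θ x‖ ≤ k := fun k x hx θ hθ => by
    have h0 := hL0 θ (hrV hθ) x
    have h := hx θ hθ
    have h1 : 0 ≤ L θ x * |g x| := by positivity
    have h2 : 0 ≤ |g x| * ‖L θ x • s θ x‖ := by positivity
    simp only [Φ] at h
    rw [Real.norm_of_nonneg h0]; linarith
  have hb2 : ∀ k, ∀ x ∈ Xs k, ∀ θ ∈ B, ‖L θ x * g x‖ ≤ k := fun k x hx θ hθ => by
    have h0 := hL0 θ (hrV hθ) x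
    have h := hx θ hθ
    have h2 : 0 ≤ |g x| * ‖L θ x • s θ x‖ := by positivity
    simp only [Φ] at h
    rw [norm_mul, Real.norm_of_nonneg h0, Real.norm_eq_abs]; linarith
  have hb3 : ∀ k, ∀ x ∈ Xs k, ∀ θ ∈ B, ‖(L θ x * g x) • s θ x‖ ≤ k := fun k x hx θ hθ => by
    have h0 := hL0 θ (hrV hθ) x
    have h := hx θ hθ
    have h1 : 0 ≤ L θ x * (1 + |g x|) := by positivity
    have h2 : (L θ x * g x) • s θ x = g x • (L θ x • s θ x) := by rw [smul_smul, mul_comm]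
    simp only [Φ] at h
    rw [h2, norm_smul, Real.norm_eq_abs]; linarith
  -- the derivative, as a linear form
  let F' : E → X → (E →L[ℝ] ℝ) := fun θ x => InnerProductSpace.toDual ℝ E ((L θ x * g x) • s θ x)
  have hF'n : ∀ θ x, ‖F' θ x‖ = ‖(L θ x * g x) • s θ x‖ := fun θ x =>
    (InnerProductSpace.toDual ℝ E).norm_map _
  have hvm : ∀ θ ∈ B, Measurable fun x => (L θ x * g x) • s θ x := fun θ hθ =>
    ((hLm θ (hrV hθ)).mul hg).smul (hsm θ (hrV hθ))
  have hF'm : ∀ θ ∈ B, AEStronglyMeasurable (F' θ) m := fun θ hθ =>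
    (InnerProductSpace.toDual ℝ E).continuous.comp_aestronglyMeasurable
      (hvm θ hθ).aestronglyMeasurable
  have hlow : ∀ θ ∈ B, ∀ x, ‖L θ x‖ₑ = ENNReal.ofReal (L θ x) := fun θ hθ x => by
    rw [← ofReal_norm, Real.norm_of_nonneg (hL0 θ (hrV hθ) x)]
  have hF'e : ∀ θ ∈ B, ∀ x, ‖F' θ x‖ₑ = ENNReal.ofReal (L θ x) * (‖g x‖ₑ * ‖s θ x‖ₑ) :=
    fun θ hθ x => by
      rw [← hlow θ hθ, ← mul_assoc, ← enorm_mul, ← enorm_smul, ← ofReal_norm, hF'n, ofReal_norm]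
  have hLe : ∀ θ ∈ B, Measurable fun x => ENNReal.ofReal (L θ x) := fun θ hθ =>
    (hLm θ (hrV hθ)).ennreal_ofReal
  have htail : ∀ θ ∈ B, ∀ (t : Set X) (ε : ℝ≥0∞), ε ≠ 0 → ε ≠ ∞ → ∫⁻ x in t, ‖F' θ x‖ₑ ∂m ≤
      ε * K + ε⁻¹ * ∫⁻ x in t, ENNReal.ofReal (L θ x) ∂m := by
    intro θ hθ t ε h0 h1
    simp_rw [hF'e θ hθ]
    exact setLIntegral_le_of_sq t (hLe θ hθ) (hg.enorm.mul (hsm θ (hrV hθ)).enorm) h0 h1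
      (hsK θ (hrV hθ))
  have hF'i : ∀ θ ∈ B, Integrable (F' θ) m := fun θ hθ => by
    refine ⟨hF'm θ hθ, ?_⟩
    have := htail θ hθ Set.univ 1 (by simp) (by simp)
    rw [Measure.restrict_univ, hone θ (hrV hθ)] at this
    exact this.trans_lt (by simpa using hK.lt_top)
  have hFi : ∀ θ ∈ B, Integrable (fun x => L θ x * g x) m := fun θ hθ => by
    refine ⟨((hLm θ (hrV hθ)).mul hg).aestronglyMeasurable, ?_⟩
    have := setLIntegral_le_of_sq (m := m) Set.univ (hLe θ hθ) hg.enorm (ε := 1) (by simp)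
      (by simp) (hgK θ (hrV hθ))
    rw [Measure.restrict_univ, hone θ (hrV hθ)] at this
    refine lt_of_le_of_lt (le_of_eq ?_) (this.trans_lt (by simpa using hK.lt_top))
    refine lintegral_congr fun x => ?_
    rw [enorm_mul, hlow θ hθ]
  -- the limit of the derivatives of the truncated integrals
  have hLi : ∀ θ ∈ B, Integrable (L θ) m := fun θ hθ => by
    refine ⟨(hLm θ (hrV hθ)).aestronglyMeasurable, ?_⟩
    have h : ∫⁻ x, ‖L θ x‖ₑ ∂m = 1 := by
      rw [← hone θ (hrV hθ)]; exact lintegral_congr fun x => hlow θ hθ x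
    exact lt_of_le_of_lt h.le (by simp)
  have hmain : HasFDerivAt (fun θ => ∫ x, L θ x * g x ∂m) (∫ x, F' θ₀ x ∂m) θ₀ := by
    refine hasFDerivAt_of_tendstoUniformlyOnFilter (l := atTop)
      (f := fun k θ => ∫ x in Xs k, L θ x * g x ∂m) (f' := fun k θ => ∫ x in Xs k, F' θ x ∂m)
      (g' := fun θ => ∫ x, F' θ x ∂m) ?_ ?_ ?_
    · rw [Metric.tendstoUniformlyOnFilter_iff]
      intro η hη
      obtain ⟨ε, δ, hε0, hε1, hδ, hεδ⟩ := exists_small_coeffs (η := ENNReal.ofReal (η / 2)) hK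
        (by simpa using hη)
      have htendsto : Tendsto (fun k => ∫⁻ x in (Xs k)ᶜ, ENNReal.ofReal (L θ₀ x) ∂m) atTop
          (𝓝 0) := by
        have hfin : IsFiniteMeasure (m.withDensity fun x => ENNReal.ofReal (L θ₀ x)) :=
          isFiniteMeasure_withDensity (by rw [hone θ₀ (hrV hθ₀B)]; simp)
        have h := tendsto_measure_iInter_atTop
          (μ := m.withDensity fun x => ENNReal.ofReal (L θ₀ x)) (s := fun k => (Xs k)ᶜ)
          (fun k => (hXm k).compl.nullMeasurableSet)
          (fun i j hij => Set.compl_subset_compl.2 (hXmono hij)) ⟨0, measure_ne_top _ _⟩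
        rw [← Set.compl_iUnion, hXU, Set.compl_univ, measure_empty] at h
        refine h.congr fun k => ?_
        exact withDensity_apply _ (hXm k).compl
      obtain ⟨k₀, hk₀⟩ := (htendsto.eventually (gt_mem_nhds hδ)).exists
      -- the densities have integral one, so the mass outside `Xs k₀` is continuous in `θ`
      have hreal : ∀ θ ∈ B, ∫⁻ x in (Xs k₀)ᶜ, ENNReal.ofReal (L θ x) ∂m =
          ENNReal.ofReal (1 - ∫ x in Xs k₀, L θ x ∂m) := by
        intro θ hθ
        have h1 : ∫ x, L θ x ∂m = 1 := by
          rw [integral_eq_lintegral_of_nonneg_ae (.of_forall (hL0 θ (hrV hθ)))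
            (hLm θ (hrV hθ)).aestronglyMeasurable, hone θ (hrV hθ)]; simp
        rw [← h1, ← setIntegral_compl (hXm k₀) (hLi θ hθ), ofReal_integral_eq_lintegral_ofReal
          (hLi θ hθ).integrableOn (.of_forall (hL0 θ (hrV hθ)))]
      have hcontk : ContinuousAt (fun θ => ∫ x in Xs k₀, L θ x ∂m) θ₀ := by
        refine continuousAt_of_dominated (bound := fun _ => (k₀ : ℝ)) ?_ ?_
          (integrable_const _) ?_
        · filter_upwards [hV] with θ hθ using (hLm θ hθ).aestronglyMeasurable
        · filter_upwards [Metric.closedBall_mem_nhds θ₀ hr] with θ hθ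
          exact ae_restrict_of_forall_mem (hXm k₀) fun x hx => hb1 k₀ x hx θ hθ
        · exact .of_forall fun x => (hder θ₀ (hrV hθ₀B) x).continuousAt
      have hev : ∀ᶠ θ in 𝓝 θ₀, ∫⁻ x in (Xs k₀)ᶜ, ENNReal.ofReal (L θ x) ∂m < δ := by
        have hc : ContinuousAt (fun θ => ENNReal.ofReal (1 - ∫ x in Xs k₀, L θ x ∂m)) θ₀ :=
          ENNReal.continuous_ofReal.continuousAt.comp (continuousAt_const.sub hcontk)
        have h := hc.tendsto.eventually_lt_const (u := δ) (by rw [← hreal θ₀ hθ₀B]; exact hk₀)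
        filter_upwards [h, Metric.closedBall_mem_nhds θ₀ hr] with θ h1 h2
        rw [hreal θ h2]; exact h1
      refine ((eventually_ge_atTop k₀).prod_mk (hev.and (Metric.closedBall_mem_nhds θ₀ hr))).mono ?_
      rintro ⟨k, θ⟩ ⟨hk, hθδ, hθ⟩
      simp only at hk hθδ hθ ⊢
      rw [dist_eq_norm, ← integral_add_compl (hXm k) (hF'i θ hθ), add_sub_cancel_left]
      refine lt_of_le_of_lt ?_ (half_lt_self hη)
      rw [← ENNReal.ofReal_le_ofReal_iff (by positivity), ofReal_norm]
      refine (enorm_integral_le_lintegral_enorm _).trans ((htail θ hθ _ ε hε0 hε1).trans ?_)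
      exact hεδ _ ((lintegral_mono_set (Set.compl_subset_compl.2 (hXmono hk))).trans hθδ.le)
    · refine (Eventually.of_forall fun k => True.intro).prod_mk
        (Metric.ball_mem_nhds θ₀ hr) |>.mono ?_
      rintro ⟨k, θ⟩ ⟨-, hθ⟩
      have hnb : Metric.ball θ₀ r ∈ 𝓝 θ := Metric.isOpen_ball.mem_nhds hθ
      refine hasFDerivAt_integral_of_dominated_of_fderiv_le (bound := fun _ => (k : ℝ)) hnb
        ?_ (hFi θ (hball hθ)).integrableOn (hF'm θ (hball hθ)).restrict ?_
        (integrable_const _) ?_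
      · filter_upwards [hnb] with θ' hθ'
        exact (hFi θ' (hball hθ')).aestronglyMeasurable.restrict
      · exact ae_restrict_of_forall_mem (hXm k) fun x hx θ' hθ' => by
          rw [hF'n]; exact hb3 k x hx θ' (hball hθ')
      · refine .of_forall fun x θ' hθ' => ?_
        have h := (hder θ' (hrV (hball hθ')) x).hasFDerivAt.mul_const (g x)
        refine h.congr_fderiv ?_
        ext v
        simp [F']
        ring
    · filter_upwards [Metric.closedBall_mem_nhds θ₀ hr] with θ hθ
      have h := tendsto_setIntegral_of_monotone (μ := m) (f := fun x => L θ x * g x) hXm hXmono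
        (hFi θ hθ).integrableOn
      rwa [hXU, setIntegral_univ] at h
  rw [hasGradientAt_iff_hasFDerivAt]
  refine hmain.congr_fderiv ?_
  ext v
  have hvi : Integrable (fun x => (L θ₀ x * g x) • s θ₀ x) m := by
    refine (hF'i θ₀ hθ₀B).norm.mono' (hvm θ₀ hθ₀B).aestronglyMeasurable (.of_forall fun x => ?_)
    rw [hF'n]
  rw [ContinuousLinearMap.integral_apply (hF'i θ₀ hθ₀B)]
  simp only [F', InnerProductSpace.toDual_apply_apply]
  rw [real_inner_comm, ← integral_inner hvi]
  simp_rw [real_inner_comm v]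

end ScoreDifferentiation

/-! ### Likelihood ratios and scores of the parameterized policies -/

section Policy

variable {S A : Type*} [MeasurableSpace S] [MeasurableSpace A] {d : ℕ}
  (M : MDP S A) (Q : ParamPolicy d S A) {θ : EuclideanSpace ℝ (Fin d)}

lemma ParamPolicy.differentiableAt (hθ : θ ∈ Q.U) (s : S) (a : A) :
    DifferentiableAt ℝ (fun θ => Q.p θ s a) θ :=
  ((Q.contDiffOn s a).differentiableOn one_ne_zero).differentiableAt (Q.isOpen_U.mem_nhds hθ)

/-- The score is `∇p / p`. Where the density vanishes both sides are `0`: there `log p` is either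
not differentiable, or `p` vanishes in a neighbourhood. -/
lemma ParamPolicy.score_eq (hθ : θ ∈ Q.U) (z : S × A) :
    Q.score θ z = (Q.p θ z.1 z.2)⁻¹ • gradient (fun θ' => Q.p θ' z.1 z.2) θ := by
  have hd := Q.differentiableAt hθ z.1 z.2
  by_cases hp : Q.p θ z.1 z.2 = 0
  · rw [hp, inv_zero, zero_smul, ParamPolicy.score, gradient]
    by_cases hl : DifferentiableAt ℝ (fun θ' => Real.log (Q.p θ' z.1 z.2)) θ
    · have h1 : ∀ᶠ θ' in 𝓝 θ, -1 < Real.log (Q.p θ' z.1 z.2) :=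
        hl.continuousAt.tendsto.eventually_const_lt (by simp [hp])
      have h2 : ∀ᶠ θ' in 𝓝 θ, Q.p θ' z.1 z.2 < Real.exp (-1) :=
        hd.continuousAt.tendsto.eventually_lt_const (by rw [hp]; exact Real.exp_pos _)
      have h3 : (fun θ' => Real.log (Q.p θ' z.1 z.2)) =ᶠ[𝓝 θ] fun _ => 0 := by
        filter_upwards [h1, h2, Q.isOpen_U.mem_nhds hθ] with θ' h1 h2 hU
        rcases (Q.p_nonneg θ' hU z.1 z.2).eq_or_lt with h | h
        · simp [← h]
        · have := (Real.log_lt_iff_lt_exp h).2 h2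
          linarith
      rw [h3.fderiv_eq]
      simp
    · rw [fderiv_zero_of_not_differentiableAt hl, map_zero]
  · have h := (hd.hasFDerivAt.log hp).fderiv
    rw [ParamPolicy.score, gradient, h, gradient, map_smul]

/-- The score identity `∇p = p ∇ log p`, valid also where `p` vanishes, since there `p` has a
minimum. -/
lemma ParamPolicy.hasGradientAt_p (hθ : θ ∈ Q.U) (z : S × A) :
    HasGradientAt (fun θ' => Q.p θ' z.1 z.2) (Q.p θ z.1 z.2 • Q.score θ z) θ := by
  have hd := Q.differentiableAt hθ z.1 z.2
  rw [Q.score_eq hθ]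
  by_cases hp : Q.p θ z.1 z.2 = 0
  · have hmin : IsLocalMin (fun θ' => Q.p θ' z.1 z.2) θ := by
      filter_upwards [Q.isOpen_U.mem_nhds hθ] with θ' hU
      rw [hp]; exact Q.p_nonneg θ' hU _ _
    have h0 := hmin.fderiv_eq_zero
    rw [hp, zero_smul, hasGradientAt_iff_hasFDerivAt, map_zero, ← h0]
    exact hd.hasFDerivAt
  · rw [smul_smul, mul_inv_cancel₀ hp, one_smul]
    exact hd.hasGradientAt

lemma ParamPolicy.continuousOn_gradient (s : S) (a : A) :
    ContinuousOn (fun θ => gradient (fun θ' => Q.p θ' s a) θ) Q.U :=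
  (InnerProductSpace.toDual ℝ _).symm.continuous.comp_continuousOn
    ((Q.contDiffOn s a).continuousOn_fderiv_of_isOpen Q.isOpen_U le_rfl)

lemma ParamPolicy.measurable_gradient (hθ : θ ∈ Q.U) :
    Measurable fun z : S × A => gradient (fun θ' => Q.p θ' z.1 z.2) θ := by
  classical
  have hdir : ∀ v, Measurable fun z : S × A => fderiv ℝ (fun θ' => Q.p θ' z.1 z.2) θ v := by
    intro v
    let pt : EuclideanSpace ℝ (Fin d) → S × A → ℝ := fun θ' z =>
      if θ' ∈ Q.U then Q.p θ' z.1 z.2 else 0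
    have hpt : ∀ θ', Measurable (pt θ') := fun θ' => by
      by_cases h : θ' ∈ Q.U
      · simpa [pt, h] using Q.measurable_p θ' h
      · simp [pt, h]
    refine measurable_of_tendsto_metrizable
      (f := fun (n : ℕ) z => (n : ℝ) • (pt (θ + (n : ℝ)⁻¹ • v) z - pt θ z))
      (fun n => ((hpt (θ + (n : ℝ)⁻¹ • v)).sub (hpt θ)).const_smul (n : ℝ)) ?_
    rw [tendsto_pi_nhds]
    intro z
    have hlim := (Q.differentiableAt hθ z.1 z.2).hasFDerivAt.lim v (l := atTop)
      (c := fun n : ℕ => (n : ℝ)) (by simpa using tendsto_natCast_atTop_atTop (R := ℝ))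
    refine hlim.congr' ?_
    have hU : ∀ᶠ n : ℕ in atTop, θ + (n : ℝ)⁻¹ • v ∈ Q.U := by
      have ht : Tendsto (fun n : ℕ => θ + (n : ℝ)⁻¹ • v) atTop (𝓝 (θ + (0 : ℝ) • v)) :=
        tendsto_const_nhds.add (tendsto_inv_atTop_nhds_zero_nat.smul_const v)
      rw [zero_smul, add_zero] at ht
      exact ht.eventually (Q.isOpen_U.mem_nhds hθ)
    filter_upwards [hU] with n hn
    simp [pt, hn, hθ]
  have hcoord : ∀ z : S × A, gradient (fun θ' => Q.p θ' z.1 z.2) θ =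
      WithLp.toLp 2 fun i => fderiv ℝ (fun θ' => Q.p θ' z.1 z.2) θ (EuclideanSpace.single i 1) := by
    intro z
    ext i
    have : gradient (fun θ' => Q.p θ' z.1 z.2) θ i =
        inner ℝ (gradient (fun θ' => Q.p θ' z.1 z.2) θ) (EuclideanSpace.single i (1 : ℝ)) := by
      rw [EuclideanSpace.inner_single_right]; simp
    change _ = fderiv ℝ (fun θ' => Q.p θ' z.1 z.2) θ (EuclideanSpace.single i 1)
    rw [this, gradient, InnerProductSpace.toDual_symm_apply]
  simp_rw [hcoord]
  exact (PiLp.continuous_toLp 2 _).measurable.comp (measurable_pi_lambda _ fun i => hdir _)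

lemma ParamPolicy.measurable_p_prod :
    Measurable fun w : Q.U × (S × A) => Q.p w.1 w.2.1 w.2.2 := by
  refine measurable_uncurry_of_continuous_of_measurable
    (u := fun (θ : Q.U) (z : S × A) => Q.p θ z.1 z.2) (fun z => ?_) fun θ => Q.measurable_p θ θ.2
  exact continuousOn_iff_continuous_domRestrict.1 (Q.contDiffOn z.1 z.2).continuousOn

/-- The score is jointly measurable in the parameter and the state-action pair. -/
lemma ParamPolicy.measurable_score_prod :
    Measurable fun w : Q.U × (S × A) => Q.score w.1 w.2 := by
  have h : Measurable fun w : Q.U × (S × A) => gradient (fun θ' => Q.p θ' w.2.1 w.2.2) w.1 := by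
    refine measurable_uncurry_of_continuous_of_measurable
      (u := fun (θ : Q.U) (z : S × A) => gradient (fun θ' => Q.p θ' z.1 z.2) θ) (fun z => ?_)
      fun θ => Q.measurable_gradient θ.2
    exact continuousOn_iff_continuous_domRestrict.1 (Q.continuousOn_gradient z.1 z.2)
  have h2 : (fun w : Q.U × (S × A) => Q.score w.1 w.2) = fun w =>
      (Q.p w.1 w.2.1 w.2.2)⁻¹ • gradient (fun θ' => Q.p θ' w.2.1 w.2.2) w.1 :=
    funext fun w => Q.score_eq w.1.2 w.2
  rw [h2]
  exact Q.measurable_p_prod.inv.smul h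

lemma ParamPolicy.measurable_score (hθ : θ ∈ Q.U) : Measurable (Q.score θ) :=
  Q.measurable_score_prod.comp (measurable_prodMk_left (x := (⟨θ, hθ⟩ : Q.U)))

/-! ### Change of measure to a fixed reference law -/

lemma ParamPolicy.neZero_ν (hθ : θ ∈ Q.U) (s : S) : NeZero Q.ν := by
  refine ⟨fun h => ?_⟩
  have h1 : Q.π θ s Set.univ = 1 := measure_univ
  rw [Q.density θ hθ s, h] at h1
  simp at h1

/-- The density of `Q.ν` with respect to an equivalent probability measure. -/
def ParamPolicy.weight (a : A) : ℝ := (Q.ν.rnDeriv Q.ν.toFinite a).toReal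

lemma ParamPolicy.measurable_weight : Measurable Q.weight :=
  (Measure.measurable_rnDeriv _ _).ennreal_toReal

lemma ParamPolicy.weight_nonneg (a : A) : 0 ≤ Q.weight a := ENNReal.toReal_nonneg

lemma ParamPolicy.withDensity_weight :
    Q.ν.toFinite.withDensity (fun a => ENNReal.ofReal (Q.weight a)) = Q.ν := by
  conv_rhs => rw [← Measure.withDensity_rnDeriv_eq Q.ν Q.ν.toFinite
    (absolutelyContinuous_toFinite Q.ν)]
  refine withDensity_congr_ae ?_
  filter_upwards [Measure.rnDeriv_lt_top Q.ν Q.ν.toFinite] with a ha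
  exact ENNReal.ofReal_toReal ha.ne

/-- The likelihood ratio of the first `n` actions under `π_θ`, with respect to actions that are
drawn independently from a fixed probability measure equivalent to `Q.ν`. -/
def ParamPolicy.likelihood (n : ℕ) (θ : EuclideanSpace ℝ (Fin d)) (x : ℕ → S × A) : ℝ :=
  ∏ i ∈ Finset.range n, Q.p θ (x i).1 (x i).2 * Q.weight (x i).2

lemma ParamPolicy.likelihood_nonneg (hθ : θ ∈ Q.U) (n : ℕ) (x : ℕ → S × A) :
    0 ≤ Q.likelihood n θ x :=
  Finset.prod_nonneg fun _ _ => mul_nonneg (Q.p_nonneg θ hθ _ _) (Q.weight_nonneg _)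

lemma ParamPolicy.measurable_likelihood_prod (n : ℕ) :
    Measurable fun w : Q.U × (ℕ → S × A) => Q.likelihood n w.1 w.2 := by
  refine Finset.measurable_prod _ fun i _ => Measurable.mul ?_ ?_
  · exact Q.measurable_p_prod.comp (f := fun w : Q.U × (ℕ → S × A) => (w.1, w.2 i)) (by fun_prop)
  · exact Q.measurable_weight.comp (by fun_prop)

lemma ParamPolicy.measurable_likelihood (hθ : θ ∈ Q.U) (n : ℕ) :
    Measurable (Q.likelihood n θ) :=
  (Q.measurable_likelihood_prod n).comp (measurable_prodMk_left (x := (⟨θ, hθ⟩ : Q.U)))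

/-- The score of the first `n` actions is the sum of the scores of the actions. -/
lemma ParamPolicy.hasGradientAt_likelihood (hθ : θ ∈ Q.U) (n : ℕ) (x : ℕ → S × A) :
    HasGradientAt (fun θ => Q.likelihood n θ x)
      (Q.likelihood n θ x • ∑ i ∈ Finset.range n, Q.score θ (x i)) θ := by
  induction n with
  | zero =>
    simp only [ParamPolicy.likelihood, Finset.range_zero, Finset.prod_empty, Finset.sum_empty,
      smul_zero]
    exact hasGradientAt_const θ 1
  | succ n ih =>
    have h1 : HasFDerivAt (fun θ => Q.p θ (x n).1 (x n).2 * Q.weight (x n).2) _ θ :=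
      (Q.hasGradientAt_p hθ (x n)).hasFDerivAt.mul_const (Q.weight (x n).2)
    have h2 := ih.hasFDerivAt.mul h1
    have h3 : (fun θ => Q.likelihood (n + 1) θ x) = fun θ => Q.likelihood n θ x *
        (Q.p θ (x n).1 (x n).2 * Q.weight (x n).2) := by
      ext θ; simp [ParamPolicy.likelihood, Finset.prod_range_succ]
    rw [h3, hasGradientAt_iff_hasFDerivAt]
    refine h2.congr_fderiv ?_
    rw [show Q.likelihood (n + 1) θ x = Q.likelihood n θ x *
        (Q.p θ (x n).1 (x n).2 * Q.weight (x n).2) from congrFun h3 θ, Finset.sum_range_succ]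
    ext v
    simp
    ring

lemma ParamPolicy.contDiffOn_likelihood (n : ℕ) (x : ℕ → S × A) :
    ContDiffOn ℝ 1 (fun θ => Q.likelihood n θ x) Q.U :=
  contDiffOn_prod fun _ _ => (Q.contDiffOn _ _).mul contDiffOn_const

lemma ParamPolicy.continuousOn_likelihood_smul_score (n : ℕ) (x : ℕ → S × A) :
    ContinuousOn (fun θ => Q.likelihood n θ x • ∑ i ∈ Finset.range n, Q.score θ (x i)) Q.U := by
  have h : ContinuousOn (fun θ => gradient (fun θ' => Q.likelihood n θ' x) θ) Q.U :=
    (InnerProductSpace.toDual ℝ _).symm.continuous.comp_continuousOn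
      ((Q.contDiffOn_likelihood n x).continuousOn_fderiv_of_isOpen Q.isOpen_U le_rfl)
  exact h.congr fun θ hθ => (Q.hasGradientAt_likelihood hθ n x).gradient.symm

/-- The law of the trajectory when the actions are drawn independently from a fixed probability
measure equivalent to `Q.ν`. -/
def refLaw [NeZero Q.ν] : Measure (ℕ → S × A) :=
  pathLaw M.P (Kernel.const S Q.ν.toFinite) M.s₀

instance [NeZero Q.ν] : IsProbabilityMeasure (refLaw M Q) := by unfold refLaw; infer_instance

instance (θ : EuclideanSpace ℝ (Fin d)) : IsProbabilityMeasure (trajLaw M Q θ) := by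
  rw [trajLaw_eq_pathLaw]; infer_instance

/-- Importance sampling: expectations of functions of the first `n` actions under `π_θ` as
expectations under the reference law, with the likelihood ratio as weight. -/
lemma lintegral_trajLaw_eq_refLaw [NeZero Q.ν] (hθ : θ ∈ Q.U) {n : ℕ}
    {g : (ℕ → S × A) → ℝ≥0∞} (hg : Measurable g) (hgn : DeterminedBy n g) :
    ∫⁻ x, g x ∂trajLaw M Q θ =
      ∫⁻ x, ENNReal.ofReal (Q.likelihood n θ x) * g x ∂refLaw M Q := by
  have hpw : Measurable fun z : S × A => Q.p θ z.1 z.2 * Q.weight z.2 :=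
    (Q.measurable_p θ hθ).mul (Q.measurable_weight.comp measurable_snd)
  rw [trajLaw_eq_pathLaw, refLaw, lintegral_pathLaw_withDensity M.P (Q.π θ)
    (Kernel.const S Q.ν.toFinite)
    (q := fun z => ENNReal.ofReal (Q.p θ z.1 z.2 * Q.weight z.2)) hpw.ennreal_ofReal
    (fun s => ?_) n M.s₀ hg hgn]
  · refine lintegral_congr fun x => ?_
    rw [ParamPolicy.likelihood, ENNReal.ofReal_prod_of_nonneg fun i _ =>
      mul_nonneg (Q.p_nonneg θ hθ _ _) (Q.weight_nonneg _)]
  · rw [Q.density θ hθ s, Kernel.const_apply]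
    conv_lhs => rw [← Q.withDensity_weight]
    rw [← withDensity_mul _ Q.measurable_weight.ennreal_ofReal
      (g := fun a => ENNReal.ofReal (Q.p θ s a))
      (((Q.measurable_p θ hθ).comp measurable_prodMk_left).ennreal_ofReal)]
    congr 1
    ext a
    rw [Pi.mul_apply, mul_comm, ← ENNReal.ofReal_mul (Q.p_nonneg θ hθ s a)]

lemma lintegral_likelihood [NeZero Q.ν] (hθ : θ ∈ Q.U) (n : ℕ) :
    ∫⁻ x, ENNReal.ofReal (Q.likelihood n θ x) ∂refLaw M Q = 1 := by
  have h := lintegral_trajLaw_eq_refLaw M Q hθ (n := n) (g := fun _ => 1) measurable_const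
    (fun _ _ _ _ => rfl)
  simpa using h.symm

/-- The law of the trajectory, as a kernel from the parameters in `Q.U`. -/
def trajKernel : Kernel Q.U (ℕ → S × A) where
  toFun θ := trajLaw M Q θ
  measurable' := by
    refine Measurable.measure_of_isPiSystem_of_isProbabilityMeasure
      (generateFrom_measurableCylinders (α := fun _ : ℕ => S × A)).symm
      isPiSystem_measurableCylinders fun B hB => ?_
    by_cases hU : Nonempty Q.U
    swap
    · have := not_nonempty_iff.1 hU
      exact measurable_of_empty _
    obtain ⟨θ₁⟩ := hU
    have : NeZero Q.ν := Q.neZero_ν θ₁.2 M.s₀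
    have hBm := MeasurableSet.of_mem_measurableCylinders hB
    obtain ⟨I, T, -, rfl⟩ := (mem_measurableCylinders _).1 hB
    have hdet : DeterminedBy (I.sup id + 1) ((cylinder I T).indicator (fun _ => (1 : ℝ≥0∞))) := by
      intro x x' h1 _
      have : I.restrict x = I.restrict x' := by
        ext1 i
        exact h1 i (Nat.lt_succ_of_le (Finset.le_sup (f := id) i.2))
      have hm : x ∈ cylinder I T ↔ x' ∈ cylinder I T := by
        rw [mem_cylinder, mem_cylinder]; exact this ▸ Iff.rfl
      by_cases h : x ∈ cylinder I T
      · rw [Set.indicator_of_mem h, Set.indicator_of_mem (hm.1 h)]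
      · rw [Set.indicator_of_notMem h, Set.indicator_of_notMem (mt hm.2 h)]
    have h : ∀ θ : Q.U, trajLaw M Q θ (cylinder I T) = ∫⁻ x,
        ENNReal.ofReal (Q.likelihood (I.sup id + 1) θ x) *
          (cylinder I T).indicator (fun _ => 1) x ∂refLaw M Q := fun θ => by
      rw [← lintegral_trajLaw_eq_refLaw M Q θ.2 (measurable_const.indicator hBm) hdet,
        lintegral_indicator_const hBm, one_mul]
    simp_rw [h]
    exact Measurable.lintegral_prod_right' (f := fun w : Q.U × (ℕ → S × A) =>
      ENNReal.ofReal (Q.likelihood (I.sup id + 1) w.1 w.2) * (cylinder I T).indicator (fun _ => 1) w.2)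
      ((Q.measurable_likelihood_prod _).ennreal_ofReal.mul
        ((measurable_const.indicator hBm).comp measurable_snd))

lemma trajKernel_apply (θ : Q.U) : trajKernel M Q θ = trajLaw M Q θ := rfl

instance : IsMarkovKernel (trajKernel M Q) :=
  ⟨fun θ => by rw [trajKernel_apply]; infer_instance⟩

end Policy

/-! ### Return times and the first cycle -/

section Cycle

variable {S A : Type*}

lemma lt_returnTime_succ_iff (s₀ : S) (x : ℕ → S × A) (n t : ℕ) :
    (t : ℕ∞) < returnTime s₀ x (n + 1) ↔
      ∀ j : ℕ, returnTime s₀ x n < j → (x j).1 = s₀ → t < j := by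
  rw [returnTime]
  constructor
  · intro h j h1 h2
    exact Nat.cast_lt.1 (h.trans_le (sInf_le ⟨j, rfl, h1, h2⟩))
  · intro h
    rcases Set.eq_empty_or_nonempty
      {k : ℕ∞ | ∃ t : ℕ, k = t ∧ returnTime s₀ x n < t ∧ (x t).1 = s₀} with h0 | h0
    · rw [h0, sInf_empty]; exact ENat.natCast_lt_top t
    · obtain ⟨j, hj, h1, h2⟩ := csInf_mem h0
      rw [hj]
      exact Nat.cast_lt.2 (h j h1 h2)

lemma enat_eq_of_forall_lt_iff {a b : ℕ∞} (h : ∀ t : ℕ, (t : ℕ∞) < a ↔ (t : ℕ∞) < b) : a = b := by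
  refine le_antisymm (le_of_not_gt fun hlt => ?_) (le_of_not_gt fun hlt => ?_)
  · lift b to ℕ using hlt.ne_top
    exact lt_irrefl _ ((h b).1 hlt)
  · lift a to ℕ using hlt.ne_top
    exact lt_irrefl _ ((h a).2 hlt)

/-- The trajectories that have not returned to `s₀` up to time `t`. -/
def alive (s₀ : S) (t : ℕ) : Set (ℕ → S × A) := {x | ∀ j, 1 ≤ j → j ≤ t → (x j).1 ≠ s₀}

lemma mem_alive_iff (s₀ : S) (x : ℕ → S × A) (t : ℕ) :
    x ∈ alive s₀ t ↔ (t : ℕ∞) < returnTime s₀ x 1 := by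
  rw [lt_returnTime_succ_iff]
  simp only [returnTime, Nat.cast_pos, alive, Set.mem_ofPred_eq]
  refine ⟨fun h j h1 h2 => lt_of_not_ge fun h3 => h j h1 h3 h2, fun h j h1 h2 h3 => ?_⟩
  exact absurd (h j h1 h3) (not_lt.2 h2)

lemma mem_cycle_zero (s₀ : S) (x : ℕ → S × A) (t : ℕ) :
    t ∈ cycle s₀ x 0 ↔ x ∈ alive s₀ t := by
  rw [mem_alive_iff]; simp [cycle, returnTime]

lemma alive_zero (s₀ : S) : (alive s₀ 0 : Set (ℕ → S × A)) = Set.univ := by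
  ext x; simp only [alive, Set.mem_ofPred_eq, Set.mem_univ, iff_true]; intro j h1 h2; omega

lemma alive_anti (s₀ : S) : Antitone (alive s₀ : ℕ → Set (ℕ → S × A)) :=
  fun _ _ h _ hx j h1 h2 => hx j h1 (h2.trans h)

/-- The trajectories that return to `s₀` for the first time at time `k + 1`. -/
def firstReturn (s₀ : S) (k : ℕ) : Set (ℕ → S × A) := alive s₀ k \ alive s₀ (k + 1)

lemma returnTime_of_mem_firstReturn {s₀ : S} {x : ℕ → S × A} {k : ℕ}
    (hx : x ∈ firstReturn s₀ k) : returnTime s₀ x 1 = (k + 1 : ℕ) := by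
  obtain ⟨h1, h2⟩ := hx
  rw [mem_alive_iff] at h1 h2
  refine le_antisymm (not_lt.1 h2) ?_
  rw [Nat.cast_add, Nat.cast_one]
  exact Order.add_one_le_of_lt h1

lemma mem_firstReturn_iff {s₀ : S} {x : ℕ → S × A} {k : ℕ} :
    x ∈ firstReturn s₀ k ↔ returnTime s₀ x 1 = (k + 1 : ℕ) := by
  refine ⟨returnTime_of_mem_firstReturn, fun h => ?_⟩
  rw [firstReturn, Set.mem_sdiff, mem_alive_iff, mem_alive_iff, h]
  exact ⟨Nat.cast_lt.2 (Nat.lt_succ_self k), lt_irrefl _⟩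

lemma mem_alive_of_mem_firstReturn {s₀ : S} {x : ℕ → S × A} {k : ℕ}
    (hx : x ∈ firstReturn s₀ k) (t : ℕ) : x ∈ alive s₀ t ↔ t < k + 1 := by
  rw [mem_alive_iff, returnTime_of_mem_firstReturn hx, Nat.cast_lt]

lemma state_of_mem_firstReturn {s₀ : S} {x : ℕ → S × A} {k : ℕ}
    (hx : x ∈ firstReturn s₀ k) : (x (k + 1)).1 = s₀ := by
  by_contra h
  refine hx.2 fun j h1 h2 => ?_
  rcases h2.lt_or_eq with h3 | rfl
  · exact hx.1 j h1 (by omega)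
  · exact h

lemma pairwise_disjoint_firstReturn (s₀ : S) :
    Pairwise (Function.onFun Disjoint (firstReturn s₀ : ℕ → Set (ℕ → S × A))) := by
  intro i j hij
  refine Set.disjoint_left.2 fun x hi hj => hij ?_
  have h := (returnTime_of_mem_firstReturn hi).symm.trans (returnTime_of_mem_firstReturn hj)
  have := Nat.cast_injective (R := ℕ∞) h
  omega

/-- A trajectory either never returns to `s₀`, or it has a first return time. -/
lemma alive_or_firstReturn (s₀ : S) (x : ℕ → S × A) :
    (∀ t, x ∈ alive s₀ t) ∨ ∃ k, x ∈ firstReturn s₀ k := by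
  classical
  by_cases h : ∀ t, x ∈ alive s₀ t
  · exact Or.inl h
  · push Not at h
    right
    have h0 : Nat.find h ≠ 0 := fun h0 => by
      have := Nat.find_spec h
      rw [h0, alive_zero] at this
      exact this (Set.mem_univ x)
    obtain ⟨k, hk⟩ := Nat.exists_eq_succ_of_ne_zero h0
    refine ⟨k, ?_, ?_⟩
    · by_contra hc
      have := Nat.find_min' h hc
      omega
    · have := Nat.find_spec h
      rwa [hk] at this

lemma determinedBy_mem_alive (s₀ : S) (t : ℕ) :
    DeterminedBy t (fun x : ℕ → S × A => x ∈ alive s₀ t) := by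
  intro x x' h1 h2
  simp only [alive, Set.mem_ofPred_eq, eq_iff_iff]
  refine forall_congr' fun j => forall_congr' fun _ => forall_congr' fun h3 => ?_
  rcases h3.lt_or_eq with h | rfl
  · rw [h1 j h]
  · rw [h2]

lemma determinedBy_mem_firstReturn (s₀ : S) (k : ℕ) :
    DeterminedBy (k + 1) (fun x : ℕ → S × A => x ∈ firstReturn s₀ k) := by
  intro x x' h1 h2
  have h3 := (determinedBy_mem_alive s₀ k).mono (Nat.le_succ k) h1 h2
  have h4 := determinedBy_mem_alive s₀ (k + 1) h1 h2
  simp only [eq_iff_iff] at h3 h4 ⊢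
  rw [firstReturn, Set.mem_sdiff, Set.mem_sdiff, h3, h4]

lemma DeterminedBy.indicator {β : Type*} [Zero β] {n : ℕ} {s : Set (ℕ → S × A)}
    {g : (ℕ → S × A) → β} (hs : DeterminedBy n (fun x => x ∈ s)) (hg : DeterminedBy n g) :
    DeterminedBy n (s.indicator g) := by
  intro x x' h1 h2
  have h3 : x ∈ s ↔ x' ∈ s := eq_iff_iff.1 (hs h1 h2)
  by_cases h : x ∈ s
  · rw [Set.indicator_of_mem h, Set.indicator_of_mem (h3.1 h), hg h1 h2]
  · rw [Set.indicator_of_notMem h, Set.indicator_of_notMem (mt h3.2 h)]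

variable [MeasurableSpace S] [MeasurableSingletonClass S] [MeasurableSpace A]

lemma measurableSet_alive (s₀ : S) (t : ℕ) :
    MeasurableSet (alive s₀ t : Set (ℕ → S × A)) := by
  simp only [alive, Set.ofPred_forall]
  refine MeasurableSet.iInter fun j => MeasurableSet.iInter fun _ => MeasurableSet.iInter fun _ => ?_
  exact ((measurable_fst.comp (measurable_pi_apply j)) (measurableSet_singleton s₀)).compl

lemma measurableSet_firstReturn (s₀ : S) (k : ℕ) :
    MeasurableSet (firstReturn s₀ k : Set (ℕ → S × A)) :=
  (measurableSet_alive s₀ k).diff (measurableSet_alive s₀ (k + 1))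

end Cycle

/-! ### The strong Markov property at the first return, and the renewal equation -/

section Renewal

variable {S A : Type*} [MeasurableSpace S] [MeasurableSingletonClass S] [MeasurableSpace A] {d : ℕ}
  (M : MDP S A) (Q : ParamPolicy d S A) (θ : EuclideanSpace ℝ (Fin d))

lemma setLIntegral_firstReturn_shift (k : ℕ) {f : (ℕ → S × A) → ℝ≥0∞} (hf : Measurable f) :
    ∫⁻ x, (firstReturn M.s₀ k).indicator (fun x => f (shift (k + 1) x)) x ∂trajLaw M Q θ =
      trajLaw M Q θ (firstReturn M.s₀ k) * ∫⁻ x, f x ∂trajLaw M Q θ := by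
  have hm : MeasurableSet (firstReturn M.s₀ k : Set (ℕ → S × A)) := measurableSet_firstReturn _ _
  have h := lintegral_mul_shift M.P (Q.π θ) (k + 1) M.s₀
    (g := (firstReturn M.s₀ k).indicator fun _ => 1) (measurable_const.indicator hm)
    ((determinedBy_mem_firstReturn M.s₀ k).indicator fun _ _ _ _ => rfl) hf
  rw [← trajLaw_eq_pathLaw] at h
  calc _ = ∫⁻ x, (firstReturn M.s₀ k).indicator (fun _ => 1) x * f (shift (k + 1) x)
        ∂trajLaw M Q θ := by
        refine lintegral_congr fun x => ?_
        by_cases hx : x ∈ firstReturn M.s₀ k <;> simp [hx]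
    _ = ∫⁻ x, (firstReturn M.s₀ k).indicator (fun _ => 1) x * ∫⁻ y, f y ∂trajLaw M Q θ
        ∂trajLaw M Q θ := by
        rw [h]
        refine lintegral_congr fun x => ?_
        by_cases hx : x ∈ firstReturn M.s₀ k
        · rw [state_of_mem_firstReturn hx, trajLaw_eq_pathLaw]
        · simp [hx]
    _ = _ := by
        rw [lintegral_mul_const _ (measurable_const.indicator hm), lintegral_indicator_const hm,
          one_mul]

/-- The discount `γ ^ t`, as an extended nonnegative number. -/
def MDP.disc (t : ℕ) : ℝ≥0∞ := ENNReal.ofReal (M.γ ^ t)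

omit [MeasurableSingletonClass S] in
lemma MDP.disc_add (t k : ℕ) : M.disc (t + k) = M.disc k * M.disc t := by
  rw [MDP.disc, MDP.disc, MDP.disc, ← ENNReal.ofReal_mul (pow_nonneg M.γ_pos.le _), pow_add,
    mul_comm]

omit [MeasurableSingletonClass S] in
lemma MDP.tsum_disc : ∑' t, M.disc t = ENNReal.ofReal (1 - M.γ)⁻¹ := by
  rw [← tsum_geometric_of_lt_one M.γ_pos.le M.γ_lt_one, ENNReal.ofReal_tsum_of_nonneg
    (fun t => pow_nonneg M.γ_pos.le _) (summable_geometric_of_lt_one M.γ_pos.le M.γ_lt_one)]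
  rfl

/-- The expected discount `E[γ ^ τ]` at the first return time `τ`. -/
def returnDiscount : ℝ≥0∞ :=
  ∑' k, M.disc (k + 1) * trajLaw M Q θ (firstReturn M.s₀ k)

lemma returnDiscount_le : returnDiscount M Q θ ≤ ENNReal.ofReal M.γ := by
  calc returnDiscount M Q θ
      ≤ ∑' k, ENNReal.ofReal M.γ * trajLaw M Q θ (firstReturn M.s₀ k) := by
        refine ENNReal.tsum_le_tsum fun k => ?_
        gcongr
        refine ENNReal.ofReal_le_ofReal ?_
        rw [pow_succ]
        exact mul_le_of_le_one_left M.γ_pos.le (pow_le_one₀ M.γ_pos.le M.γ_lt_one.le)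
    _ = ENNReal.ofReal M.γ * trajLaw M Q θ (⋃ k, firstReturn M.s₀ k) := by
        rw [ENNReal.tsum_mul_left, measure_iUnion (pairwise_disjoint_firstReturn M.s₀)
          (measurableSet_firstReturn M.s₀)]
    _ ≤ ENNReal.ofReal M.γ * 1 := by gcongr; exact prob_le_one
    _ = _ := mul_one _

lemma returnDiscount_lt_one : returnDiscount M Q θ < 1 := by
  refine (returnDiscount_le M Q θ).trans_lt ?_
  rw [← ENNReal.ofReal_one]
  exact (ENNReal.ofReal_lt_ofReal_iff one_pos).2 M.γ_lt_one

/-- The cost of the step at time `t` along a trajectory. -/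
def cost {β : Type*} (c : S × A × S → β) (x : ℕ → S × A) (t : ℕ) : β :=
  c ((x t).1, (x t).2, (x (t + 1)).1)

omit [MeasurableSpace S] [MeasurableSingletonClass S] [MeasurableSpace A] in
lemma cost_shift {β : Type*} (c : S × A × S → β) (x : ℕ → S × A) (k t : ℕ) :
    cost c (shift k x) t = cost c x (t + k) := by
  simp only [cost, shift, add_right_comm]

omit [MeasurableSingletonClass S] in
lemma measurable_cost {β : Type*} [MeasurableSpace β] {c : S × A × S → β} (hc : Measurable c)
    (t : ℕ) : Measurable fun x => cost c x t :=
  hc.comp (by fun_prop)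

omit [MeasurableSpace S] [MeasurableSingletonClass S] [MeasurableSpace A] in
lemma determinedBy_cost {β : Type*} (c : S × A × S → β) (t : ℕ) :
    DeterminedBy (t + 1) fun x => cost c x t := by
  intro x x' h1 h2
  simp only [cost, h1 t (Nat.lt_succ_self t), h2]

/-- The total discounted cost of a trajectory. -/
def totalCost (b : S × A × S → ℝ≥0∞) (x : ℕ → S × A) : ℝ≥0∞ := ∑' t, M.disc t * cost b x t

/-- The discounted cost of the first cycle. -/
def firstCycleCost (b : S × A × S → ℝ≥0∞) (x : ℕ → S × A) : ℝ≥0∞ :=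
  ∑' t, (alive M.s₀ t).indicator (fun x => M.disc t * cost b x t) x

omit [MeasurableSingletonClass S] in
lemma measurable_disc_mul_cost {b : S × A × S → ℝ≥0∞} (hb : Measurable b) (t : ℕ) :
    Measurable fun x => M.disc t * cost b x t := (measurable_cost hb t).const_mul _

omit [MeasurableSingletonClass S] in
lemma measurable_totalCost {b : S × A × S → ℝ≥0∞} (hb : Measurable b) :
    Measurable (totalCost M b) :=
  Measurable.tsum fun t => measurable_disc_mul_cost M hb t

lemma measurable_firstCycleCost {b : S × A × S → ℝ≥0∞} (hb : Measurable b) :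
    Measurable (firstCycleCost M b) :=
  Measurable.tsum fun t =>
    (measurable_disc_mul_cost M hb t).indicator (measurableSet_alive M.s₀ t)

omit [MeasurableSingletonClass S] in
lemma firstCycleCost_of_mem_firstReturn (b : S × A × S → ℝ≥0∞) {x : ℕ → S × A} {k : ℕ}
    (hx : x ∈ firstReturn M.s₀ k) :
    firstCycleCost M b x = ∑ t ∈ Finset.range (k + 1), M.disc t * cost b x t := by
  rw [firstCycleCost, tsum_eq_sum (s := Finset.range (k + 1))]
  · refine Finset.sum_congr rfl fun t ht => ?_
    rw [Set.indicator_of_mem ((mem_alive_of_mem_firstReturn hx t).2 (Finset.mem_range.1 ht))]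
  · intro t ht
    rw [Set.indicator_of_notMem]
    rw [mem_alive_of_mem_firstReturn hx]
    simpa using ht

omit [MeasurableSpace S] [MeasurableSingletonClass S] [MeasurableSpace A] in
lemma tsum_firstReturn_indicator (s₀ : S) (F : ℕ → (ℕ → S × A) → ℝ≥0∞) {x : ℕ → S × A} {k : ℕ}
    (hx : x ∈ firstReturn s₀ k) :
    ∑' j, (firstReturn s₀ j).indicator (F j) x = F k x := by
  rw [tsum_eq_single k, Set.indicator_of_mem hx]
  intro j hj
  rw [Set.indicator_of_notMem]
  exact fun h => Set.disjoint_left.1 (pairwise_disjoint_firstReturn s₀ hj) h hx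

/-- The discounted cost after the first return. -/
lemma lintegral_afterReturn {F : (ℕ → S × A) → ℝ≥0∞} (hF : Measurable F) :
    ∫⁻ x, ∑' k, (firstReturn M.s₀ k).indicator (fun x => M.disc (k + 1) * F (shift (k + 1) x)) x
      ∂trajLaw M Q θ = returnDiscount M Q θ * ∫⁻ x, F x ∂trajLaw M Q θ := by
  have hm : ∀ k, Measurable fun x => M.disc (k + 1) * F (shift (k + 1) x) := fun k =>
    (hF.comp (measurable_shift (k + 1))).const_mul _
  rw [lintegral_tsum fun k => ((hm k).indicator (measurableSet_firstReturn M.s₀ k)).aemeasurable,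
    returnDiscount, ← ENNReal.tsum_mul_right]
  refine tsum_congr fun k => ?_
  rw [setLIntegral_firstReturn_shift M Q θ k (f := fun x => M.disc (k + 1) * F x)
    (hF.const_mul _),
    lintegral_const_mul _ hF]
  ring

omit [MeasurableSingletonClass S] in
/-- Regeneration: the total cost is the cost of the first cycle plus the discounted total cost
of the trajectory from the first return on. -/
lemma totalCost_eq (b : S × A × S → ℝ≥0∞) (x : ℕ → S × A) :
    totalCost M b x = firstCycleCost M b x + ∑' k, (firstReturn M.s₀ k).indicator
      (fun x => M.disc (k + 1) * totalCost M b (shift (k + 1) x)) x := by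
  rcases alive_or_firstReturn M.s₀ x with h | ⟨k, hk⟩
  · have h0 : ∀ k, x ∉ firstReturn M.s₀ k := fun k hk => hk.2 (h _)
    simp [firstCycleCost, totalCost, h, h0]
  · have h1 : totalCost M b x = ∑ t ∈ Finset.range (k + 1), M.disc t * cost b x t +
        ∑' t, M.disc (t + (k + 1)) * cost b x (t + (k + 1)) :=
      (Summable.sum_add_tsum_nat_add' (f := fun t => M.disc t * cost b x t)
        ENNReal.summable).symm
    have h2 : M.disc (k + 1) * totalCost M b (shift (k + 1) x) =
        ∑' t, M.disc (t + (k + 1)) * cost b x (t + (k + 1)) := by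
      rw [totalCost, ← ENNReal.tsum_mul_left]
      refine tsum_congr fun t => ?_
      rw [cost_shift, M.disc_add t (k + 1), mul_assoc]
    have h3 := tsum_firstReturn_indicator M.s₀
      (fun k x => M.disc (k + 1) * totalCost M b (shift (k + 1) x)) hk
    rw [h1, firstCycleCost_of_mem_firstReturn M b hk, h3, h2]

/-- The renewal equation for nonnegative costs. -/
lemma lintegral_totalCost_eq {b : S × A × S → ℝ≥0∞} (hb : Measurable b) :
    ∫⁻ x, totalCost M b x ∂trajLaw M Q θ = ∫⁻ x, firstCycleCost M b x ∂trajLaw M Q θ +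
      returnDiscount M Q θ * ∫⁻ x, totalCost M b x ∂trajLaw M Q θ := by
  rw [← lintegral_afterReturn M Q θ (measurable_totalCost M hb),
    ← lintegral_add_left (measurable_firstCycleCost M hb)]
  exact lintegral_congr fun x => totalCost_eq M b x

/-- If the cost of the first cycle has finite mean, so has the total cost. -/
lemma lintegral_totalCost_lt_top {b : S × A × S → ℝ≥0∞} (hb : Measurable b)
    (hfin : ∫⁻ x, firstCycleCost M b x ∂trajLaw M Q θ < ∞) :
    ∫⁻ x, totalCost M b x ∂trajLaw M Q θ < ∞ := by
  set ρ := returnDiscount M Q θ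
  set C := ∫⁻ x, firstCycleCost M b x ∂trajLaw M Q θ
  let W : ℕ → (ℕ → S × A) → ℝ≥0∞ := fun n x => ∑ t ∈ Finset.range n, M.disc t * cost b x t
  have hWm : ∀ n, Measurable (W n) := fun n =>
    Finset.measurable_sum _ fun t _ => measurable_disc_mul_cost M hb t
  have hrec : ∀ n x, W (n + 1) x ≤ firstCycleCost M b x + ∑' k, (firstReturn M.s₀ k).indicator
      (fun x => M.disc (k + 1) * W n (shift (k + 1) x)) x := by
    intro n x
    rcases alive_or_firstReturn M.s₀ x with h | ⟨k, hk⟩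
    · refine le_trans ?_ le_self_add
      calc W (n + 1) x ≤ ∑' t, M.disc t * cost b x t := ENNReal.sum_le_tsum _
        _ = firstCycleCost M b x := by simp [firstCycleCost, h]
    · rw [tsum_firstReturn_indicator M.s₀ (fun k x => M.disc (k + 1) * W n (shift (k + 1) x)) hk,
        firstCycleCost_of_mem_firstReturn M b hk]
      calc W (n + 1) x ≤ ∑ t ∈ Finset.range ((k + 1) + n), M.disc t * cost b x t :=
            Finset.sum_le_sum_of_subset (Finset.range_mono (by omega))
        _ = _ := by
            rw [Finset.sum_range_add, Finset.mul_sum]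
            congr 1
            refine Finset.sum_congr rfl fun t _ => ?_
            rw [cost_shift, add_comm (k + 1) t, M.disc_add t (k + 1), mul_assoc]
  have hle : ∀ n, ∫⁻ x, W n x ∂trajLaw M Q θ ≤ C * ∑ i ∈ Finset.range n, ρ ^ i := by
    intro n
    induction n with
    | zero => simp [W]
    | succ n ih =>
      calc ∫⁻ x, W (n + 1) x ∂trajLaw M Q θ
          ≤ C + ρ * ∫⁻ x, W n x ∂trajLaw M Q θ := by
            rw [← lintegral_afterReturn M Q θ (hWm n),
              ← lintegral_add_left (measurable_firstCycleCost M hb)]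
            exact lintegral_mono (hrec n)
        _ ≤ C + ρ * (C * ∑ i ∈ Finset.range n, ρ ^ i) := by gcongr
        _ = C * ∑ i ∈ Finset.range (n + 1), ρ ^ i := by
            rw [Finset.sum_range_succ', Finset.mul_sum, Finset.mul_sum, mul_add, Finset.mul_sum,
              add_comm]
            simp only [pow_zero, mul_one]
            congr 1
            exact Finset.sum_congr rfl fun i _ => by ring
  have hgeo : C * ∑' i, ρ ^ i < ∞ := by
    rw [ENNReal.tsum_geometric]
    refine ENNReal.mul_lt_top hfin (ENNReal.inv_lt_top.2 ?_)
    exact tsub_pos_of_lt (returnDiscount_lt_one M Q θ)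
  refine lt_of_le_of_lt ?_ hgeo
  have hsup : ∫⁻ x, totalCost M b x ∂trajLaw M Q θ = ⨆ n, ∫⁻ x, W n x ∂trajLaw M Q θ := by
    rw [← lintegral_iSup hWm fun i j hij x => Finset.sum_le_sum_of_subset (Finset.range_mono hij)]
    exact lintegral_congr fun x => ENNReal.tsum_eq_iSup_nat
  rw [hsup]
  refine iSup_le fun n => (hle n).trans ?_
  gcongr
  exact ENNReal.sum_le_tsum _

lemma toReal_lintegral_totalCost {b : S × A × S → ℝ≥0∞} (hb : Measurable b)
    (hfin : ∫⁻ x, firstCycleCost M b x ∂trajLaw M Q θ < ∞) :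
    (∫⁻ x, totalCost M b x ∂trajLaw M Q θ).toReal * (1 - (returnDiscount M Q θ).toReal) =
      (∫⁻ x, firstCycleCost M b x ∂trajLaw M Q θ).toReal := by
  have h1 := lintegral_totalCost_lt_top M Q θ hb hfin
  have h2 := returnDiscount_lt_one M Q θ
  have h := congrArg ENNReal.toReal (lintegral_totalCost_eq M Q θ hb)
  rw [ENNReal.toReal_add hfin.ne (ENNReal.mul_lt_top (h2.trans ENNReal.one_lt_top) h1).ne,
    ENNReal.toReal_mul] at h
  linarith

/-- A series of integrable functions is integrated by splitting into positive and negative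
parts. -/
lemma integral_tsum_eq_sub {X : Type*} [MeasurableSpace X] {m : Measure X} {F : ℕ → X → ℝ}
    (hF : ∀ t, Measurable (F t)) (hfin : ∫⁻ x, ∑' t, ‖F t x‖ₑ ∂m ≠ ∞) :
    ∫ x, ∑' t, F t x ∂m = (∫⁻ x, ∑' t, ENNReal.ofReal (F t x) ∂m).toReal -
      (∫⁻ x, ∑' t, ENNReal.ofReal (-F t x) ∂m).toReal := by
  have hle : ∀ s : ℝ, ENNReal.ofReal s ≤ ‖s‖ₑ := fun s => by
    rw [← ofReal_norm]; exact ENNReal.ofReal_le_ofReal (le_abs_self s)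
  have hp : ∫⁻ x, ∑' t, ENNReal.ofReal (F t x) ∂m ≠ ∞ :=
    ((lintegral_mono fun x => ENNReal.tsum_le_tsum fun t => hle _).trans_lt hfin.lt_top).ne
  have hn : ∫⁻ x, ∑' t, ENNReal.ofReal (-F t x) ∂m ≠ ∞ :=
    ((lintegral_mono fun x => ENNReal.tsum_le_tsum fun t =>
      (hle _).trans_eq (enorm_neg _)).trans_lt hfin.lt_top).ne
  have hpm : Measurable fun x => ∑' t, ENNReal.ofReal (F t x) :=
    Measurable.tsum fun t => (hF t).ennreal_ofReal
  have hnm : Measurable fun x => ∑' t, ENNReal.ofReal (-F t x) :=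
    Measurable.tsum fun t => (hF t).neg.ennreal_ofReal
  have hpa := ae_lt_top hpm hp
  have hna := ae_lt_top hnm hn
  rw [← integral_toReal hpm.aemeasurable hpa, ← integral_toReal hnm.aemeasurable hna,
    ← integral_sub (integrable_toReal_of_lintegral_ne_top hpm.aemeasurable hp)
      (integrable_toReal_of_lintegral_ne_top hnm.aemeasurable hn)]
  refine integral_congr_ae ?_
  filter_upwards [hpa, hna] with x h1 h2
  have h3 := ENNReal.summable_toReal h1.ne
  have h4 := ENNReal.summable_toReal h2.ne
  rw [ENNReal.tsum_toReal_eq fun t => ENNReal.ofReal_ne_top,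
    ENNReal.tsum_toReal_eq fun t => ENNReal.ofReal_ne_top, ← h3.tsum_sub h4]
  refine tsum_congr fun t => ?_
  rw [ENNReal.toReal_ofReal', ENNReal.toReal_ofReal']
  rcases le_total 0 (F t x) with h | h
  · rw [max_eq_left h, max_eq_right (by linarith), sub_zero]
  · rw [max_eq_right h, max_eq_left (by linarith)]; ring

end Renewal

/-! ### Mean cycle costs and the performance -/

section MeanCost

variable {S A : Type*} [MeasurableSpace S] [MeasurableSingletonClass S] [MeasurableSpace A] {d : ℕ}
  (M : MDP S A) (Q : ParamPolicy d S A)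

/-- The contribution of time `t` to the discounted cost of the first cycle. -/
def costTerm (c : S × A × S → ℝ) (t : ℕ) (x : ℕ → S × A) : ℝ :=
  (alive M.s₀ t).indicator (fun x => M.γ ^ t * cost c x t) x

/-- The discounted cost of the first cycle, for a real-valued cost. -/
def cycleCost (c : S × A × S → ℝ) (x : ℕ → S × A) : ℝ := ∑' t, costTerm M c t x

/-- The likelihood-ratio estimate of the gradient of the mean discounted cost of a cycle: each
cost is multiplied by the scores of the actions that precede it. -/
def cycleGrad (c : S × A × S → ℝ) (θ : EuclideanSpace ℝ (Fin d)) (x : ℕ → S × A) :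
    EuclideanSpace ℝ (Fin d) :=
  ∑' t, costTerm M c t x • ∑ σ ∈ Finset.range (t + 1), Q.score θ (x σ)

/-- The discounted sum of `1 + |R_t|` over the first cycle. It bounds the discounted costs of the
first cycle for both the costs of interest, the reward and the constant `1`. -/
def absCost (x : ℕ → S × A) : ℝ≥0∞ := firstCycleCost M (fun z => 1 + ‖M.r z‖ₑ) x

/-- A common bound of the second moments of the absolute cycle estimates at `θ`. -/
def MomentBound (K : ℝ≥0∞) (θ : EuclideanSpace ℝ (Fin d)) : Prop :=
  ∫⁻ x, absCost M x ^ 2 ∂trajLaw M Q θ ≤ K ∧ ∫⁻ x, absLR M Q θ x ^ 2 ∂trajLaw M Q θ ≤ K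

variable {M Q} {c : S × A × S → ℝ} {θ : EuclideanSpace ℝ (Fin d)}

lemma measurable_costTerm (hc : Measurable c) (t : ℕ) : Measurable (costTerm M c t) :=
  ((measurable_cost hc t).const_mul _).indicator (measurableSet_alive M.s₀ t)

omit [MeasurableSingletonClass S] in
lemma determinedBy_costTerm (t : ℕ) : DeterminedBy (t + 1) (costTerm M c t) :=
  ((determinedBy_mem_alive M.s₀ t).mono (Nat.le_succ t)).indicator fun _ _ h1 h2 =>
    congrArg (M.γ ^ t * ·) (determinedBy_cost c t h1 h2)

omit [MeasurableSingletonClass S] in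
lemma enorm_costTerm (t : ℕ) (x : ℕ → S × A) : ‖costTerm M c t x‖ₑ =
    (alive M.s₀ t).indicator (fun x => M.disc t * cost (fun z => ‖c z‖ₑ) x t) x := by
  by_cases h : x ∈ alive M.s₀ t
  · rw [costTerm, Set.indicator_of_mem h, Set.indicator_of_mem h, enorm_mul, MDP.disc,
      ← ofReal_norm, Real.norm_of_nonneg (pow_nonneg M.γ_pos.le _)]
    rfl
  · rw [costTerm, Set.indicator_of_notMem h, Set.indicator_of_notMem h, enorm_zero]

omit [MeasurableSingletonClass S] in
lemma tsum_enorm_costTerm (x : ℕ → S × A) :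
    ∑' t, ‖costTerm M c t x‖ₑ = firstCycleCost M (fun z => ‖c z‖ₑ) x := by
  simp_rw [enorm_costTerm]; rfl

omit [MeasurableSingletonClass S] in
lemma firstCycleCost_mono {b b' : S × A × S → ℝ≥0∞} (h : ∀ z, b z ≤ b' z) (x : ℕ → S × A) :
    firstCycleCost M b x ≤ firstCycleCost M b' x := by
  refine ENNReal.tsum_le_tsum fun t => Set.indicator_le_indicator ?_
  gcongr
  exact h _

lemma measurable_absCost : Measurable (absCost M) :=
  measurable_firstCycleCost M (measurable_const.add M.measurable_r.enorm)

omit [MeasurableSingletonClass S] in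
lemma tsum_enorm_costTerm_le (hcr : ∀ z, ‖c z‖ₑ ≤ 1 + ‖M.r z‖ₑ) (x : ℕ → S × A) :
    ∑' t, ‖costTerm M c t x‖ₑ ≤ absCost M x := by
  rw [tsum_enorm_costTerm]
  exact firstCycleCost_mono hcr x

omit [MeasurableSingletonClass S] in
lemma enorm_cycleCost_le (hcr : ∀ z, ‖c z‖ₑ ≤ 1 + ‖M.r z‖ₑ) (x : ℕ → S × A) :
    ‖cycleCost M c x‖ₑ ≤ absCost M x :=
  enorm_tsum_le_tsum_enorm.trans (tsum_enorm_costTerm_le hcr x)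

lemma measurable_cycleCost (hc : Measurable c) : Measurable (cycleCost M c) :=
  Measurable.tsum fun t => measurable_costTerm hc t

omit [MeasurableSingletonClass S] in
lemma absLR_eq (x : ℕ → S × A) : absLR M Q θ x = ∑' t, (alive M.s₀ t).indicator
    (fun x => M.disc t * (1 + ‖M.reward x t‖ₑ) *
      ∑ σ ∈ Finset.range (t + 1), ‖Q.score θ (x σ)‖ₑ) x := by
  refine tsum_congr fun t => ?_
  by_cases h : x ∈ alive M.s₀ t
  · rw [Set.indicator_of_mem h, Set.indicator_of_mem ((mem_cycle_zero _ _ _).2 h)]; rfl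
  · rw [Set.indicator_of_notMem h, Set.indicator_of_notMem (mt (mem_cycle_zero _ _ _).1 h)]

omit [MeasurableSingletonClass S] in
lemma absReturn_eq (x : ℕ → S × A) :
    absReturn M x = firstCycleCost M (fun z => ‖M.r z‖ₑ) x := by
  refine tsum_congr fun t => ?_
  by_cases h : x ∈ alive M.s₀ t
  · rw [Set.indicator_of_mem h, Set.indicator_of_mem ((mem_cycle_zero _ _ _).2 h)]; rfl
  · rw [Set.indicator_of_notMem h, Set.indicator_of_notMem (mt (mem_cycle_zero _ _ _).1 h)]

lemma measurable_absLR (hθ : θ ∈ Q.U) : Measurable (absLR M Q θ) := by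
  have : absLR M Q θ = fun x => ∑' t, (alive M.s₀ t).indicator
    (fun x => M.disc t * (1 + ‖M.reward x t‖ₑ) *
      ∑ σ ∈ Finset.range (t + 1), ‖Q.score θ (x σ)‖ₑ) x := funext absLR_eq
  rw [this]
  refine Measurable.tsum fun t => Measurable.indicator ?_ (measurableSet_alive M.s₀ t)
  refine ((measurable_const.add (measurable_cost M.measurable_r t).enorm).const_mul _).mul ?_
  exact Finset.measurable_sum _ fun σ _ => ((Q.measurable_score hθ).comp (by fun_prop)).enorm

omit [MeasurableSingletonClass S] in
lemma enorm_gradTerm_le (hcr : ∀ z, ‖c z‖ₑ ≤ 1 + ‖M.r z‖ₑ) (t : ℕ) (x : ℕ → S × A) :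
    ‖costTerm M c t x‖ₑ * ‖∑ σ ∈ Finset.range (t + 1), Q.score θ (x σ)‖ₑ ≤
      (alive M.s₀ t).indicator (fun x => M.disc t * (1 + ‖M.reward x t‖ₑ) *
        ∑ σ ∈ Finset.range (t + 1), ‖Q.score θ (x σ)‖ₑ) x := by
  rw [enorm_costTerm]
  by_cases h : x ∈ alive M.s₀ t
  · rw [Set.indicator_of_mem h, Set.indicator_of_mem h]
    gcongr
    · exact hcr _
    · exact enorm_sum_le _ _
  · rw [Set.indicator_of_notMem h, zero_mul]; exact zero_le

omit [MeasurableSingletonClass S] in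
lemma enorm_gradTerm_le_absLR (hcr : ∀ z, ‖c z‖ₑ ≤ 1 + ‖M.r z‖ₑ) (t : ℕ) (x : ℕ → S × A) :
    ‖costTerm M c t x‖ₑ * ‖∑ σ ∈ Finset.range (t + 1), Q.score θ (x σ)‖ₑ ≤ absLR M Q θ x := by
  rw [absLR_eq]
  exact (enorm_gradTerm_le hcr t x).trans (ENNReal.le_tsum t)

omit [MeasurableSingletonClass S] in
lemma tsum_enorm_gradTerm_le (hcr : ∀ z, ‖c z‖ₑ ≤ 1 + ‖M.r z‖ₑ) (x : ℕ → S × A) :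
    ∑' t, ‖costTerm M c t x • ∑ σ ∈ Finset.range (t + 1), Q.score θ (x σ)‖ₑ ≤ absLR M Q θ x := by
  rw [absLR_eq]
  refine ENNReal.tsum_le_tsum fun t => ?_
  rw [enorm_smul]
  exact enorm_gradTerm_le hcr t x

omit [MeasurableSingletonClass S] in
lemma enorm_cycleGrad_le (hcr : ∀ z, ‖c z‖ₑ ≤ 1 + ‖M.r z‖ₑ) (x : ℕ → S × A) :
    ‖cycleGrad M Q c θ x‖ₑ ≤ absLR M Q θ x :=
  enorm_tsum_le_tsum_enorm.trans (tsum_enorm_gradTerm_le hcr x)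

lemma measurable_gradTerm (hc : Measurable c) (hθ : θ ∈ Q.U) (t : ℕ) :
    Measurable fun x => costTerm M c t x • ∑ σ ∈ Finset.range (t + 1), Q.score θ (x σ) :=
  (measurable_costTerm hc t).smul
    (Finset.measurable_sum _ fun σ _ => (Q.measurable_score hθ).comp (measurable_pi_apply σ))

lemma measurable_cycleGrad (hc : Measurable c) (hθ : θ ∈ Q.U) :
    Measurable (cycleGrad M Q c θ) :=
  Measurable.tsum fun t => measurable_gradTerm hc hθ t

/-- Finite second moment implies finite first moment, for a probability measure. -/
lemma lintegral_lt_top_of_sq {X : Type*} [MeasurableSpace X] {m : Measure X}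
    [IsProbabilityMeasure m] {u : X → ℝ≥0∞} {K : ℝ≥0∞} (hK : K ≠ ∞)
    (h : ∫⁻ x, u x ^ 2 ∂m ≤ K) : ∫⁻ x, u x ∂m < ∞ := by
  calc ∫⁻ x, u x ∂m ≤ ∫⁻ x, (u x ^ 2 + 1) ∂m := by
        refine lintegral_mono fun x => ?_
        simpa using ENNReal.le_mul_sq_add_inv one_ne_zero ENNReal.one_ne_top (u x)
    _ = ∫⁻ x, u x ^ 2 ∂m + 1 := by rw [lintegral_add_right _ measurable_const]; simp
    _ ≤ K + 1 := by gcongr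
    _ < ∞ := by simpa using hK.lt_top

omit [MeasurableSingletonClass S] in
lemma MomentBound.absCost_lt_top {K : ℝ≥0∞} (h : MomentBound M Q K θ) (hK : K ≠ ∞) :
    ∫⁻ x, absCost M x ∂trajLaw M Q θ < ∞ := lintegral_lt_top_of_sq hK h.1

omit [MeasurableSingletonClass S] in
lemma MomentBound.absLR_lt_top {K : ℝ≥0∞} (h : MomentBound M Q K θ) (hK : K ≠ ∞) :
    ∫⁻ x, absLR M Q θ x ∂trajLaw M Q θ < ∞ := lintegral_lt_top_of_sq hK h.2

lemma integrable_cycleCost (hc : Measurable c) (hcr : ∀ z, ‖c z‖ₑ ≤ 1 + ‖M.r z‖ₑ)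
    (hfin : ∫⁻ x, absCost M x ∂trajLaw M Q θ < ∞) :
    Integrable (cycleCost M c) (trajLaw M Q θ) :=
  ⟨(measurable_cycleCost hc).aestronglyMeasurable,
    (lintegral_mono fun x => enorm_cycleCost_le hcr x).trans_lt hfin⟩

lemma integrable_cycleGrad (hc : Measurable c) (hcr : ∀ z, ‖c z‖ₑ ≤ 1 + ‖M.r z‖ₑ)
    (hθ : θ ∈ Q.U) (hfin : ∫⁻ x, absLR M Q θ x ∂trajLaw M Q θ < ∞) :
    Integrable (cycleGrad M Q c θ) (trajLaw M Q θ) :=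
  ⟨(measurable_cycleGrad hc hθ).aestronglyMeasurable,
    (lintegral_mono fun x => enorm_cycleGrad_le hcr x).trans_lt hfin⟩

/-- The renewal equation for real-valued costs. -/
lemma integral_cycleCost_eq (hc : Measurable c) (hcr : ∀ z, ‖c z‖ₑ ≤ 1 + ‖M.r z‖ₑ)
    (hfin : ∫⁻ x, absCost M x ∂trajLaw M Q θ < ∞) :
    ∫ x, cycleCost M c x ∂trajLaw M Q θ = (∫ x, ∑' t, M.γ ^ t * cost c x t ∂trajLaw M Q θ) *
      (1 - (returnDiscount M Q θ).toReal) := by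
  have hγ : ∀ t, 0 ≤ M.γ ^ t := fun t => pow_nonneg M.γ_pos.le t
  have hbm : Measurable fun z => 1 + ‖M.r z‖ₑ := measurable_const.add M.measurable_r.enorm
  have htot := lintegral_totalCost_lt_top M Q θ hbm hfin
  have h1 := integral_tsum_eq_sub (m := trajLaw M Q θ)
    (F := fun t x => M.γ ^ t * cost c x t) (fun t => (measurable_cost hc t).const_mul _) (by
      refine ((lintegral_mono fun x => ENNReal.tsum_le_tsum fun t => ?_).trans_lt htot).ne
      rw [enorm_mul, MDP.disc, ← ofReal_norm, Real.norm_of_nonneg (hγ t)]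
      gcongr
      exact hcr _)
  have h2 := integral_tsum_eq_sub (m := trajLaw M Q θ)
    (F := fun t x => costTerm M c t x) (fun t => measurable_costTerm hc t)
    ((lintegral_mono fun x => tsum_enorm_costTerm_le hcr x).trans_lt hfin).ne
  have htp : ∀ (c : S × A × S → ℝ) x, ∑' t, ENNReal.ofReal (M.γ ^ t * cost c x t) =
      totalCost M (fun z => ENNReal.ofReal (c z)) x := fun c x =>
    tsum_congr fun t => ENNReal.ofReal_mul (hγ t)
  have htn : ∀ x, ∑' t, ENNReal.ofReal (-(M.γ ^ t * cost c x t)) =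
      totalCost M (fun z => ENNReal.ofReal (-c z)) x := fun x => by
    rw [← htp]; simp only [cost, mul_neg]
  have hcp : ∀ (c : S × A × S → ℝ) x, ∑' t, ENNReal.ofReal (costTerm M c t x) =
      firstCycleCost M (fun z => ENNReal.ofReal (c z)) x := fun c x => by
    refine tsum_congr fun t => ?_
    by_cases h : x ∈ alive M.s₀ t
    · rw [costTerm, Set.indicator_of_mem h, Set.indicator_of_mem h, ENNReal.ofReal_mul (hγ t)]; rfl
    · rw [costTerm, Set.indicator_of_notMem h, Set.indicator_of_notMem h, ENNReal.ofReal_zero]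
  have hcn : ∀ x, ∑' t, ENNReal.ofReal (-costTerm M c t x) =
      firstCycleCost M (fun z => ENNReal.ofReal (-c z)) x := fun x => by
    rw [← hcp]
    refine tsum_congr fun t => ?_
    by_cases h : x ∈ alive M.s₀ t <;> simp [costTerm, h, cost]
  have hle : ∀ s : ℝ, ENNReal.ofReal s ≤ ‖s‖ₑ := fun s => by
    rw [← ofReal_norm]; exact ENNReal.ofReal_le_ofReal (le_abs_self s)
  have hfp : ∫⁻ x, firstCycleCost M (fun z => ENNReal.ofReal (c z)) x ∂trajLaw M Q θ < ∞ :=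
    (lintegral_mono fun x => firstCycleCost_mono (fun z => (hle _).trans (hcr z)) x).trans_lt hfin
  have hfn : ∫⁻ x, firstCycleCost M (fun z => ENNReal.ofReal (-c z)) x ∂trajLaw M Q θ < ∞ :=
    (lintegral_mono fun x => firstCycleCost_mono (fun z => ((hle _).trans_eq
      (enorm_neg _)).trans (hcr z)) x).trans_lt hfin
  simp_rw [htp, htn] at h1
  simp_rw [hcp, hcn] at h2
  rw [h1, show (∫ x, cycleCost M c x ∂trajLaw M Q θ) = _ from h2, sub_mul,
    toReal_lintegral_totalCost M Q θ hc.ennreal_ofReal hfp,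
    toReal_lintegral_totalCost M Q θ (b := fun z => ENNReal.ofReal (-c z))
      hc.neg.ennreal_ofReal hfn]

omit [MeasurableSingletonClass S] in
lemma cycleSum_zero (c : S × A × S → ℝ) (x : ℕ → S × A) :
    cycleSum M.γ M.s₀ (cost c x) x 0 0 = cycleCost M c x := by
  rw [cycleSum, cycleCost]
  simp only [returnTime, ENat.toNat_zero, pow_zero, inv_one, one_mul]
  refine tsum_congr fun t => ?_
  by_cases h : x ∈ alive M.s₀ t
  · rw [costTerm, Set.indicator_of_mem h, Set.indicator_of_mem]
    exact ⟨(mem_cycle_zero _ _ _).2 h, Nat.zero_le t⟩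
  · rw [costTerm, Set.indicator_of_notMem h, Set.indicator_of_notMem]
    exact fun h' => h ((mem_cycle_zero _ _ _).1 h'.1)

omit [MeasurableSingletonClass S] in
lemma meanR_eq : meanR M Q θ = ∫ x, cycleCost M M.r x ∂trajLaw M Q θ :=
  integral_congr_ae (.of_forall fun x => cycleSum_zero M.r x)

omit [MeasurableSingletonClass S] in
lemma meanT_eq : meanT M Q θ = ∫ x, cycleCost M (fun _ => 1) x ∂trajLaw M Q θ :=
  integral_congr_ae (.of_forall fun x => cycleSum_zero (fun _ => 1) x)

omit [MeasurableSingletonClass S] in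
lemma enorm_r_le (M : MDP S A) (z : S × A × S) : ‖M.r z‖ₑ ≤ 1 + ‖M.r z‖ₑ := le_add_self

omit [MeasurableSingletonClass S] in
lemma enorm_one_le (M : MDP S A) (z : S × A × S) : ‖(1 : ℝ)‖ₑ ≤ 1 + ‖M.r z‖ₑ := by simp

lemma meanT_eq_div (hfin : ∫⁻ x, absCost M x ∂trajLaw M Q θ < ∞) :
    meanT M Q θ = (1 - M.γ)⁻¹ * (1 - (returnDiscount M Q θ).toReal) := by
  rw [meanT_eq, integral_cycleCost_eq measurable_const (enorm_one_le M) hfin]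
  simp [cost, tsum_geometric_of_lt_one M.γ_pos.le M.γ_lt_one]

lemma one_le_meanT (hfin : ∫⁻ x, absCost M x ∂trajLaw M Q θ < ∞) : 1 ≤ meanT M Q θ := by
  rw [meanT_eq_div hfin, ← div_eq_inv_mul, one_le_div (sub_pos.2 M.γ_lt_one)]
  have h := ENNReal.toReal_mono ENNReal.ofReal_ne_top (returnDiscount_le M Q θ)
  rw [ENNReal.toReal_ofReal M.γ_pos.le] at h
  linarith

/-- The renewal formula: the performance is the ratio of the mean discounted reward and the mean
discounted time of a cycle, up to the factor `1 - γ`. -/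
lemma J_eq (hfin : ∫⁻ x, absCost M x ∂trajLaw M Q θ < ∞) :
    J M Q θ = meanR M Q θ / ((1 - M.γ) * meanT M Q θ) := by
  have h1 := one_le_meanT hfin
  have hγ : 0 < 1 - M.γ := sub_pos.2 M.γ_lt_one
  have hT := meanT_eq_div hfin
  have hR : meanR M Q θ = J M Q θ * (1 - (returnDiscount M Q θ).toReal) := by
    rw [meanR_eq, integral_cycleCost_eq M.measurable_r (enorm_r_le M) hfin]; rfl
  rw [eq_div_iff (by positivity), hR, hT]
  field_simp

end MeanCost

/-! ### The likelihood-ratio gradient of the mean cycle cost -/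

section Gradient

variable {S A : Type*} [MeasurableSpace S] [MeasurableSpace A] {d : ℕ}
  {M : MDP S A} {Q : ParamPolicy d S A} {c : S × A × S → ℝ} {θ : EuclideanSpace ℝ (Fin d)}

lemma integral_trajLaw_eq_refLaw [NeZero Q.ν] (hθ : θ ∈ Q.U) {n : ℕ} {F : Type*}
    [NormedAddCommGroup F] [NormedSpace ℝ F] [MeasurableSpace F] [BorelSpace F]
    [SecondCountableTopology F] {f : (ℕ → S × A) → F} (hf : Measurable f)
    (hfn : DeterminedBy n f) :
    ∫ x, f x ∂trajLaw M Q θ = ∫ x, Q.likelihood n θ x • f x ∂refLaw M Q := by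
  obtain ⟨a₀⟩ : Nonempty A := by
    obtain ⟨x⟩ := (trajLaw M Q θ).nonempty_of_neZero
    exact ⟨(x 0).2⟩
  -- `φ x` has the same first `n` state-action pairs and the same next state as `x`, and is a
  -- function of these
  let φ : (ℕ → S × A) → ℕ → S × A := fun x t => if t < n then x t else ((x n).1, a₀)
  have hφ : Measurable φ := by
    refine measurable_pi_lambda _ fun t => ?_
    by_cases h : t < n
    · simp only [φ, h, if_true]; fun_prop
    · simp only [φ, h, if_false]; fun_prop
  have hfφ : ∀ x, f (φ x) = f x := fun x => by
    refine hfn (fun i hi => ?_) ?_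
    · simp [φ, hi]
    · simp [φ]
  have hφdet : ∀ {β : Type} (g : (ℕ → S × A) → β), DeterminedBy n fun x => g (φ x) := by
    intro β g x x' h1 h2
    have : φ x = φ x' := by
      ext1 t
      by_cases h : t < n
      · simp [φ, h, h1 t h]
      · simp [φ, h, h2]
    simp only [this]
  have hLm := Q.measurable_likelihood hθ n
  have hmap : (trajLaw M Q θ).map φ =
      ((refLaw M Q).withDensity fun x => ENNReal.ofReal (Q.likelihood n θ x)).map φ := by
    refine Measure.ext_of_lintegral _ fun g hg => ?_
    rw [lintegral_map hg hφ, lintegral_map hg hφ,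
      lintegral_trajLaw_eq_refLaw M Q hθ (g := fun x => g (φ x)) (hg.comp hφ) (hφdet g),
      lintegral_withDensity_eq_lintegral_mul _ hLm.ennreal_ofReal (g := fun x => g (φ x))
        (hg.comp hφ)]
    rfl
  calc ∫ x, f x ∂trajLaw M Q θ = ∫ x, f (φ x) ∂trajLaw M Q θ := by simp_rw [hfφ]
    _ = ∫ x, f (φ x) ∂(refLaw M Q).withDensity fun x => ENNReal.ofReal (Q.likelihood n θ x) := by
        rw [← integral_map hφ.aemeasurable hf.aestronglyMeasurable, hmap,
          integral_map hφ.aemeasurable hf.aestronglyMeasurable]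
    _ = ∫ x, Q.likelihood n θ x • f x ∂refLaw M Q := by
        simp_rw [hfφ]
        rw [integral_withDensity_eq_integral_toReal_smul hLm.ennreal_ofReal
          (.of_forall fun x => ENNReal.ofReal_lt_top)]
        simp_rw [ENNReal.toReal_ofReal (Q.likelihood_nonneg hθ n _)]

variable [MeasurableSingletonClass S]

/-- The likelihood-ratio gradient of the mean discounted cost at a fixed time. -/
lemma hasGradientAt_integral_costTerm (hc : Measurable c) (hcr : ∀ z, ‖c z‖ₑ ≤ 1 + ‖M.r z‖ₑ)
    (hθ : θ ∈ Q.U) {K : ℝ≥0∞} (hK : K ≠ ∞) (hmom : ∀ᶠ θ' in 𝓝 θ, MomentBound M Q K θ') (t : ℕ) :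
    HasGradientAt (fun θ' => ∫ x, costTerm M c t x ∂trajLaw M Q θ')
      (∫ x, costTerm M c t x • ∑ σ ∈ Finset.range (t + 1), Q.score θ (x σ) ∂trajLaw M Q θ) θ := by
  have : NeZero Q.ν := Q.neZero_ν hθ M.s₀
  have hU : ∀ᶠ θ' in 𝓝 θ, θ' ∈ Q.U := Q.isOpen_U.mem_nhds hθ
  have hcm : Measurable (costTerm M c t) := measurable_costTerm hc t
  have hsm : ∀ θ' ∈ Q.U, Measurable fun x : ℕ → S × A =>
      ∑ σ ∈ Finset.range (t + 1), Q.score θ' (x σ) := fun θ' hθ' =>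
    Finset.measurable_sum _ fun σ _ => (Q.measurable_score hθ').comp (measurable_pi_apply σ)
  have hsd : ∀ θ', DeterminedBy (t + 1) fun x : ℕ → S × A =>
      ∑ σ ∈ Finset.range (t + 1), Q.score θ' (x σ) := fun θ' x x' h1 h2 =>
    Finset.sum_congr rfl fun σ hσ => by rw [h1 σ (Finset.mem_range.1 hσ)]
  have key := hasGradientAt_integral_density (m := refLaw M Q) (L := Q.likelihood (t + 1))
    (s := fun θ' x => ∑ σ ∈ Finset.range (t + 1), Q.score θ' (x σ)) (g := costTerm M c t)
    (V := {θ' | θ' ∈ Q.U ∧ MomentBound M Q K θ'}) (hU.and hmom)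
    (fun θ' h x => Q.likelihood_nonneg h.1 _ x) (fun θ' h => Q.measurable_likelihood h.1 _)
    (fun θ' h => hsm θ' h.1) (fun θ' h x => Q.hasGradientAt_likelihood h.1 _ x)
    (fun x => (Q.continuousOn_likelihood_smul_score _ x).mono fun θ' h => h.1)
    (fun θ' h => lintegral_likelihood M Q h.1 _) hcm hK ?_ ?_
  · have hgrad : ∫ x, (Q.likelihood (t + 1) θ x * costTerm M c t x) •
          ∑ σ ∈ Finset.range (t + 1), Q.score θ (x σ) ∂refLaw M Q =
        ∫ x, costTerm M c t x • ∑ σ ∈ Finset.range (t + 1), Q.score θ (x σ) ∂trajLaw M Q θ := by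
      rw [integral_trajLaw_eq_refLaw hθ (measurable_gradTerm hc hθ t) (n := t + 1)]
      · simp_rw [smul_smul]
      · intro x x' h1 h2
        exact congrArg₂ (· • ·) (determinedBy_costTerm t h1 h2) (hsd θ h1 h2)
    rw [hgrad] at key
    refine key.congr_of_eventuallyEq ?_
    filter_upwards [hU] with θ' hθ'
    rw [integral_trajLaw_eq_refLaw hθ' hcm (determinedBy_costTerm t)]
    rfl
  · intro θ' h
    rw [← lintegral_trajLaw_eq_refLaw M Q h.1 (g := fun x => ‖costTerm M c t x‖ₑ ^ 2)
      (hcm.enorm.pow_const _) fun x x' h1 h2 => by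
        simp only [determinedBy_costTerm t h1 h2]]
    refine (lintegral_mono fun x => ?_).trans h.2.1
    gcongr
    exact (ENNReal.le_tsum t).trans (tsum_enorm_costTerm_le hcr x)
  · intro θ' h
    rw [← lintegral_trajLaw_eq_refLaw M Q h.1
      (g := fun x => (‖costTerm M c t x‖ₑ * ‖∑ σ ∈ Finset.range (t + 1), Q.score θ' (x σ)‖ₑ) ^ 2)
      ((hcm.enorm.mul (hsm θ' h.1).enorm).pow_const _) fun x x' h1 h2 => by
        have h3 := hsd θ' h1 h2
        simp only at h3
        simp only [determinedBy_costTerm t h1 h2, h3]]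
    refine (lintegral_mono fun x => ?_).trans h.2.2
    gcongr
    exact enorm_gradTerm_le_absLR hcr t x

/-- The probability of no return up to time `n` is continuous in the parameter. -/
lemma continuousAt_measure_alive (hθ : θ ∈ Q.U) {K : ℝ≥0∞} (hK : K ≠ ∞)
    (hmom : ∀ᶠ θ' in 𝓝 θ, MomentBound M Q K θ') (n : ℕ) :
    ContinuousAt (fun θ' => trajLaw M Q θ' (alive M.s₀ n)) θ := by
  have h := (hasGradientAt_integral_costTerm measurable_const (enorm_one_le M) hθ hK hmom
    n).continuousAt
  have h2 : ∀ θ', trajLaw M Q θ' (alive M.s₀ n) =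
      ENNReal.ofReal ((M.γ ^ n)⁻¹ * ∫ x, costTerm M (fun _ => 1) n x ∂trajLaw M Q θ') := by
    intro θ'
    have h3 : ∫ x, costTerm M (fun _ => 1) n x ∂trajLaw M Q θ' =
        (trajLaw M Q θ').real (alive M.s₀ n) * M.γ ^ n := by
      have h4 : costTerm M (fun _ => (1 : ℝ)) n =
          (alive M.s₀ n : Set (ℕ → S × A)).indicator fun _ => M.γ ^ n := by
        ext x; simp [costTerm, cost]
      rw [h4, integral_indicator_const _ (measurableSet_alive M.s₀ n), smul_eq_mul]
    have hγ : M.γ ^ n ≠ 0 := pow_ne_zero _ M.γ_pos.ne'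
    rw [h3, mul_comm _ (M.γ ^ n), inv_mul_cancel_left₀ hγ, ofReal_measureReal]
  simp_rw [h2]
  exact ENNReal.continuous_ofReal.continuousAt.comp (continuousAt_const.mul h)

/-- Under positive recurrence a return is almost sure. -/
lemma measure_iInter_alive (hrec : PositiveRecurrent M Q θ) :
    trajLaw M Q θ (⋂ n, alive M.s₀ n) = 0 := by
  have hm : MeasurableSet (⋂ n, alive M.s₀ n : Set (ℕ → S × A)) :=
    MeasurableSet.iInter fun n => measurableSet_alive M.s₀ n
  by_contra h0
  have h1 : ∞ * trajLaw M Q θ (⋂ n, alive M.s₀ n) ≤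
      ∫⁻ x, ((returnTime M.s₀ x 1 : ℕ∞) : ℝ≥0∞) ∂trajLaw M Q θ := by
    rw [← lintegral_indicator_const hm]
    refine lintegral_mono fun x => ?_
    by_cases hx : x ∈ ⋂ n, alive M.s₀ n
    · have h2 : returnTime M.s₀ x 1 = ⊤ := by
        exact enat_eq_of_forall_lt_iff fun n => iff_of_true
          ((mem_alive_iff _ _ _).1 (Set.mem_iInter.1 hx n)) (ENat.natCast_lt_top n)
      rw [h2]; simp
    · rw [Set.indicator_of_notMem hx]; exact zero_le
  rw [ENNReal.top_mul h0] at h1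
  exact absurd hrec (not_lt.2 h1)

lemma tendsto_measure_alive (hrec : PositiveRecurrent M Q θ) :
    Tendsto (fun n => trajLaw M Q θ (alive M.s₀ n)) atTop (𝓝 0) := by
  rw [← measure_iInter_alive hrec]
  exact tendsto_measure_iInter_atTop (fun n => (measurableSet_alive M.s₀ n).nullMeasurableSet)
    (alive_anti M.s₀) ⟨0, measure_ne_top _ _⟩

omit [MeasurableSingletonClass S] in
/-- The part of the likelihood-ratio estimate from time `n` on is carried by the trajectories
that have not returned up to time `n`. -/
lemma enorm_cycleGrad_sub_le (hcr : ∀ z, ‖c z‖ₑ ≤ 1 + ‖M.r z‖ₑ) {x : ℕ → S × A}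
    (hx : absLR M Q θ x < ∞) (n : ℕ) :
    ‖cycleGrad M Q c θ x - ∑ t ∈ Finset.range n,
        costTerm M c t x • ∑ σ ∈ Finset.range (t + 1), Q.score θ (x σ)‖ₑ ≤
      (alive M.s₀ n).indicator (absLR M Q θ) x := by
  set v : ℕ → EuclideanSpace ℝ (Fin d) := fun t =>
    costTerm M c t x • ∑ σ ∈ Finset.range (t + 1), Q.score θ (x σ) with hv
  have hsum : Summable v := by
    refine Summable.of_enorm ?_
    exact ((tsum_enorm_gradTerm_le hcr x).trans_lt hx).ne
  have h1 : cycleGrad M Q c θ x - ∑ t ∈ Finset.range n, v t = ∑' t, v (t + n) := by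
    rw [sub_eq_iff_eq_add', hsum.sum_add_tsum_nat_add n]; rfl
  rw [h1]
  by_cases h : x ∈ alive M.s₀ n
  · rw [Set.indicator_of_mem h]
    refine enorm_tsum_le_tsum_enorm.trans ((le_trans ?_ (tsum_enorm_gradTerm_le hcr x)))
    exact ENNReal.tsum_comp_le_tsum_of_injective (add_left_injective n) fun t => ‖v t‖ₑ
  · rw [Set.indicator_of_notMem h]
    have h0 : ∀ t, v (t + n) = 0 := fun t => by
      have : x ∉ alive M.s₀ (t + n) := fun h' => h (alive_anti M.s₀ (Nat.le_add_left n t) h')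
      simp [hv, costTerm, this]
    simp [h0]

/-- **The likelihood-ratio formula** for the gradient of the mean discounted cost of a cycle. The
partial sums over time converge locally uniformly together with their gradients, because the
probability of long cycles is small uniformly near a positive recurrent parameter. -/
theorem hasGradientAt_integral_cycleCost (hc : Measurable c)
    (hcr : ∀ z, ‖c z‖ₑ ≤ 1 + ‖M.r z‖ₑ) (hθ : θ ∈ Q.U) (hrec : PositiveRecurrent M Q θ)
    {K : ℝ≥0∞} (hK : K ≠ ∞) (hmom : ∀ᶠ θ' in 𝓝 θ, MomentBound M Q K θ') :
    HasGradientAt (fun θ' => ∫ x, cycleCost M c x ∂trajLaw M Q θ')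
      (∫ x, cycleGrad M Q c θ x ∂trajLaw M Q θ) θ := by
  have hU : ∀ᶠ θ' in 𝓝 θ, θ' ∈ Q.U := Q.isOpen_U.mem_nhds hθ
  have hgi : ∀ θ' ∈ Q.U, MomentBound M Q K θ' → ∀ t, Integrable (fun x => costTerm M c t x •
      ∑ σ ∈ Finset.range (t + 1), Q.score θ' (x σ)) (trajLaw M Q θ') := fun θ' h1 h2 t =>
    ⟨(measurable_gradTerm hc h1 t).aestronglyMeasurable,
      (lintegral_mono fun x => (enorm_smul _ _).trans_le
        (enorm_gradTerm_le_absLR hcr t x)).trans_lt (h2.absLR_lt_top hK)⟩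
  rw [hasGradientAt_iff_hasFDerivAt]
  refine hasFDerivAt_of_tendstoUniformlyOnFilter (l := atTop)
    (f := fun n θ' => ∑ t ∈ Finset.range n, ∫ x, costTerm M c t x ∂trajLaw M Q θ')
    (f' := fun n θ' => InnerProductSpace.toDual ℝ _ (∑ t ∈ Finset.range n, ∫ x, costTerm M c t x •
      ∑ σ ∈ Finset.range (t + 1), Q.score θ' (x σ) ∂trajLaw M Q θ'))
    (g' := fun θ' => InnerProductSpace.toDual ℝ _ (∫ x, cycleGrad M Q c θ' x ∂trajLaw M Q θ'))
    ?_ ?_ ?_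
  · rw [Metric.tendstoUniformlyOnFilter_iff]
    intro η hη
    obtain ⟨ε, δ, hε0, hε1, hδ, hεδ⟩ := exists_small_coeffs (η := ENNReal.ofReal (η / 2)) hK
      (by simpa using hη)
    obtain ⟨n₀, hn₀⟩ := ((tendsto_measure_alive hrec).eventually (gt_mem_nhds hδ)).exists
    have hev : ∀ᶠ θ' in 𝓝 θ, trajLaw M Q θ' (alive M.s₀ n₀) < δ :=
      (continuousAt_measure_alive hθ hK hmom n₀).tendsto.eventually_lt_const hn₀
    refine ((eventually_ge_atTop n₀).prod_mk (hev.and (hU.and hmom))).mono ?_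
    rintro ⟨n, θ'⟩ ⟨hn, hθδ, hθU, hθK⟩
    simp only at hn hθδ hθU hθK ⊢
    have hm := measurable_absLR (M := M) hθU
    have hfin := hθK.absLR_lt_top hK
    rw [LinearIsometryEquiv.dist_map, dist_eq_norm,
      ← integral_finsetSum _ fun t _ => hgi θ' hθU hθK t,
      ← integral_sub (integrable_cycleGrad hc hcr hθU hfin)
        (integrable_finsetSum _ fun t _ => hgi θ' hθU hθK t)]
    refine lt_of_le_of_lt ?_ (half_lt_self hη)
    rw [← ENNReal.ofReal_le_ofReal_iff (by positivity), ofReal_norm]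
    calc _ ≤ ∫⁻ x, ‖cycleGrad M Q c θ' x - ∑ t ∈ Finset.range n,
            costTerm M c t x • ∑ σ ∈ Finset.range (t + 1), Q.score θ' (x σ)‖ₑ ∂trajLaw M Q θ' :=
          enorm_integral_le_lintegral_enorm _
      _ ≤ ∫⁻ x, (alive M.s₀ n).indicator (absLR M Q θ') x ∂trajLaw M Q θ' := by
          refine lintegral_mono_ae ?_
          filter_upwards [ae_lt_top hm hfin.ne] with x hx
          exact enorm_cycleGrad_sub_le hcr hx n
      _ = ∫⁻ x in alive M.s₀ n, 1 * absLR M Q θ' x ∂trajLaw M Q θ' := by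
          rw [lintegral_indicator (measurableSet_alive M.s₀ n)]; simp
      _ ≤ ε * K + ε⁻¹ * ∫⁻ x in alive M.s₀ n, 1 ∂trajLaw M Q θ' :=
          setLIntegral_le_of_sq _ measurable_const hm hε0 hε1 (by simpa using hθK.2)
      _ ≤ ENNReal.ofReal (η / 2) := by
          refine hεδ _ ?_
          rw [setLIntegral_one]
          exact (measure_mono (alive_anti M.s₀ hn)).trans hθδ.le
  · refine ((Eventually.of_forall fun _ => True.intro).prod_mk
      (hU.and (eventually_eventually_nhds.2 hmom))).mono ?_
    rintro ⟨n, θ'⟩ ⟨-, hθU, hθK⟩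
    simp only at hθU hθK ⊢
    rw [map_sum]
    exact HasFDerivAt.fun_sum fun t _ =>
      (hasGradientAt_integral_costTerm hc hcr hθU hK hθK t).hasFDerivAt
  · filter_upwards [hmom] with θ' hθK
    have hfin := hθK.absCost_lt_top hK
    have h := hasSum_integral_of_summable_integral_norm (μ := trajLaw M Q θ')
      (F := fun t x => costTerm M c t x) (fun t => ⟨(measurable_costTerm hc t).aestronglyMeasurable,
        (lintegral_mono fun x => (ENNReal.le_tsum t).trans
          (tsum_enorm_costTerm_le hcr x)).trans_lt hfin⟩) ?_
    · exact h.tendsto_sum_nat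
    · have h2 : ∑' t, ∫⁻ x, ‖costTerm M c t x‖ₑ ∂trajLaw M Q θ' ≠ ∞ := by
        rw [← lintegral_tsum fun t => (measurable_costTerm hc t).enorm.aemeasurable]
        exact ((lintegral_mono fun x => tsum_enorm_costTerm_le hcr x).trans_lt hfin).ne
      refine (ENNReal.summable_toReal h2).congr fun t => ?_
      rw [integral_norm_eq_lintegral_enorm (measurable_costTerm hc t).aestronglyMeasurable]

end Gradient

/-! ### The gradient of the performance -/

section Performance

variable {S A : Type*} [MeasurableSpace S] [MeasurableSpace A] {d : ℕ}
  {M : MDP S A} {Q : ParamPolicy d S A} {Θ : Set (EuclideanSpace ℝ (Fin d))}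
  {θ : EuclideanSpace ℝ (Fin d)}

lemma absCost_le (x : ℕ → S × A) :
    absCost M x ≤ ENNReal.ofReal (1 - M.γ)⁻¹ + absReturn M x := by
  rw [← MDP.tsum_disc, absReturn_eq, firstCycleCost, ← ENNReal.tsum_add]
  refine ENNReal.tsum_le_tsum fun t => ?_
  by_cases h : x ∈ alive M.s₀ t
  · rw [Set.indicator_of_mem h, Set.indicator_of_mem h, cost, mul_add, mul_one]; rfl
  · rw [Set.indicator_of_notMem h]; exact zero_le

lemma ennreal_add_sq_le (a b : ℝ≥0∞) : (a + b) ^ 2 ≤ 4 * a ^ 2 + 4 * b ^ 2 := by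
  calc (a + b) ^ 2 ≤ (2 * max a b) ^ 2 := by
        gcongr
        rw [two_mul]
        exact add_le_add (le_max_left _ _) (le_max_right _ _)
    _ = 4 * max a b ^ 2 := by rw [mul_pow]; norm_num
    _ ≤ 4 * a ^ 2 + 4 * b ^ 2 := by
        rcases le_total a b with h | h
        · rw [max_eq_right h]; exact le_add_self
        · rw [max_eq_left h]; exact le_self_add

lemma MomentBound.mono {K K' : ℝ≥0∞} (h : MomentBound M Q K θ) (hK : K ≤ K') :
    MomentBound M Q K' θ := ⟨h.1.trans hK, h.2.trans hK⟩

lemma LocallyBoundedSecondMoments.exists_momentBound (hmom : LocallyBoundedSecondMoments M Q Θ)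
    (hθ : θ ∈ Θ) : ∃ K : ℝ≥0∞, K ≠ ∞ ∧ ∀ᶠ θ' in 𝓝 θ, MomentBound M Q K θ' := by
  obtain ⟨K, hK, hev⟩ := hmom θ hθ
  refine ⟨4 * ENNReal.ofReal (1 - M.γ)⁻¹ ^ 2 + 4 * K, by finiteness, hev.mono fun θ' h => ⟨?_, ?_⟩⟩
  · calc ∫⁻ x, absCost M x ^ 2 ∂trajLaw M Q θ'
        ≤ ∫⁻ x, (4 * ENNReal.ofReal (1 - M.γ)⁻¹ ^ 2 + 4 * absReturn M x ^ 2)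
            ∂trajLaw M Q θ' := by
          refine lintegral_mono fun x => (?_ : absCost M x ^ 2 ≤ _).trans (ennreal_add_sq_le _ _)
          gcongr
          exact absCost_le x
      _ = 4 * ENNReal.ofReal (1 - M.γ)⁻¹ ^ 2 + 4 * ∫⁻ x, absReturn M x ^ 2 ∂trajLaw M Q θ' := by
          rw [lintegral_add_left measurable_const]
          simp [lintegral_const_mul']
      _ ≤ _ := by gcongr; exact h.1
  · refine h.2.trans (le_trans ?_ le_add_self)
    exact le_mul_of_one_le_left zero_le (by norm_num)

/-- On a compact set of parameters the second moments are bounded uniformly. -/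
lemma LocallyBoundedSecondMoments.exists_momentBound_of_isCompact
    (hmom : LocallyBoundedSecondMoments M Q Θ) {C : Set (EuclideanSpace ℝ (Fin d))}
    (hC : IsCompact C) (hCΘ : C ⊆ Θ) : ∃ K : ℝ≥0∞, K ≠ ∞ ∧ ∀ θ' ∈ C, MomentBound M Q K θ' := by
  refine hC.induction_on (p := fun D => ∃ K : ℝ≥0∞, K ≠ ∞ ∧ ∀ θ' ∈ D, MomentBound M Q K θ')
    ⟨0, by simp, by simp⟩ ?_ ?_ ?_
  · rintro s t hst ⟨K, hK, h⟩
    exact ⟨K, hK, fun θ' hθ' => h θ' (hst hθ')⟩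
  · rintro s t ⟨K, hK, h⟩ ⟨K', hK', h'⟩
    refine ⟨max K K', by simp [hK, hK'], ?_⟩
    rintro θ' (hθ' | hθ')
    · exact (h θ' hθ').mono (le_max_left _ _)
    · exact (h' θ' hθ').mono (le_max_right _ _)
  · intro θ hθ
    obtain ⟨K, hK, h⟩ := hmom.exists_momentBound (hCΘ hθ)
    exact ⟨_, mem_nhdsWithin_of_mem_nhds h, K, hK, fun θ' h => h⟩

lemma lintegral_absCost_lt_top (hmom : LocallyBoundedSecondMoments M Q Θ) (hθΘ : θ ∈ Θ) :
    ∫⁻ x, absCost M x ∂trajLaw M Q θ < ∞ := by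
  obtain ⟨K, hK, h⟩ := hmom.exists_momentBound hθΘ
  exact h.self_of_nhds.absCost_lt_top hK

variable [MeasurableSingletonClass S]

lemma hasGradientAt_meanR (hmom : LocallyBoundedSecondMoments M Q Θ) (hθΘ : θ ∈ Θ) (hθ : θ ∈ Q.U)
    (hrec : PositiveRecurrent M Q θ) :
    HasGradientAt (meanR M Q) (∫ x, cycleGrad M Q M.r θ x ∂trajLaw M Q θ) θ := by
  obtain ⟨K, hK, h⟩ := hmom.exists_momentBound hθΘ
  have := hasGradientAt_integral_cycleCost M.measurable_r (enorm_r_le M) hθ hrec hK h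
  exact this.congr_of_eventuallyEq (.of_forall fun θ' => meanR_eq)

lemma hasGradientAt_meanT (hmom : LocallyBoundedSecondMoments M Q Θ) (hθΘ : θ ∈ Θ) (hθ : θ ∈ Q.U)
    (hrec : PositiveRecurrent M Q θ) :
    HasGradientAt (meanT M Q) (∫ x, cycleGrad M Q (fun _ => 1) θ x ∂trajLaw M Q θ) θ := by
  obtain ⟨K, hK, h⟩ := hmom.exists_momentBound hθΘ
  have := hasGradientAt_integral_cycleCost measurable_const (enorm_one_le M) hθ hrec hK h
  exact this.congr_of_eventuallyEq (.of_forall fun θ' => meanT_eq)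

/-- The gradient of a quotient, in the form `(T ∇R - R ∇T) / T²`. -/
lemma hasGradientAt_div {E : Type*} [NormedAddCommGroup E] [InnerProductSpace ℝ E]
    [CompleteSpace E] {f g : E → ℝ} {f' g' z : E} (hf : HasGradientAt f f' z)
    (hg : HasGradientAt g g' z) (h0 : g z ≠ 0) :
    HasGradientAt (fun w => f w / g w) ((g z ^ 2)⁻¹ • (g z • f' - f z • g')) z := by
  have h1 := hf.hasFDerivAt.mul ((hasDerivAt_inv h0).comp_hasFDerivAt z hg.hasFDerivAt)
  rw [hasGradientAt_iff_hasFDerivAt]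
  refine (h1.congr_fderiv ?_).congr_of_eventuallyEq (.of_forall fun w => by simp [div_eq_mul_inv])
  ext v
  simp
  field_simp
  ring

/-- The gradient of the performance is a positive multiple of `H`. -/
lemma hasGradientAt_J (hmom : LocallyBoundedSecondMoments M Q Θ) (hθΘ : θ ∈ Θ) (hθ : θ ∈ Q.U)
    (hrec : PositiveRecurrent M Q θ) :
    HasGradientAt (J M Q) (((1 - M.γ) * meanT M Q θ ^ 2)⁻¹ • H M Q θ) θ := by
  have hR := hasGradientAt_meanR hmom hθΘ hθ hrec
  have hT := hasGradientAt_meanT hmom hθΘ hθ hrec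
  have hT1 := one_le_meanT (lintegral_absCost_lt_top hmom hθΘ)
  have h1 := (hasGradientAt_div hR hT (by positivity)).hasFDerivAt.const_mul (1 - M.γ)⁻¹
  have h2 : J M Q =ᶠ[𝓝 θ] fun w => (1 - M.γ)⁻¹ * (meanR M Q w / meanT M Q w) := by
    obtain ⟨K, hK, h⟩ := hmom.exists_momentBound hθΘ
    filter_upwards [h] with w hw
    rw [J_eq (hw.absCost_lt_top hK), mul_comm (1 - M.γ), ← div_div, div_eq_inv_mul]
  rw [hasGradientAt_iff_hasFDerivAt]
  refine (h1.congr_of_eventuallyEq h2).congr_fderiv ?_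
  rw [H, hR.gradient, hT.gradient, mul_inv, mul_smul, map_smul _ (1 - M.γ)⁻¹]

lemma H_eq_smul_gradient (hmom : LocallyBoundedSecondMoments M Q Θ) (hθΘ : θ ∈ Θ) (hθ : θ ∈ Q.U)
    (hrec : PositiveRecurrent M Q θ) :
    H M Q θ = ((1 - M.γ) * meanT M Q θ ^ 2) • gradient (J M Q) θ := by
  have hT1 := one_le_meanT (lintegral_absCost_lt_top hmom hθΘ)
  have hγ : 0 < 1 - M.γ := sub_pos.2 M.γ_lt_one
  rw [(hasGradientAt_J hmom hθΘ hθ hrec).gradient, smul_inv_smul₀ (by positivity)]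

/-- Lipschitz bounds pass from `T ≥ 1` and a bounded `h` to `h / T²`. -/
lemma norm_inv_sq_smul_sub_le {E : Type*} [NormedAddCommGroup E] [NormedSpace ℝ E] {T T' : ℝ}
    (h1 : 1 ≤ T) (h2 : 1 ≤ T') (h h' : E) :
    ‖(T ^ 2)⁻¹ • h - (T' ^ 2)⁻¹ • h'‖ ≤ ‖h - h'‖ + 2 * |T - T'| * ‖h'‖ := by
  have hT2 : |(T ^ 2)⁻¹ - (T' ^ 2)⁻¹| ≤ 2 * |T - T'| := by
    have h3 : (T ^ 2)⁻¹ - (T' ^ 2)⁻¹ = (T' - T) * (T⁻¹ * (T'⁻¹) ^ 2 + (T⁻¹) ^ 2 * T'⁻¹) := by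
      field_simp
      ring
    have i1 : T⁻¹ ≤ 1 := inv_le_one_of_one_le₀ h1
    have i2 : T'⁻¹ ≤ 1 := inv_le_one_of_one_le₀ h2
    have i3 : 0 ≤ T⁻¹ := by positivity
    have i4 : 0 ≤ T'⁻¹ := by positivity
    have h4 : T⁻¹ * (T'⁻¹) ^ 2 + (T⁻¹) ^ 2 * T'⁻¹ ≤ 2 := by
      have := mul_le_one₀ i1 (by positivity) (pow_le_one₀ (n := 2) i4 i2)
      have := mul_le_one₀ (pow_le_one₀ (n := 2) i3 i1) (by positivity) i2
      linarith
    rw [h3, abs_mul, abs_sub_comm, abs_of_nonneg (a := T⁻¹ * _ + _) (by positivity), mul_comm]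
    gcongr
  have hsplit : (T ^ 2)⁻¹ • h - (T' ^ 2)⁻¹ • h' =
      (T ^ 2)⁻¹ • (h - h') + ((T ^ 2)⁻¹ - (T' ^ 2)⁻¹) • h' := by
    rw [smul_sub, sub_smul]; abel
  rw [hsplit]
  refine (norm_add_le _ _).trans ?_
  rw [norm_smul, norm_smul, Real.norm_of_nonneg (r := (T ^ 2)⁻¹) (by positivity),
    Real.norm_eq_abs]
  gcongr
  exact mul_le_of_le_one_left (norm_nonneg _) (inv_le_one_of_one_le₀ (one_le_pow₀ h1))

/-- On compact convex sets of parameters the gradient of the performance is Lipschitz. -/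
lemma exists_lipschitz_gradient_J (hmom : LocallyBoundedSecondMoments M Q Θ) (hΘU : Θ ⊆ Q.U)
    (hrec : ∀ θ ∈ Θ, PositiveRecurrent M Q θ) (hLip : LocallyLipschitzOn Θ (H M Q))
    {C : Set (EuclideanSpace ℝ (Fin d))} (hC : IsCompact C) (hCc : Convex ℝ C) (hCΘ : C ⊆ Θ) :
    ∃ L : ℝ, 0 < L ∧ ∀ θ ∈ C, ∀ θ' ∈ C,
      ‖gradient (J M Q) θ - gradient (J M Q) θ'‖ ≤ L * ‖θ - θ'‖ := by
  have hγ : 0 < 1 - M.γ := sub_pos.2 M.γ_lt_one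
  obtain ⟨K, hK, hmK⟩ := hmom.exists_momentBound_of_isCompact hC hCΘ
  obtain ⟨LH, hLH⟩ := (hLip.mono hCΘ).exists_lipschitzOnWith_of_compact hC
  obtain ⟨BH, hBH⟩ := hC.exists_bound_of_continuousOn hLH.continuousOn
  have hT1 : ∀ θ ∈ C, 1 ≤ meanT M Q θ := fun θ hθ =>
    one_le_meanT (lintegral_absCost_lt_top hmom (hCΘ hθ))
  -- the mean cycle time is Lipschitz, because its gradient is bounded
  have hTlip : ∀ θ ∈ C, ∀ θ' ∈ C,
      |meanT M Q θ - meanT M Q θ'| ≤ (K + 1).toReal * ‖θ - θ'‖ := by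
    intro θ hθ θ' hθ'
    refine hCc.norm_image_sub_le_of_norm_hasFDerivWithin_le (f := meanT M Q)
      (fun w hw => ((hasGradientAt_meanT hmom (hCΘ hw) (hΘU (hCΘ hw))
        (hrec w (hCΘ hw))).hasFDerivAt).hasFDerivWithinAt) (fun w hw => ?_) hθ' hθ
    rw [LinearIsometryEquiv.norm_map, ← ENNReal.ofReal_le_iff_le_toReal (by finiteness), ofReal_norm]
    refine (enorm_integral_le_lintegral_enorm _).trans ?_
    calc _ ≤ ∫⁻ x, (absLR M Q w x ^ 2 + 1) ∂trajLaw M Q w := by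
          refine lintegral_mono fun x => (enorm_cycleGrad_le (enorm_one_le M) x).trans ?_
          simpa using ENNReal.le_mul_sq_add_inv one_ne_zero ENNReal.one_ne_top (absLR M Q w x)
      _ ≤ K + 1 := by
          rw [lintegral_add_right _ measurable_const]
          simpa using (hmK w hw).2
  refine ⟨(1 - M.γ)⁻¹ * (LH + 2 * (K + 1).toReal * |BH|) + 1, by positivity,
    fun θ hθ θ' hθ' => ?_⟩
  rw [(hasGradientAt_J hmom (hCΘ hθ) (hΘU (hCΘ hθ)) (hrec θ (hCΘ hθ))).gradient,
    (hasGradientAt_J hmom (hCΘ hθ') (hΘU (hCΘ hθ')) (hrec θ' (hCΘ hθ'))).gradient,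
    mul_inv, mul_inv, mul_smul, mul_smul, ← smul_sub, norm_smul, Real.norm_of_nonneg (by positivity)]
  have hHd : ‖H M Q θ - H M Q θ'‖ ≤ LH * ‖θ - θ'‖ := by
    simpa [dist_eq_norm] using hLH.dist_le_mul θ hθ θ' hθ'
  have hfin := norm_inv_sq_smul_sub_le (hT1 θ hθ) (hT1 θ' hθ') (H M Q θ) (H M Q θ')
  have hfin2 : 2 * |meanT M Q θ - meanT M Q θ'| * ‖H M Q θ'‖ ≤
      2 * ((K + 1).toReal * ‖θ - θ'‖) * |BH| :=
    mul_le_mul (mul_le_mul_of_nonneg_left (hTlip θ hθ θ' hθ') zero_le_two)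
      ((hBH θ' hθ').trans (le_abs_self _)) (norm_nonneg _) (by positivity)
  refine (mul_le_mul_of_nonneg_left (hfin.trans (add_le_add hHd hfin2)) (inv_nonneg.2 hγ.le)).trans
    ?_
  have := norm_nonneg (θ - θ')
  linarith

end Performance

/-! ### Later cycles are first cycles of the regenerated trajectory -/

section NextCycle

variable {S A : Type*}

/-- The trajectory from its first return to `s₀` on. A trajectory that never returns is left
unchanged, since `(⊤ : ℕ∞).toNat = 0`. -/
def nextCycle (s₀ : S) (x : ℕ → S × A) : ℕ → S × A := shift (returnTime s₀ x 1).toNat x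

/-- The trajectories that return to `s₀` at least once. -/
def returns (s₀ : S) : Set (ℕ → S × A) := ⋃ k, firstReturn s₀ k

/-- The trajectories that return to `s₀` infinitely often. -/
def returnsForever (s₀ : S) : Set (ℕ → S × A) := {x | ∀ n, (nextCycle s₀)^[n] x ∈ returns s₀}

lemma nextCycle_of_mem_firstReturn {s₀ : S} {x : ℕ → S × A} {k : ℕ} (hx : x ∈ firstReturn s₀ k) :
    nextCycle s₀ x = shift (k + 1) x := by
  rw [nextCycle, returnTime_of_mem_firstReturn hx, ENat.toNat_natCast]

lemma shift_shift (k j : ℕ) (x : ℕ → S × A) : shift j (shift k x) = shift (k + j) x := by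
  funext t; simp only [shift]; congr 1; omega

/-- If the `n`-th return is at time `k`, and the trajectory from then on first returns `j + 1`
steps later, then the next return is at time `k + (j + 1)`. -/
lemma returnTime_succ_eq {s₀ : S} {x : ℕ → S × A} {n k j : ℕ} (hk : returnTime s₀ x n = k)
    (hj : shift k x ∈ firstReturn s₀ j) : returnTime s₀ x (n + 1) = (k + (j + 1) : ℕ) := by
  refine enat_eq_of_forall_lt_iff fun t => ?_
  rw [lt_returnTime_succ_iff, hk, Nat.cast_lt]
  refine ⟨fun h => h _ (Nat.cast_lt.2 (by omega)) ?_, fun h i hi hs => ?_⟩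
  · have := state_of_mem_firstReturn hj
    rwa [shift, Nat.add_comm] at this
  · rw [Nat.cast_lt] at hi
    by_contra hc
    refine hj.1 (i - k) (by omega) (by omega) ?_
    rwa [shift, Nat.sub_add_cancel hi.le]

lemma exists_returnTime_eq {s₀ : S} {x : ℕ → S × A} (hx : x ∈ returnsForever s₀) (n : ℕ) :
    ∃ k : ℕ, returnTime s₀ x n = k ∧ (nextCycle s₀)^[n] x = shift k x := by
  induction n with
  | zero => exact ⟨0, rfl, rfl⟩
  | succ n ih =>
    obtain ⟨k, hk, hsk⟩ := ih
    obtain ⟨j, hj⟩ := Set.mem_iUnion.1 (hx n)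
    refine ⟨k + (j + 1), returnTime_succ_eq hk (hsk ▸ hj), ?_⟩
    rw [Function.iterate_succ_apply', nextCycle_of_mem_firstReturn hj, hsk, shift_shift]

/-- The sum over the last part of the cycle after the `n`-th return, as a finite sum along the
regenerated trajectory. -/
lemma cycleSum_eq {s₀ : S} {x : ℕ → S × A} {n k j : ℕ} (hk : returnTime s₀ x n = k)
    (hj : shift k x ∈ firstReturn s₀ j) {γ : ℝ} (hγ : γ ≠ 0) (f : ℕ → ℝ) (s : ℕ) :
    cycleSum γ s₀ f x n (s + k) = ∑ t ∈ Finset.Ico s (j + 1), γ ^ t * f (t + k) := by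
  rw [cycleSum, hk, ENat.toNat_natCast, tsum_eq_sum (s := Finset.Ico (s + k) (j + 1 + k)),
    ← Finset.sum_Ico_add' _ s (j + 1) k, Finset.mul_sum]
  · refine Finset.sum_congr rfl fun t ht => ?_
    rw [Finset.mem_Ico] at ht
    rw [Set.indicator_of_mem, pow_add]
    · field_simp
    · refine ⟨⟨?_, ?_⟩, Set.mem_Ici.2 (by omega)⟩
      · rw [hk]; exact Nat.cast_le.2 (by omega)
      · rw [returnTime_succ_eq hk hj]; exact Nat.cast_lt.2 (by omega)
  · intro t ht
    rw [Set.indicator_of_notMem]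
    rintro ⟨⟨-, h2⟩, h3⟩
    rw [returnTime_succ_eq hk hj, Nat.cast_lt] at h2
    rw [Set.mem_Ici] at h3
    exact ht (Finset.mem_Ico.2 ⟨h3, by omega⟩)

end NextCycle

section Regeneration

variable {S A : Type*} [MeasurableSpace S] [MeasurableSpace A] {d : ℕ}
  {M : MDP S A} {Q : ParamPolicy d S A} {θ : EuclideanSpace ℝ (Fin d)} {c : S × A × S → ℝ}

lemma costTerm_of_mem_firstReturn {x : ℕ → S × A} {j : ℕ} (hx : x ∈ firstReturn M.s₀ j) (t : ℕ) :
    costTerm M c t x = if t < j + 1 then M.γ ^ t * cost c x t else 0 := by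
  have h := mem_alive_of_mem_firstReturn hx t
  by_cases ht : t < j + 1
  · rw [costTerm, Set.indicator_of_mem (h.2 ht), if_pos ht]
  · rw [costTerm, Set.indicator_of_notMem (mt h.1 ht), if_neg ht]

lemma cycleCost_of_mem_firstReturn {x : ℕ → S × A} {j : ℕ} (hx : x ∈ firstReturn M.s₀ j) :
    cycleCost M c x = ∑ t ∈ Finset.range (j + 1), M.γ ^ t * cost c x t := by
  rw [cycleCost, tsum_eq_sum (s := Finset.range (j + 1))]
  · refine Finset.sum_congr rfl fun t ht => ?_
    rw [costTerm_of_mem_firstReturn hx, if_pos (Finset.mem_range.1 ht)]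
  · intro t ht
    rw [costTerm_of_mem_firstReturn hx, if_neg (by simpa using ht)]

lemma cycleGrad_of_mem_firstReturn {x : ℕ → S × A} {j : ℕ} (hx : x ∈ firstReturn M.s₀ j) :
    cycleGrad M Q c θ x = ∑ t ∈ Finset.range (j + 1),
      (M.γ ^ t * cost c x t) • ∑ σ ∈ Finset.range (t + 1), Q.score θ (x σ) := by
  rw [cycleGrad, tsum_eq_sum (s := Finset.range (j + 1))]
  · refine Finset.sum_congr rfl fun t ht => ?_
    rw [costTerm_of_mem_firstReturn hx, if_pos (Finset.mem_range.1 ht)]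
  · intro t ht
    rw [costTerm_of_mem_firstReturn hx, if_neg (by simpa using ht), zero_smul]

lemma cycleSum_eq_cycleCost {x : ℕ → S × A} (hx : x ∈ returnsForever M.s₀) (n : ℕ) :
    cycleSum M.γ M.s₀ (cost c x) x n 0 = cycleCost M c ((nextCycle M.s₀)^[n] x) := by
  obtain ⟨k, hk, hsk⟩ := exists_returnTime_eq hx n
  obtain ⟨j, hj⟩ := Set.mem_iUnion.1 (hx n)
  have h0 : cycleSum M.γ M.s₀ (cost c x) x n 0 = cycleSum M.γ M.s₀ (cost c x) x n (0 + k) := by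
    rw [cycleSum, cycleSum]
    congr 2 with t
    congr 1
    ext t
    refine and_congr_right fun h => ?_
    have := h.1
    rw [hk, Nat.cast_le] at this
    simpa using this
  rw [h0, cycleSum_eq hk (hsk ▸ hj) M.γ_pos.ne', cycleCost_of_mem_firstReturn hj,
    Finset.range_eq_Ico, hsk]
  exact Finset.sum_congr rfl fun t _ => by rw [cost_shift]

/-- Exchanging the two sums of a cycle turns the scores weighted with the future costs into the
costs weighted with the past scores. -/
lemma tsum_cycleSum_smul_score {x : ℕ → S × A} (hx : x ∈ returnsForever M.s₀) (n : ℕ) :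
    ∑' σ : ℕ, (cycle M.s₀ x n).indicator
      (fun σ => cycleSum M.γ M.s₀ (cost c x) x n σ • Q.score θ (x σ)) σ =
    cycleGrad M Q c θ ((nextCycle M.s₀)^[n] x) := by
  obtain ⟨k, hk, hsk⟩ := exists_returnTime_eq hx n
  obtain ⟨j, hj⟩ := Set.mem_iUnion.1 (hx n)
  have hj' : shift k x ∈ firstReturn M.s₀ j := hsk ▸ hj
  have hcyc : ∀ σ, σ ∈ cycle M.s₀ x n ↔ σ ∈ Finset.Ico (0 + k) (j + 1 + k) := fun σ => by
    simp only [cycle, Set.mem_ofPred_eq, hk, returnTime_succ_eq hk hj', Nat.cast_le, Nat.cast_lt,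
      Finset.mem_Ico]
    omega
  rw [tsum_eq_sum (s := Finset.Ico (0 + k) (j + 1 + k)), ← Finset.sum_Ico_add' _ 0 (j + 1) k,
    cycleGrad_of_mem_firstReturn hj, hsk, Finset.range_eq_Ico]
  · calc _ = ∑ σ ∈ Finset.Ico 0 (j + 1), ∑ t ∈ Finset.Ico σ (j + 1),
          (M.γ ^ t * cost c (shift k x) t) • Q.score θ (shift k x σ) := by
          refine Finset.sum_congr rfl fun σ hσ => ?_
          rw [Finset.mem_Ico] at hσ
          rw [Set.indicator_of_mem ((hcyc _).2 (Finset.mem_Ico.2 (by omega))),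
            cycleSum_eq hk hj' M.γ_pos.ne', Finset.sum_smul]
          exact Finset.sum_congr rfl fun t _ => by rw [cost_shift]; rfl
      _ = _ := by
          rw [Finset.sum_Ico_Ico_comm]
          refine Finset.sum_congr rfl fun t _ => ?_
          rw [Finset.smul_sum, Finset.range_eq_Ico]
  · intro σ hσ
    rw [Set.indicator_of_notMem (mt (hcyc σ).1 hσ)]

/-- The average cost of the first `N` cycles. -/
def avgCost (M : MDP S A) (c : S × A × S → ℝ) (N : ℕ) (x : ℕ → S × A) : ℝ :=
  (N : ℝ)⁻¹ * ∑ n ∈ Finset.range N, cycleCost M c ((nextCycle M.s₀)^[n] x)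

/-- The average over the first `N` cycles of the likelihood-ratio gradient estimates. -/
def avgGrad (M : MDP S A) (Q : ParamPolicy d S A) (c : S × A × S → ℝ) (N : ℕ)
    (θ : EuclideanSpace ℝ (Fin d)) (x : ℕ → S × A) : EuclideanSpace ℝ (Fin d) :=
  (N : ℝ)⁻¹ • ∑ n ∈ Finset.range N, cycleGrad M Q c θ ((nextCycle M.s₀)^[n] x)

/-- The estimate of `H` written in terms of the regenerated trajectories. It is measurable, and it
equals `estH` on trajectories that return infinitely often. -/
def regenEst (M : MDP S A) (Q : ParamPolicy d S A) (N : ℕ) (θ : EuclideanSpace ℝ (Fin d))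
    (w : (ℕ → S × A) × (ℕ → S × A)) : EuclideanSpace ℝ (Fin d) :=
  avgCost M (fun _ => 1) N w.1 • avgGrad M Q M.r N θ w.2 -
    avgCost M M.r N w.1 • avgGrad M Q (fun _ => 1) N θ w.2

lemma estH_eq_regenEst {x y : ℕ → S × A} (hx : x ∈ returnsForever M.s₀)
    (hy : y ∈ returnsForever M.s₀) (N : ℕ) : estH M Q N θ x y = regenEst M Q N θ (x, y) := by
  have h1 : ∀ c : S × A × S → ℝ, avgEst M N (cost c x) x = avgCost M c N x := fun c => by
    simp only [avgEst, avgCost, cycleSum_eq_cycleCost hx]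
  have h2 : ∀ c : S × A × S → ℝ, gradEst M Q N θ (cost c y) y = avgGrad M Q c N θ y := fun c => by
    simp only [gradEst, avgGrad, tsum_cycleSum_smul_score hy]
  rw [regenEst, ← h1, ← h1, ← h2, ← h2]
  rfl

variable [MeasurableSingletonClass S]

lemma measurable_nextCycle (s₀ : S) : Measurable (nextCycle s₀ : (ℕ → S × A) → ℕ → S × A) := by
  have hτ : Measurable fun x : ℕ → S × A => (returnTime s₀ x 1).toNat := by
    refine measurable_to_countable' fun k => ?_
    cases k with
    | zero =>
      have : (fun x : ℕ → S × A => (returnTime s₀ x 1).toNat) ⁻¹' {0} =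
          (⋃ k, firstReturn s₀ k)ᶜ := by
        ext x
        simp only [Set.mem_preimage, Set.mem_singleton_iff, Set.mem_compl_iff, Set.mem_iUnion]
        rcases alive_or_firstReturn s₀ x with h | ⟨k, hk⟩
        · have h2 : returnTime s₀ x 1 = ⊤ := enat_eq_of_forall_lt_iff fun n => iff_of_true
            ((mem_alive_iff _ _ _).1 (h n)) (ENat.natCast_lt_top n)
          simp only [h2, ENat.toNat_top, true_iff]
          exact fun ⟨k, hk⟩ => hk.2 (h (k + 1))
        · rw [returnTime_of_mem_firstReturn hk, ENat.toNat_natCast]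
          exact iff_of_false (by simp) (fun h => h ⟨k, hk⟩)
      rw [this]
      exact (MeasurableSet.iUnion fun k => measurableSet_firstReturn s₀ k).compl
    | succ k =>
      have : (fun x : ℕ → S × A => (returnTime s₀ x 1).toNat) ⁻¹' {k + 1} = firstReturn s₀ k := by
        ext x
        rw [mem_firstReturn_iff, Set.mem_preimage, Set.mem_singleton_iff,
          ENat.toNat_eq_iff (Nat.succ_ne_zero k)]
      rw [this]
      exact measurableSet_firstReturn s₀ k
  have h : Measurable fun p : ℕ × (ℕ → S × A) => shift p.1 p.2 :=
    measurable_from_prod_countable_right fun k => measurable_shift k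
  exact h.comp (hτ.prodMk measurable_id)

lemma measurableSet_returns (s₀ : S) : MeasurableSet (returns s₀ : Set (ℕ → S × A)) :=
  MeasurableSet.iUnion fun k => measurableSet_firstReturn s₀ k

lemma measurableSet_returnsForever (s₀ : S) :
    MeasurableSet (returnsForever s₀ : Set (ℕ → S × A)) := by
  simp only [returnsForever, Set.ofPred_forall]
  exact MeasurableSet.iInter fun n => (measurable_nextCycle s₀).iterate n (measurableSet_returns s₀)

lemma ae_mem_returns (hrec : PositiveRecurrent M Q θ) :
    ∀ᵐ x ∂trajLaw M Q θ, x ∈ returns M.s₀ := by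
  have h := measure_iInter_alive hrec
  rw [measure_eq_zero_iff_ae_notMem] at h
  filter_upwards [h] with x hx
  rcases alive_or_firstReturn M.s₀ x with h2 | h2
  · exact absurd (Set.mem_iInter.2 h2) hx
  · exact Set.mem_iUnion.2 h2

/-- The strong Markov property at the first return: the regenerated trajectory has the law of the
original one. -/
lemma measurePreserving_nextCycle (hrec : PositiveRecurrent M Q θ) :
    MeasurePreserving (nextCycle M.s₀) (trajLaw M Q θ) (trajLaw M Q θ) := by
  refine ⟨measurable_nextCycle M.s₀, ?_⟩
  have key : ∀ f : (ℕ → S × A) → ℝ≥0∞, Measurable f → ∫⁻ x, f (nextCycle M.s₀ x) ∂trajLaw M Q θ =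
      (∑' k, trajLaw M Q θ (firstReturn M.s₀ k)) * ∫⁻ x, f x ∂trajLaw M Q θ := by
    intro f hf
    rw [← ENNReal.tsum_mul_right]
    simp_rw [← setLIntegral_firstReturn_shift M Q θ _ hf]
    rw [← lintegral_tsum
      (f := fun k => (firstReturn M.s₀ k).indicator fun x => f (shift (k + 1) x))
      fun k => ((hf.comp (measurable_shift (k + 1))).indicator
        (measurableSet_firstReturn M.s₀ k)).aemeasurable]
    refine lintegral_congr_ae ?_
    filter_upwards [ae_mem_returns hrec] with x hx
    obtain ⟨k, hk⟩ := Set.mem_iUnion.1 hx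
    rw [tsum_firstReturn_indicator M.s₀ (fun k x => f (shift (k + 1) x)) hk,
      nextCycle_of_mem_firstReturn hk]
  have h1 := key (fun _ => 1) measurable_const
  simp only [lintegral_const, measure_univ, mul_one] at h1
  ext B hB
  rw [Measure.map_apply (measurable_nextCycle M.s₀) hB,
    ← lintegral_indicator_one (measurable_nextCycle M.s₀ hB), ← lintegral_indicator_one hB]
  have h2 := key (B.indicator 1) (measurable_one.indicator hB)
  rw [← h1, one_mul] at h2
  exact h2

lemma ae_mem_returnsForever (hrec : PositiveRecurrent M Q θ) :
    ∀ᵐ x ∂trajLaw M Q θ, x ∈ returnsForever M.s₀ :=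
  ae_all_iff.2 fun n =>
    ((measurePreserving_nextCycle hrec).iterate n).quasiMeasurePreserving.ae (ae_mem_returns hrec)

end Regeneration

/-! ### The estimates are unbiased and square integrable -/

section Estimates

variable {S A : Type*} [MeasurableSpace S] [MeasurableSingletonClass S] [MeasurableSpace A] {d : ℕ}
  {M : MDP S A} {Q : ParamPolicy d S A} {θ : EuclideanSpace ℝ (Fin d)} {c : S × A × S → ℝ} {N : ℕ}

lemma measurable_cycleGrad_prod (hc : Measurable c) :
    Measurable fun w : Q.U × (ℕ → S × A) => cycleGrad M Q c w.1 w.2 := by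
  refine Measurable.tsum fun t => ((measurable_costTerm hc t).comp measurable_snd).smul ?_
  exact Finset.measurable_sum _ fun σ _ => Q.measurable_score_prod.comp
    (measurable_fst.prodMk ((measurable_pi_apply σ).comp measurable_snd))

lemma measurable_avgCost (hc : Measurable c) : Measurable (avgCost M c N) :=
  (Finset.measurable_sum _ fun n _ => (measurable_cycleCost hc).comp
    ((measurable_nextCycle M.s₀).iterate n)).const_mul _

lemma measurable_avgGrad_prod (hc : Measurable c) :
    Measurable fun w : Q.U × (ℕ → S × A) => avgGrad M Q c N w.1 w.2 := by
  have h : ∀ n, Measurable fun w : Q.U × (ℕ → S × A) =>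
      cycleGrad M Q c w.1 ((nextCycle M.s₀)^[n] w.2) := fun n =>
    (measurable_cycleGrad_prod (M := M) (Q := Q) hc).comp
      (measurable_fst.prodMk (((measurable_nextCycle M.s₀).iterate n).comp measurable_snd))
  exact (Finset.measurable_fun_sum (Finset.range N) fun n _ => h n).const_smul (N : ℝ)⁻¹

lemma measurable_regenEst_prod : Measurable
    fun w : Q.U × (ℕ → S × A) × (ℕ → S × A) => regenEst M Q N w.1 w.2 := by
  have h1 : Measurable fun w : Q.U × (ℕ → S × A) × (ℕ → S × A) => w.2.1 := by fun_prop
  have h2 : Measurable fun w : Q.U × (ℕ → S × A) × (ℕ → S × A) => (w.1, w.2.2) := by fun_prop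
  have hC : ∀ c, Measurable c → Measurable
      fun w : Q.U × (ℕ → S × A) × (ℕ → S × A) => avgCost M c N w.2.1 := fun c hc =>
    (measurable_avgCost hc).comp h1
  have hG : ∀ c, Measurable c → Measurable
      fun w : Q.U × (ℕ → S × A) × (ℕ → S × A) => avgGrad M Q c N w.1 w.2.2 := fun c hc => by
    have h3 := (measurable_avgGrad_prod (M := M) (Q := Q) (N := N) hc).comp h2
    simpa only [Function.comp_def] using h3
  have k1 := (hC (fun _ => 1) measurable_const).smul (hG M.r M.measurable_r)
  have k2 := (hC M.r M.measurable_r).smul (hG (fun _ => 1) measurable_const)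
  simp only [regenEst]
  exact k1.sub k2

lemma measurable_regenEst (hθ : θ ∈ Q.U) : Measurable (regenEst M Q N θ) := by
  have h : Measurable fun w : (ℕ → S × A) × (ℕ → S × A) => ((⟨θ, hθ⟩ : Q.U), w) :=
    measurable_prodMk_left
  have h2 := (measurable_regenEst_prod (M := M) (Q := Q) (N := N)).comp h
  simpa only [Function.comp_def] using h2

lemma integral_average {E : Type*} [NormedAddCommGroup E] [NormedSpace ℝ E]
    (hrec : PositiveRecurrent M Q θ) (hN : 0 < N) {f : (ℕ → S × A) → E}
    (hf : Integrable f (trajLaw M Q θ)) :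
    Integrable (fun x => (N : ℝ)⁻¹ • ∑ n ∈ Finset.range N, f ((nextCycle M.s₀)^[n] x))
      (trajLaw M Q θ) ∧
    ∫ x, (N : ℝ)⁻¹ • ∑ n ∈ Finset.range N, f ((nextCycle M.s₀)^[n] x) ∂trajLaw M Q θ =
      ∫ x, f x ∂trajLaw M Q θ := by
  have hp := fun n => (measurePreserving_nextCycle hrec).iterate n
  have hi : ∀ n, Integrable (fun x => f ((nextCycle M.s₀)^[n] x)) (trajLaw M Q θ) := fun n =>
    (hp n).integrable_comp_of_integrable hf
  refine ⟨(integrable_finsetSum _ fun n _ => hi n).smul _, ?_⟩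
  have he : ∀ n, ∫ x, f ((nextCycle M.s₀)^[n] x) ∂trajLaw M Q θ = ∫ x, f x ∂trajLaw M Q θ := by
    intro n
    have h := integral_map (hp n).measurable.aemeasurable
      ((hp n).map_eq.symm ▸ hf.aestronglyMeasurable : AEStronglyMeasurable f
        ((trajLaw M Q θ).map (nextCycle M.s₀)^[n]))
    rw [← h, (hp n).map_eq]
  rw [integral_smul, integral_finsetSum _ fun n _ => hi n]
  simp_rw [he]
  rw [Finset.sum_const, Finset.card_range, ← Nat.cast_smul_eq_nsmul ℝ,
    inv_smul_smul₀ (Nat.cast_ne_zero.2 hN.ne')]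

lemma lintegral_sum_sq_le (hrec : PositiveRecurrent M Q θ) {u : (ℕ → S × A) → ℝ≥0∞}
    (hu : Measurable u) {K : ℝ≥0∞} (hK : ∫⁻ x, u x ^ 2 ∂trajLaw M Q θ ≤ K) :
    ∫⁻ x, (∑ n ∈ Finset.range N, u ((nextCycle M.s₀)^[n] x)) ^ 2 ∂trajLaw M Q θ ≤ N * (N * K) := by
  have hp := fun n => (measurePreserving_nextCycle hrec).iterate n
  calc _ ≤ ∫⁻ x, N * ∑ n ∈ Finset.range N, u ((nextCycle M.s₀)^[n] x) ^ 2 ∂trajLaw M Q θ := by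
        refine lintegral_mono fun x => ?_
        have h := ENNReal.rpow_sum_le_const_mul_sum_rpow (Finset.range N)
          (fun n => u ((nextCycle M.s₀)^[n] x)) (p := 2) (by norm_num)
        norm_num at h
        exact h
    _ = N * ∑ n ∈ Finset.range N, ∫⁻ x, u ((nextCycle M.s₀)^[n] x) ^ 2 ∂trajLaw M Q θ := by
        have hm : ∀ n, Measurable fun x => u ((nextCycle M.s₀)^[n] x) ^ 2 := fun n =>
          (hu.comp (hp n).measurable).pow_const 2
        rw [lintegral_const_mul _ (Finset.measurable_sum _ fun n _ => hm n),
          lintegral_finsetSum _ fun n _ => hm n]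
    _ ≤ N * (N * K) := by
        gcongr
        calc _ ≤ ∑ n ∈ Finset.range N, K := Finset.sum_le_sum fun n _ => by
              rw [(hp n).lintegral_comp (hu.pow_const 2)]; exact hK
          _ = N * K := by simp

omit [MeasurableSpace S] [MeasurableSingletonClass S] [MeasurableSpace A] in
lemma enorm_average_le {E : Type*} [NormedAddCommGroup E] [NormedSpace ℝ E]
    (N : ℕ) (v : ℕ → E) : ‖(N : ℝ)⁻¹ • ∑ n ∈ Finset.range N, v n‖ₑ ≤
      ∑ n ∈ Finset.range N, ‖v n‖ₑ := by
  rw [enorm_smul]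
  refine (mul_le_of_le_one_left zero_le ?_).trans (enorm_sum_le _ _)
  rw [← ofReal_norm, ENNReal.ofReal_le_one, Real.norm_of_nonneg (by positivity)]
  exact Nat.cast_inv_le_one N

/-- The mean of the estimate is `H`. -/
lemma integral_regenEst {K : ℝ≥0∞} (hθ : θ ∈ Q.U) (hrec : PositiveRecurrent M Q θ) (hK : K ≠ ∞)
    (hm : MomentBound M Q K θ) (hN : 0 < N)
    (hR : HasGradientAt (meanR M Q) (∫ x, cycleGrad M Q M.r θ x ∂trajLaw M Q θ) θ)
    (hT : HasGradientAt (meanT M Q) (∫ x, cycleGrad M Q (fun _ => 1) θ x ∂trajLaw M Q θ) θ) :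
    ∫ w, regenEst M Q N θ w ∂(trajLaw M Q θ).prod (trajLaw M Q θ) = H M Q θ := by
  have hC := hm.absCost_lt_top hK
  have hG := hm.absLR_lt_top hK
  have r1 := integral_average hrec hN (integrable_cycleCost M.measurable_r (enorm_r_le M) hC)
  have t1 := integral_average hrec hN
    (integrable_cycleCost (c := fun _ => 1) measurable_const (enorm_one_le M) hC)
  have r2 := integral_average hrec hN (integrable_cycleGrad M.measurable_r (enorm_r_le M) hθ hG)
  have t2 := integral_average hrec hN
    (integrable_cycleGrad (c := fun _ => 1) measurable_const (enorm_one_le M) hθ hG)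
  rw [← meanR_eq] at r1
  rw [← meanT_eq] at t1
  rw [H, hR.gradient, hT.gradient, ← r1.2, ← t1.2, ← r2.2, ← t2.2, ← integral_prod_smul,
    ← integral_prod_smul, ← integral_sub (t1.1.smul_prod r2.1) (r1.1.smul_prod t2.1)]
  rfl

/-- The second moment of the estimate is bounded in terms of the moments of the cycles. -/
lemma lintegral_regenEst_sq_le {K : ℝ≥0∞} (hθ : θ ∈ Q.U) (hrec : PositiveRecurrent M Q θ)
    (hm : MomentBound M Q K θ) :
    ∫⁻ w, ‖regenEst M Q N θ w‖ₑ ^ 2 ∂(trajLaw M Q θ).prod (trajLaw M Q θ) ≤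
      4 * ((N * (N * K)) * (N * (N * K))) := by
  set u : (ℕ → S × A) → ℝ≥0∞ := fun x =>
    ∑ n ∈ Finset.range N, absCost M ((nextCycle M.s₀)^[n] x) with hu
  set v : (ℕ → S × A) → ℝ≥0∞ := fun x =>
    ∑ n ∈ Finset.range N, absLR M Q θ ((nextCycle M.s₀)^[n] x) with hv
  have hum : Measurable u := Finset.measurable_sum _ fun n _ =>
    measurable_absCost.comp ((measurable_nextCycle M.s₀).iterate n)
  have hvm : Measurable v := Finset.measurable_sum _ fun n _ =>
    (measurable_absLR hθ).comp ((measurable_nextCycle M.s₀).iterate n)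
  have hc : ∀ c : S × A × S → ℝ, (∀ z, ‖c z‖ₑ ≤ 1 + ‖M.r z‖ₑ) → ∀ x, ‖avgCost M c N x‖ₑ ≤ u x :=
    fun c hcr x => (enorm_average_le N _).trans
      (Finset.sum_le_sum fun n _ => enorm_cycleCost_le hcr _)
  have hg : ∀ c : S × A × S → ℝ, (∀ z, ‖c z‖ₑ ≤ 1 + ‖M.r z‖ₑ) → ∀ x,
      ‖avgGrad M Q c N θ x‖ₑ ≤ v x :=
    fun c hcr x => (enorm_average_le N _).trans
      (Finset.sum_le_sum fun n _ => enorm_cycleGrad_le hcr _)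
  calc _ ≤ ∫⁻ w, 4 * (u w.1 ^ 2 * v w.2 ^ 2) ∂(trajLaw M Q θ).prod (trajLaw M Q θ) := by
        refine lintegral_mono fun w => ?_
        calc ‖regenEst M Q N θ w‖ₑ ^ 2 ≤ (u w.1 * v w.2 + u w.1 * v w.2) ^ 2 := by
              gcongr
              refine (enorm_sub_le).trans ?_
              rw [enorm_smul, enorm_smul]
              gcongr
              · exact hc _ (enorm_one_le M) _
              · exact hg _ (enorm_r_le M) _
              · exact hc _ (enorm_r_le M) _
              · exact hg _ (enorm_one_le M) _
          _ = 4 * (u w.1 ^ 2 * v w.2 ^ 2) := by rw [← two_mul]; ring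
    _ ≤ _ := by
        rw [lintegral_const_mul' _ _ (by simp),
          lintegral_prod_mul (f := fun x => u x ^ 2) (g := fun x => v x ^ 2)
          (hum.pow_const 2).aemeasurable (hvm.pow_const 2).aemeasurable]
        gcongr
        · exact lintegral_sum_sq_le hrec measurable_absCost hm.1
        · exact lintegral_sum_sq_le hrec (measurable_absLR hθ) hm.2

end Estimates

/-! ### Convergence of square integrable martingale difference series -/

section MartingaleSeries

variable {Ω : Type*} {mΩ : MeasurableSpace Ω} {μ : Measure Ω} [IsProbabilityMeasure μ]
  {ℱ : Filtration ℕ mΩ}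

/-- A martingale difference is orthogonal to the past. -/
lemma integral_mul_eq_zero_of_setIntegral {m : MeasurableSpace Ω} (hm : m ≤ mΩ) {S D : Ω → ℝ}
    (hS : StronglyMeasurable[m] S) (hS2 : MemLp S 2 μ) (hD2 : MemLp D 2 μ)
    (h0 : ∀ F, MeasurableSet[m] F → ∫ ω in F, D ω ∂μ = 0) : ∫ ω, S ω * D ω ∂μ = 0 := by
  have hD : Integrable D μ := hD2.integrable one_le_two
  have hc : (0 : Ω → ℝ) =ᵐ[μ] μ[D | m] :=
    ae_eq_condExp_of_forall_setIntegral_eq hm hD (fun _ _ _ => integrableOn_zero)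
      (fun F hF _ => by rw [h0 F hF]; simp) aestronglyMeasurable_zero
  have h1 := condExp_mul_of_stronglyMeasurable_left hS (hS2.integrable_mul hD2) hD
  have h2 : ∫ ω, (S * D) ω ∂μ = 0 := by
    rw [← integral_condExp hm (f := S * D)]
    refine integral_eq_zero_of_ae ?_
    filter_upwards [h1, hc] with ω h3 h4
    rw [h3, Pi.mul_apply, ← h4]
    simp
  exact h2

/-- A series of martingale differences with summable second moments converges almost surely. -/
theorem ae_exists_tendsto_sum_of_martingale_difference {D : ℕ → Ω → ℝ}
    (hD : ∀ n, StronglyMeasurable[ℱ (n + 1)] (D n)) (hL : ∀ n, MemLp (D n) 2 μ) {b : ℕ → ℝ}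
    (hb : ∀ n, ∫ ω, D n ω ^ 2 ∂μ ≤ b n) (hs : Summable b)
    (h0 : ∀ n F, MeasurableSet[ℱ n] F → ∫ ω in F, D n ω ∂μ = 0) :
    ∀ᵐ ω ∂μ, ∃ l, Tendsto (fun n => ∑ i ∈ Finset.range n, D i ω) atTop (𝓝 l) := by
  set S : ℕ → Ω → ℝ := fun n ω => ∑ i ∈ Finset.range n, D i ω with hS
  have hSm : ∀ n, StronglyMeasurable[ℱ n] (S n) := fun n =>
    Finset.stronglyMeasurable_fun_sum _ fun i hi =>
      (hD i).mono (ℱ.mono (Nat.succ_le_of_lt (Finset.mem_range.1 hi)))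
  have hSL : ∀ n, MemLp (S n) 2 μ := fun n => memLp_finsetSum _ fun i _ => hL i
  have hint : ∀ n, Integrable (S n) μ := fun n => (hSL n).integrable one_le_two
  have hsucc : ∀ n ω, S (n + 1) ω = S n ω + D n ω := fun n ω => Finset.sum_range_succ _ _
  have hvar : ∀ n, ∫ ω, S n ω ^ 2 ∂μ = ∑ i ∈ Finset.range n, ∫ ω, D i ω ^ 2 ∂μ := by
    intro n
    induction n with
    | zero => simp [hS]
    | succ n ih =>
      have i1 := (hSL n).integrable_sq
      have i2 := ((hSL n).integrable_mul (hL n)).const_mul 2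
      have i3 := (hL n).integrable_sq
      have horth : ∫ ω, 2 * (S n * D n) ω ∂μ = 0 := by
        rw [integral_const_mul, show (∫ ω, (S n * D n) ω ∂μ) = 0 from
          integral_mul_eq_zero_of_setIntegral (ℱ.le n) (hSm n) (hSL n) (hL n) (h0 n), mul_zero]
      rw [Finset.sum_range_succ, ← ih]
      calc ∫ ω, S (n + 1) ω ^ 2 ∂μ = ∫ ω, (S n ω ^ 2 + 2 * (S n * D n) ω) + D n ω ^ 2 ∂μ := by
            refine integral_congr_ae (.of_forall fun ω => ?_)
            simp only [hsucc, Pi.mul_apply]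
            ring
        _ = _ := by rw [integral_add (f := fun ω => S n ω ^ 2 + 2 * (S n * D n) ω) (i1.add i2) i3,
              integral_add i1 i2, horth, add_zero]
  have hb0 : ∀ n, 0 ≤ b n := fun n => (integral_nonneg fun ω => sq_nonneg _).trans (hb n)
  have hmart : Martingale S ℱ μ := by
    refine martingale_of_setIntegral_eq_succ hSm hint fun n F hF => ?_
    simp_rw [hsucc]
    rw [integral_add (hint n).integrableOn ((hL n).integrable one_le_two).integrableOn, h0 n F hF,
      add_zero]
  refine hmart.submartingale.exists_ae_tendsto_of_bdd (R := (∑' i, b i + 1).toNNReal) fun n => ?_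
  rw [eLpNorm_one_eq_lintegral_enorm, ← ofReal_integral_norm_eq_lintegral_enorm (hint n)]
  refine ENNReal.ofReal_le_ofReal ?_
  calc ∫ ω, ‖S n ω‖ ∂μ ≤ ∫ ω, (S n ω ^ 2 + 1) ∂μ := by
        refine integral_mono (hint n).norm ((hSL n).integrable_sq.add (integrable_const 1))
          fun ω => ?_
        simp only [Real.norm_eq_abs]
        nlinarith [sq_abs (S n ω), sq_nonneg (|S n ω| - 1), abs_nonneg (S n ω)]
    _ = ∑ i ∈ Finset.range n, ∫ ω, D i ω ^ 2 ∂μ + 1 := by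
        rw [integral_add (hSL n).integrable_sq (integrable_const 1), hvar]; simp
    _ ≤ ∑' i, b i + 1 := by
        gcongr
        exact (Finset.sum_le_sum fun i _ => hb i).trans (hs.sum_le_tsum _ fun i _ => hb0 i)

end MartingaleSeries

/-! ### Sampling from a kernel given the past -/

section Freezing

variable {Ω U W : Type*} {m mΩ : MeasurableSpace Ω} [MeasurableSpace U] [MeasurableSpace W]
  {μ : Measure Ω} [IsProbabilityMeasure μ] {κ : Kernel U W} [IsMarkovKernel κ]
  {T : Ω → U} {Z : Ω → W}

/-- If, given the past `m`, the variable `Z` has the law `κ (T ω)`, then on every event of the past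
the joint law of `T` and `Z` is the composition of the law of `T` with `κ`. -/
lemma map_restrict_eq_compProd (hm : m ≤ mΩ) (hT : Measurable[m] T) (hZ : Measurable Z)
    (law : ∀ F, MeasurableSet[m] F → ∀ B, MeasurableSet B →
      μ (F ∩ {ω | Z ω ∈ B}) = ∫⁻ ω in F, κ (T ω) B ∂μ) {F : Set Ω} (hF : MeasurableSet[m] F) :
    (μ.restrict F).map (fun ω => (T ω, Z ω)) = ((μ.restrict F).map T) ⊗ₘ κ := by
  have hT' : Measurable T := hT.mono hm le_rfl
  refine Measure.ext_prod fun {s t} hs ht => ?_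
  rw [Measure.map_apply (hT'.prodMk hZ) (hs.prod ht), Measure.compProd_apply_prod hs ht,
    Measure.restrict_map hT' hs, lintegral_map (κ.measurable_coe ht) hT',
    Measure.restrict_restrict (hT' hs), Measure.restrict_apply (hT'.prodMk hZ (hs.prod ht)),
    ← law _ ((hT hs).inter hF) t ht]
  congr 1
  ext ω
  simp only [Set.mem_inter_iff, Set.mem_preimage, Set.mem_prod, Set.mem_ofPred_eq]
  tauto

lemma setLIntegral_freezing (hm : m ≤ mΩ) (hT : Measurable[m] T) (hZ : Measurable Z)
    (law : ∀ F, MeasurableSet[m] F → ∀ B, MeasurableSet B →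
      μ (F ∩ {ω | Z ω ∈ B}) = ∫⁻ ω in F, κ (T ω) B ∂μ) {F : Set Ω} (hF : MeasurableSet[m] F)
    {g : U × W → ℝ≥0∞} (hg : Measurable g) :
    ∫⁻ ω in F, g (T ω, Z ω) ∂μ = ∫⁻ ω in F, ∫⁻ w, g (T ω, w) ∂κ (T ω) ∂μ := by
  have hT' : Measurable T := hT.mono hm le_rfl
  rw [← lintegral_map hg (hT'.prodMk hZ), map_restrict_eq_compProd hm hT hZ law hF,
    Measure.lintegral_compProd hg, lintegral_map hg.lintegral_kernel_prod_right' hT']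

lemma setIntegral_freezing (hm : m ≤ mΩ) (hT : Measurable[m] T) (hZ : Measurable Z)
    (law : ∀ F, MeasurableSet[m] F → ∀ B, MeasurableSet B →
      μ (F ∩ {ω | Z ω ∈ B}) = ∫⁻ ω in F, κ (T ω) B ∂μ) {F : Set Ω} (hF : MeasurableSet[m] F)
    {g : U × W → ℝ} (hg : Measurable g) (hint : Integrable (fun ω => g (T ω, Z ω)) μ) :
    ∫ ω in F, g (T ω, Z ω) ∂μ = ∫ ω in F, ∫ w, g (T ω, w) ∂κ (T ω) ∂μ := by
  have hT' : Measurable T := hT.mono hm le_rfl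
  have hi : Integrable g ((μ.restrict F).map fun ω => (T ω, Z ω)) :=
    (integrable_map_measure hg.aestronglyMeasurable (hT'.prodMk hZ).aemeasurable).2
      hint.integrableOn
  rw [← integral_map (φ := fun ω => (T ω, Z ω)) (hT'.prodMk hZ).aemeasurable
    hg.aestronglyMeasurable]
  rw [map_restrict_eq_compProd hm hT hZ law hF] at hi ⊢
  rw [Measure.integral_compProd hi, integral_map hT'.aemeasurable]
  exact (hg.stronglyMeasurable.integral_kernel_prod_right').aestronglyMeasurable

end Freezing

section SampledSeries

variable {Ω U W : Type*} {mΩ : MeasurableSpace Ω} [MeasurableSpace U] [MeasurableSpace W]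
  {μ : Measure Ω} [IsProbabilityMeasure μ] {κ : Kernel U W} [IsMarkovKernel κ]
  {ℱ : Filtration ℕ mΩ} {T : ℕ → Ω → U} {Z : ℕ → Ω → W}

/-- Weighted sums of centred samples with bounded second moments converge almost surely if the
weights are square summable. -/
theorem ae_exists_tendsto_sum_of_centred (hT : ∀ n, Measurable[ℱ n] (T n))
    (hZ : ∀ n, Measurable[ℱ (n + 1)] (Z n))
    (law : ∀ n, ∀ F, MeasurableSet[ℱ n] F → ∀ B, MeasurableSet B →
      μ (F ∩ {ω | Z n ω ∈ B}) = ∫⁻ ω in F, κ (T n ω) B ∂μ)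
    {α : ℕ → ℝ} (hα : Summable fun n => α n ^ 2) {g : U × W → ℝ} (hg : Measurable g)
    (h0 : ∀ u, ∫ w, g (u, w) ∂κ u = 0) {V : ℝ≥0∞} (hV : V ≠ ∞)
    (hgV : ∀ u, ∫⁻ w, ‖g (u, w)‖ₑ ^ 2 ∂κ u ≤ V) :
    ∀ᵐ ω ∂μ, ∃ l, Tendsto (fun n => ∑ i ∈ Finset.range n, α i * g (T i ω, Z i ω)) atTop
      (𝓝 l) := by
  have hTm : ∀ n, Measurable (T n) := fun n => (hT n).mono (ℱ.le n) le_rfl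
  have hZm : ∀ n, Measurable (Z n) := fun n => (hZ n).mono (ℱ.le _) le_rfl
  have hgn : ∀ n, Measurable[ℱ (n + 1)] fun ω => g (T n ω, Z n ω) := fun n =>
    hg.comp (((hT n).mono (ℱ.mono n.le_succ) le_rfl).prodMk (hZ n))
  have hgm : ∀ n, Measurable fun ω => g (T n ω, Z n ω) := fun n => hg.comp ((hTm n).prodMk (hZm n))
  have hsq : ∀ n, ∫⁻ ω, ‖g (T n ω, Z n ω)‖ₑ ^ 2 ∂μ ≤ V := by
    intro n
    have h := setLIntegral_freezing (ℱ.le n) (hT n) (hZm n) (law n) MeasurableSet.univ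
      (g := fun p => ‖g p‖ₑ ^ 2) (hg.enorm.pow_const 2)
    simp only [Measure.restrict_univ] at h
    rw [h]
    exact (lintegral_mono fun ω => hgV _).trans (by simp)
  have hLp : ∀ n, MemLp (fun ω => g (T n ω, Z n ω)) 2 μ := fun n => by
    refine ⟨(hgm n).aestronglyMeasurable, ?_⟩
    rw [eLpNorm_lt_top_iff_lintegral_rpow_enorm_lt_top two_ne_zero ENNReal.ofNat_ne_top]
    have := (hsq n).trans_lt hV.lt_top
    simpa using this
  refine ae_exists_tendsto_sum_of_martingale_difference (ℱ := ℱ)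
    (D := fun n ω => α n * g (T n ω, Z n ω)) (b := fun n => α n ^ 2 * V.toReal)
    (fun n => ((hgn n).const_mul _).stronglyMeasurable) (fun n => (hLp n).const_mul _) ?_
    (hα.mul_right _) ?_
  · intro n
    simp_rw [mul_pow]
    rw [integral_const_mul]
    refine mul_le_mul_of_nonneg_left ?_ (sq_nonneg _)
    rw [integral_eq_lintegral_of_nonneg_ae (.of_forall fun ω => sq_nonneg _)
      ((hgm n).pow_const 2).aestronglyMeasurable]
    refine ENNReal.toReal_mono hV (le_trans (lintegral_mono fun ω => ?_) (hsq n))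
    rw [← ofReal_norm, Real.norm_eq_abs, ← ENNReal.ofReal_pow (abs_nonneg _), sq_abs]
  · intro n F hF
    rw [integral_const_mul, setIntegral_freezing (ℱ.le n) (hT n) (hZm n) (law n) hF hg
      ((hLp n).integrable one_le_two)]
    simp [h0]

/-- Weighted sums of samples centred at their means converge almost surely, on the event that the
parameters stay in a set where the second moments are bounded, if the weights are square summable. -/
theorem ae_exists_tendsto_sum_sub_integral (hT : ∀ n, Measurable[ℱ n] (T n))
    (hZ : ∀ n, Measurable[ℱ (n + 1)] (Z n))
    (law : ∀ n, ∀ F, MeasurableSet[ℱ n] F → ∀ B, MeasurableSet B →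
      μ (F ∩ {ω | Z n ω ∈ B}) = ∫⁻ ω in F, κ (T n ω) B ∂μ)
    {α : ℕ → ℝ} (hα : Summable fun n => α n ^ 2) {g : U × W → ℝ} (hg : Measurable g)
    {C : Set U} (hC : MeasurableSet C) {V : ℝ≥0∞} (hV : V ≠ ∞)
    (hgV : ∀ u ∈ C, ∫⁻ w, ‖g (u, w)‖ₑ ^ 2 ∂κ u ≤ V) :
    ∀ᵐ ω ∂μ, (∀ i, T i ω ∈ C) → ∃ l, Tendsto (fun n => ∑ i ∈ Finset.range n,
      α i * (g (T i ω, Z i ω) - ∫ w, g (T i ω, w) ∂κ (T i ω))) atTop (𝓝 l) := by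
  have hbar : Measurable fun u => ∫ w, g (u, w) ∂κ u :=
    hg.stronglyMeasurable.integral_kernel_prod_right'.measurable
  set g' : U × W → ℝ := fun p => (C ×ˢ Set.univ).indicator
    (fun p => g p - ∫ w, g (p.1, w) ∂κ p.1) p with hg'
  have hgm' : Measurable g' :=
    (hg.sub (hbar.comp measurable_fst)).indicator (hC.prod MeasurableSet.univ)
  have hin : ∀ u ∈ C, ∀ w, g' (u, w) = g (u, w) - ∫ w, g (u, w) ∂κ u := fun u hu w =>
    Set.indicator_of_mem (Set.mk_mem_prod hu (Set.mem_univ w)) _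
  have hout : ∀ u ∉ C, ∀ w, g' (u, w) = 0 := fun u hu w =>
    Set.indicator_of_notMem (fun h => hu h.1) _
  have hint : ∀ u ∈ C, Integrable (fun w => g (u, w)) (κ u) := fun u hu =>
    ⟨(hg.comp measurable_prodMk_left).aestronglyMeasurable,
      lintegral_lt_top_of_sq hV (hgV u hu)⟩
  have key := ae_exists_tendsto_sum_of_centred hT hZ law hα hgm' (V := 4 * V + 4 * (V + 1) ^ 2)
    (fun u => ?_) (by finiteness) (fun u => ?_)
  · filter_upwards [key] with ω hω hT
    simpa only [hin _ (hT _)] using hω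
  · by_cases hu : u ∈ C
    · simp_rw [hin u hu]
      rw [integral_sub (hint u hu) (integrable_const _)]
      simp
    · simp [hout u hu]
  · by_cases hu : u ∈ C
    · have hb : ‖∫ w, g (u, w) ∂κ u‖ₑ ≤ V + 1 := by
        refine (enorm_integral_le_lintegral_enorm _).trans ?_
        calc _ ≤ ∫⁻ w, (‖g (u, w)‖ₑ ^ 2 + 1) ∂κ u := by
              refine lintegral_mono fun w => ?_
              simpa using ENNReal.le_mul_sq_add_inv one_ne_zero ENNReal.one_ne_top ‖g (u, w)‖ₑ
          _ ≤ V + 1 := by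
              rw [lintegral_add_right _ measurable_const]
              simpa using hgV u hu
      calc ∫⁻ w, ‖g' (u, w)‖ₑ ^ 2 ∂κ u ≤ ∫⁻ w, (4 * ‖g (u, w)‖ₑ ^ 2 + 4 * (V + 1) ^ 2) ∂κ u := by
            refine lintegral_mono fun w => ?_
            rw [hin u hu]
            calc _ ≤ (‖g (u, w)‖ₑ + (V + 1)) ^ 2 := by
                  gcongr
                  exact enorm_sub_le.trans (by gcongr)
              _ ≤ _ := ennreal_add_sq_le _ _
        _ ≤ 4 * V + 4 * (V + 1) ^ 2 := by
            rw [lintegral_add_right _ measurable_const, lintegral_const_mul' _ _ (by simp)]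
            simp only [lintegral_const, measure_univ, mul_one]
            gcongr
            exact hgV u hu
    · simp [hout u hu]

/-- Weighted squares of samples with bounded second moments are almost surely summable if the
weights are square summable. -/
theorem ae_summable_sq (hT : ∀ n, Measurable[ℱ n] (T n)) (hZ : ∀ n, Measurable[ℱ (n + 1)] (Z n))
    (law : ∀ n, ∀ F, MeasurableSet[ℱ n] F → ∀ B, MeasurableSet B →
      μ (F ∩ {ω | Z n ω ∈ B}) = ∫⁻ ω in F, κ (T n ω) B ∂μ)
    {α : ℕ → ℝ} (hα : Summable fun n => α n ^ 2) {g : U × W → ℝ} (hg : Measurable g)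
    {C : Set U} (hC : MeasurableSet C) {V : ℝ≥0∞} (hV : V ≠ ∞)
    (hgV : ∀ u ∈ C, ∫⁻ w, ‖g (u, w)‖ₑ ^ 2 ∂κ u ≤ V) :
    ∀ᵐ ω ∂μ, (∀ i, T i ω ∈ C) → Summable fun i => α i ^ 2 * g (T i ω, Z i ω) ^ 2 := by
  have hTm : ∀ n, Measurable (T n) := fun n => (hT n).mono (ℱ.le n) le_rfl
  have hZm : ∀ n, Measurable (Z n) := fun n => (hZ n).mono (ℱ.le _) le_rfl
  set G : U × W → ℝ≥0∞ := fun p => (C ×ˢ Set.univ).indicator (fun p => ‖g p‖ₑ ^ 2) p with hG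
  have hGm : Measurable G := (hg.enorm.pow_const 2).indicator (hC.prod MeasurableSet.univ)
  have hGV : ∀ n, ∫⁻ ω, G (T n ω, Z n ω) ∂μ ≤ V := by
    intro n
    have h := setLIntegral_freezing (ℱ.le n) (hT n) (hZm n) (law n) MeasurableSet.univ hGm
    simp only [Measure.restrict_univ] at h
    rw [h]
    refine (lintegral_mono fun ω => (?_ : _ ≤ V)).trans (by simp)
    by_cases hu : T n ω ∈ C
    · refine le_trans (lintegral_mono fun w => ?_) (hgV _ hu)
      exact Set.indicator_le_self _ _ _
    · have : ∀ w, G (T n ω, w) = 0 := fun w => Set.indicator_of_notMem (fun h => hu h.1) _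
      simp [this]
  have hsum : ∫⁻ ω, ∑' n, ENNReal.ofReal (α n ^ 2) * G (T n ω, Z n ω) ∂μ < ∞ := by
    have hm : ∀ n, Measurable fun ω => G (T n ω, Z n ω) := fun n =>
      hGm.comp ((hTm n).prodMk (hZm n))
    rw [lintegral_tsum fun n => ((hm n).const_mul _).aemeasurable]
    simp_rw [fun n => lintegral_const_mul (μ := μ) (ENNReal.ofReal (α n ^ 2)) (hm n)]
    refine (ENNReal.tsum_le_tsum fun n => mul_le_mul_right (hGV n) _).trans_lt ?_
    rw [ENNReal.tsum_mul_right]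
    refine ENNReal.mul_lt_top ?_ hV.lt_top
    rw [← ENNReal.ofReal_tsum_of_nonneg (fun n => sq_nonneg _) hα]
    exact ENNReal.ofReal_lt_top
  filter_upwards [ae_lt_top' (AEMeasurable.tsum fun n => ((hGm.comp
    ((hTm n).prodMk (hZm n))).const_mul _).aemeasurable) hsum.ne] with ω hω hTC
  refine Summable.of_enorm (ne_of_lt (lt_of_le_of_lt (ENNReal.tsum_le_tsum fun n => ?_) hω))
  have : G (T n ω, Z n ω) = ‖g (T n ω, Z n ω)‖ₑ ^ 2 :=
    Set.indicator_of_mem (Set.mk_mem_prod (hTC n) (Set.mem_univ (Z n ω))) _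
  rw [enorm_mul, enorm_pow (g _), Function.comp_apply, this, Real.enorm_of_nonneg (sq_nonneg _)]

end SampledSeries

/-! ### The Euclidean projection -/

section Projection

variable {d : ℕ} {Θ : Set (EuclideanSpace ℝ (Fin d))}

lemma proj_spec (hc : IsClosed Θ) (hne : Θ.Nonempty) (u : EuclideanSpace ℝ (Fin d)) :
    proj Θ u ∈ Θ ∧ ∀ w ∈ Θ, ‖u - proj Θ u‖ ≤ ‖u - w‖ := by
  have h : ∃ v ∈ Θ, ∀ w ∈ Θ, ‖u - v‖ ≤ ‖u - w‖ := by
    obtain ⟨v, hv, h⟩ := hc.exists_infDist_eq_dist hne u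
    refine ⟨v, hv, fun w hw => ?_⟩
    rw [← dist_eq_norm, ← dist_eq_norm, ← h]
    exact Metric.infDist_le_dist_of_mem hw
  rw [proj, dif_pos h]
  exact h.choose_spec

lemma proj_mem (hc : IsClosed Θ) (hne : Θ.Nonempty) (u : EuclideanSpace ℝ (Fin d)) :
    proj Θ u ∈ Θ := (proj_spec hc hne u).1

/-- The variational inequality that characterizes the projection onto a convex set. -/
lemma inner_sub_proj_le (hc : IsClosed Θ) (hconv : Convex ℝ Θ) (hne : Θ.Nonempty)
    (u : EuclideanSpace ℝ (Fin d)) {w : EuclideanSpace ℝ (Fin d)} (hw : w ∈ Θ) :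
    inner ℝ (u - proj Θ u) (w - proj Θ u) ≤ 0 := by
  obtain ⟨h1, h2⟩ := proj_spec hc hne u
  have : Nonempty Θ := hne.to_subtype
  refine (norm_eq_iInf_iff_real_inner_le_zero hconv h1).1 (le_antisymm ?_ ?_) w hw
  · exact le_ciInf fun w => h2 w w.2
  · exact ciInf_le ⟨0, by rintro _ ⟨w, rfl⟩; exact norm_nonneg _⟩ (⟨_, h1⟩ : Θ)

/-- Two points satisfying the variational inequalities of `u` and `u'` are at most as far apart
as `u` and `u'`. -/
lemma norm_sub_le_of_variational {E : Type*} [NormedAddCommGroup E] [InnerProductSpace ℝ E]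
    {u u' v v' : E} (h : inner ℝ (u - v) (v' - v) ≤ 0) (h' : inner ℝ (u' - v') (v - v') ≤ 0) :
    ‖v - v'‖ ≤ ‖u - u'‖ := by
  have h1 : ‖v - v'‖ * ‖v - v'‖ ≤ inner ℝ (u - u') (v - v') := by
    rw [← real_inner_self_eq_norm_mul_norm]
    have e1 : inner ℝ (u - v) (v' - v) = -inner ℝ (u - v) (v - v') := by
      rw [← inner_neg_right, neg_sub]
    have e2 : inner ℝ (u - u') (v - v') = inner ℝ (u - v) (v - v') + inner ℝ (v - v') (v - v') -
        inner ℝ (u' - v') (v - v') := by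
      rw [← inner_add_left, ← inner_sub_left]; congr 1; abel
    linarith
  by_contra hlt
  push Not at hlt
  have h2 := real_inner_le_norm (u - u') (v - v')
  nlinarith [norm_nonneg (u - u')]

lemma norm_proj_sub_proj_le (hc : IsClosed Θ) (hconv : Convex ℝ Θ) (hne : Θ.Nonempty)
    (u u' : EuclideanSpace ℝ (Fin d)) : ‖proj Θ u - proj Θ u'‖ ≤ ‖u - u'‖ :=
  norm_sub_le_of_variational (inner_sub_proj_le hc hconv hne u (proj_mem hc hne u'))
    (inner_sub_proj_le hc hconv hne u' (proj_mem hc hne u))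

lemma proj_eq_of_variational (hc : IsClosed Θ) (hconv : Convex ℝ Θ)
    {u v : EuclideanSpace ℝ (Fin d)} (hv : v ∈ Θ)
    (h : ∀ w ∈ Θ, inner ℝ (u - v) (w - v) ≤ 0) : proj Θ u = v := by
  have hne : Θ.Nonempty := ⟨v, hv⟩
  have := norm_sub_le_of_variational (inner_sub_proj_le hc hconv hne u hv)
    (h _ (proj_mem hc hne u))
  rw [sub_self, norm_zero] at this
  exact sub_eq_zero.1 (norm_le_zero_iff.1 this)

lemma proj_of_mem (hc : IsClosed Θ) (hconv : Convex ℝ Θ) {u : EuclideanSpace ℝ (Fin d)}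
    (hu : u ∈ Θ) : proj Θ u = u :=
  proj_eq_of_variational hc hconv hu fun w _ => by simp

end Projection

/-! ### The noise of the algorithm -/

section Noise

variable {S A : Type*} [MeasurableSpace S] [MeasurableSingletonClass S] [MeasurableSpace A] {d : ℕ}
  {M : MDP S A} {Q : ParamPolicy d S A} {Θ : Set (EuclideanSpace ℝ (Fin d))} {α : ℕ → ℝ} {N : ℕ}
  {θ₀ : EuclideanSpace ℝ (Fin d)} {Ω : Type*} {mΩ : MeasurableSpace Ω} {μ : Measure Ω}
  {ℱ : Filtration ℕ mΩ} {x y : ℕ → Ω → ℕ → S × A} {θ : ℕ → Ω → EuclideanSpace ℝ (Fin d)}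

omit [MeasurableSingletonClass S] in
lemma IsRun.mem (hrun : IsRun M Q Θ α N θ₀ μ ℱ x y θ) (hc : IsClosed Θ) (hθ₀ : θ₀ ∈ Θ) (m : ℕ)
    (ω : Ω) : θ m ω ∈ Θ := by
  cases m with
  | zero => rw [hrun.init]; exact hθ₀
  | succ m => rw [hrun.update]; exact proj_mem hc ⟨θ₀, hθ₀⟩ _

/-- The trajectories generated by the algorithm return infinitely often. -/
lemma IsRun.ae_mem_returnsForever (hrun : IsRun M Q Θ α N θ₀ μ ℱ x y θ) (hc : IsClosed Θ)
    (hθ₀ : θ₀ ∈ Θ) (hrec : ∀ ϑ ∈ Θ, PositiveRecurrent M Q ϑ) :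
    ∀ᵐ ω ∂μ, ∀ m, x m ω ∈ returnsForever M.s₀ ∧ y m ω ∈ returnsForever M.s₀ := by
  refine ae_all_iff.2 fun m => ?_
  have hR : MeasurableSet (returnsForever M.s₀ : Set (ℕ → S × A)) := measurableSet_returnsForever _
  have h := hrun.law m Set.univ MeasurableSet.univ _ (hR.prod hR).compl
  rw [Set.univ_inter] at h
  have h0 : ∀ ω, ((trajLaw M Q (θ m ω)).prod (trajLaw M Q (θ m ω)))
      (returnsForever M.s₀ ×ˢ returnsForever M.s₀)ᶜ = 0 := fun ω => by
    have h1 := RMC.ae_mem_returnsForever (hrec _ (hrun.mem hc hθ₀ m ω))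
    have h2 : ∀ᵐ w ∂(trajLaw M Q (θ m ω)).prod (trajLaw M Q (θ m ω)),
        w ∈ returnsForever M.s₀ ×ˢ returnsForever M.s₀ := by
      filter_upwards [Measure.quasiMeasurePreserving_fst.ae h1,
        Measure.quasiMeasurePreserving_snd.ae h1] with w h3 h4
      exact ⟨h3, h4⟩
    exact h2
  simp only [h0, lintegral_zero] at h
  have h3 : ∀ᵐ ω ∂μ, ω ∉ {ω | (x m ω, y m ω) ∈
      (returnsForever M.s₀ ×ˢ returnsForever M.s₀ : Set ((ℕ → S × A) × (ℕ → S × A)))ᶜ} :=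
    measure_eq_zero_iff_ae_notMem.1 h
  filter_upwards [h3] with ω hω
  by_contra hcon
  exact hω fun h4 => hcon h4

variable [IsProbabilityMeasure μ]

/-- On the event that the parameters stay in a ball, the noise of the estimates tested against a
bounded function of the parameter, the fluctuations of the norms of the estimates, and the squared
norms of the estimates all give almost surely convergent weighted series. -/
theorem IsRun.ae_noise (hrun : IsRun M Q Θ α N θ₀ μ ℱ x y θ) (hc : IsClosed Θ) (hθ₀ : θ₀ ∈ Θ)
    (hΘU : Θ ⊆ Q.U) (hrec : ∀ ϑ ∈ Θ, PositiveRecurrent M Q ϑ)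
    (hmom : LocallyBoundedSecondMoments M Q Θ) (hα : Summable fun m => α m ^ 2) (hN : 0 < N)
    (B : ℝ) {φ : EuclideanSpace ℝ (Fin d) → EuclideanSpace ℝ (Fin d)} (hφ : Measurable φ) {R : ℝ}
    (hR : ∀ ϑ ∈ Θ, ‖ϑ‖ ≤ B → ‖φ ϑ‖ ≤ R) :
    ∃ D : ℝ, ∀ᵐ ω ∂μ, (∀ m, ‖θ m ω‖ ≤ B) →
      (∃ l, Tendsto (fun n => ∑ i ∈ Finset.range n, α i * inner ℝ
        (estH M Q N (θ i ω) (x i ω) (y i ω) - H M Q (θ i ω)) (φ (θ i ω))) atTop (𝓝 l)) ∧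
      (∃ e : ℕ → ℝ, (∀ i, 0 ≤ e i ∧ e i ≤ D) ∧ ∃ l, Tendsto (fun n => ∑ i ∈ Finset.range n,
        α i * (‖estH M Q N (θ i ω) (x i ω) (y i ω)‖ - e i)) atTop (𝓝 l)) ∧
      Summable fun i => α i ^ 2 * ‖estH M Q N (θ i ω) (x i ω) (y i ω)‖ ^ 2 := by
  have hmem := fun m ω => hrun.mem hc hθ₀ m ω
  have hcomp : IsCompact (Θ ∩ Metric.closedBall 0 B) := (isCompact_closedBall 0 B).inter_left hc
  obtain ⟨K, hK, hmK⟩ := hmom.exists_momentBound_of_isCompact hcomp Set.inter_subset_left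
  set V : ℝ≥0∞ := 4 * ((N * (N * K)) * (N * (N * K))) with hV
  have hVtop : V ≠ ∞ := by rw [hV]; finiteness
  set κ : Kernel Q.U ((ℕ → S × A) × (ℕ → S × A)) := trajKernel M Q ×ₖ trajKernel M Q with hκ
  have hκa : ∀ u : Q.U, κ u = (trajLaw M Q u).prod (trajLaw M Q u) := fun u => by
    rw [hκ, Kernel.prod_apply, trajKernel_apply]
  set T : ℕ → Ω → Q.U := fun m ω => ⟨θ m ω, hΘU (hmem m ω)⟩ with hTdef
  have hT : ∀ m, Measurable[ℱ m] (T m) := fun m => (hrun.adapted m).subtype_mk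
  set Z : ℕ → Ω → (ℕ → S × A) × (ℕ → S × A) := fun m ω => (x m ω, y m ω) with hZdef
  have hZ : ∀ m, Measurable[ℱ (m + 1)] (Z m) := hrun.measurable_traj
  have law : ∀ n, ∀ F, MeasurableSet[ℱ n] F → ∀ B, MeasurableSet B →
      μ (F ∩ {ω | Z n ω ∈ B}) = ∫⁻ ω in F, κ (T n ω) B ∂μ := fun n F hF B hB => by
    simp only [hκa]
    exact hrun.law n F hF B hB
  set C : Set Q.U := {u | (u : EuclideanSpace ℝ (Fin d)) ∈ Θ ∩ Metric.closedBall 0 B} with hCdef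
  have hC : MeasurableSet C := measurable_subtype_coe hcomp.isClosed.measurableSet
  have hest : Measurable fun p : Q.U × (ℕ → S × A) × (ℕ → S × A) => regenEst M Q N p.1 p.2 :=
    measurable_regenEst_prod
  have hsq : ∀ u ∈ C, ∫⁻ w, ‖regenEst M Q N u w‖ₑ ^ 2 ∂κ u ≤ V := fun u hu => by
    rw [hκa]
    exact lintegral_regenEst_sq_le u.2 (hrec _ hu.1) (hmK _ hu)
  have hmean : ∀ u ∈ C, ∫ w, regenEst M Q N u w ∂κ u = H M Q u := fun u hu => by
    rw [hκa]
    exact integral_regenEst u.2 (hrec _ hu.1) hK (hmK _ hu) hN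
      (hasGradientAt_meanR hmom hu.1 u.2 (hrec _ hu.1))
      (hasGradientAt_meanT hmom hu.1 u.2 (hrec _ hu.1))
  have hint : ∀ u ∈ C, Integrable (fun w => regenEst M Q N u w) (κ u) := fun u hu =>
    ⟨(measurable_regenEst u.2).aestronglyMeasurable, lintegral_lt_top_of_sq hVtop (hsq u hu)⟩
  have hg1 : Measurable fun p : Q.U × (ℕ → S × A) × (ℕ → S × A) =>
      inner ℝ (regenEst M Q N p.1 p.2) (φ p.1) :=
    hest.inner (hφ.comp (measurable_subtype_coe.comp measurable_fst))
  have k1 := ae_exists_tendsto_sum_sub_integral hT hZ law hα hg1 hC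
    (V := V * ENNReal.ofReal R ^ 2) (by finiteness) fun u hu => by
      calc _ ≤ ∫⁻ w, ‖regenEst M Q N u w‖ₑ ^ 2 * ENNReal.ofReal R ^ 2 ∂κ u := by
            refine lintegral_mono fun w => ?_
            rw [← mul_pow]
            gcongr
            rw [← ofReal_norm, ← ofReal_norm, ← ENNReal.ofReal_mul (norm_nonneg _)]
            refine ENNReal.ofReal_le_ofReal ((norm_inner_le_norm _ _).trans ?_)
            gcongr
            exact hR _ hu.1 (by simpa using hu.2)
        _ ≤ _ := by
            rw [lintegral_mul_const' _ _ (by finiteness)]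
            gcongr
            exact hsq u hu
  have k2 := ae_exists_tendsto_sum_sub_integral hT hZ law hα hest.norm hC hVtop fun u hu => by
    simpa only [enorm_norm] using hsq u hu
  have k3 := ae_summable_sq hT hZ law hα hest.norm hC hVtop fun u hu => by
    simpa only [enorm_norm] using hsq u hu
  refine ⟨(V + 1).toReal, ?_⟩
  filter_upwards [k1, k2, k3, hrun.ae_mem_returnsForever hc hθ₀ hrec] with ω h1 h2 h3 h4 hB
  have hTC : ∀ i, T i ω ∈ C := fun i => ⟨hmem i ω, by simpa using hB i⟩
  have hH : ∀ i, estH M Q N (θ i ω) (x i ω) (y i ω) = regenEst M Q N (T i ω) (Z i ω) := fun i =>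
    estH_eq_regenEst (h4 i).1 (h4 i).2 N
  refine ⟨?_, ⟨fun i => ∫ w, ‖regenEst M Q N (T i ω) w‖ ∂κ (T i ω), fun i =>
    ⟨integral_nonneg fun w => norm_nonneg _, ?_⟩, ?_⟩, ?_⟩
  · obtain ⟨l, hl⟩ := h1 hTC
    refine ⟨l, hl.congr fun n => Finset.sum_congr rfl fun i _ => ?_⟩
    rw [hH, inner_sub_left]
    congr 2
    have := integral_inner (𝕜 := ℝ) (hint _ (hTC i)) (φ (θ i ω))
    rw [hmean _ (hTC i)] at this
    rw [real_inner_comm (φ (θ i ω)) (H M Q (θ i ω))]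
    refine Eq.trans ?_ this
    exact integral_congr_ae (.of_forall fun w => real_inner_comm _ _)
  · refine (integral_norm_eq_lintegral_enorm (hint _ (hTC i)).1).trans_le ?_
    refine ENNReal.toReal_mono (by finiteness) ?_
    calc _ ≤ ∫⁻ w, (‖regenEst M Q N (T i ω) w‖ₑ ^ 2 + 1) ∂κ (T i ω) := by
          refine lintegral_mono fun w => ?_
          simpa using ENNReal.le_mul_sq_add_inv one_ne_zero ENNReal.one_ne_top
            ‖regenEst M Q N (T i ω) w‖ₑ
      _ ≤ V + 1 := by
          rw [lintegral_add_right _ measurable_const]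
          simpa using hsq _ (hTC i)
  · simpa only [hH] using h2 hTC
  · simpa only [hH] using h3 hTC

end Noise

/-! ### Real sequences -/

section Sequences

/-- A nonnegative series is summable if its terms are dominated by the decrease of a function that
is bounded below, up to a convergent series. -/
lemma summable_of_descent {Φ β n : ℕ → ℝ} {b : ℝ} (hβ : ∀ m, 0 ≤ β m)
    (h : ∀ m, Φ (m + 1) + β m ≤ Φ m + n m) (hΦ : ∀ m, b ≤ Φ m)
    (hn : ∃ l, Tendsto (fun k => ∑ i ∈ Finset.range k, n i) atTop (𝓝 l)) : Summable β := by
  obtain ⟨l, hl⟩ := hn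
  obtain ⟨R, hR⟩ := hl.bddAbove_range
  refine summable_of_sum_range_le (c := Φ 0 - b + R) hβ fun k => ?_
  have key : Φ k + ∑ i ∈ Finset.range k, β i ≤ Φ 0 + ∑ i ∈ Finset.range k, n i := by
    induction k with
    | zero => simp
    | succ k ih =>
      rw [Finset.sum_range_succ, Finset.sum_range_succ]
      linarith [h k]
  linarith [hΦ k, hR ⟨k, rfl⟩]

/-- If `∑ α h²` converges, `∑ α` diverges, and `h` increases by at most `δ + D α` per step with
convergent `∑ δ`, then `h` tends to zero: after a time at which `h < ε`, the sum of the `α` over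
an excursion above `ε` is small. -/
lemma tendsto_zero_of_summable_mul_sq {α h δ : ℕ → ℝ} {D : ℝ} (hα : ∀ m, 0 < α m) (hD : 0 ≤ D)
    (hα_sum : Tendsto (fun n => ∑ m ∈ Finset.range n, α m) atTop atTop)
    (hα0 : Tendsto α atTop (𝓝 0)) (hh : ∀ m, 0 ≤ h m) (hsum : Summable fun m => α m * h m ^ 2)
    (hδ : ∃ l, Tendsto (fun k => ∑ i ∈ Finset.range k, δ i) atTop (𝓝 l))
    (hstep : ∀ m, h (m + 1) ≤ h m + δ m + D * α m) : Tendsto h atTop (𝓝 0) := by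
  obtain ⟨l, hl⟩ := hδ
  rw [Metric.tendsto_atTop]
  intro η hη
  set ε := η / 2 with hε
  have hε0 : 0 < ε := half_pos hη
  obtain ⟨n₁, hn₁⟩ := Metric.cauchySeq_iff.1 hl.cauchySeq (ε / 4) (by positivity)
  obtain ⟨n₂, hn₂⟩ := eventually_atTop.1
    (hα0.eventually (gt_mem_nhds (show 0 < ε / (4 * (D + 1)) by positivity)))
  obtain ⟨n₃, hn₃⟩ := Metric.cauchySeq_iff.1 hsum.hasSum.tendsto_sum_nat.cauchySeq
    (ε ^ 3 / (4 * (D + 1))) (by positivity)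
  set n₀ := max n₁ (max n₂ n₃) with hn₀
  -- otherwise `∑ α` would converge together with `∑ α h²`
  have hex : ∃ p, n₀ ≤ p ∧ h p < ε := by
    by_contra hcon
    push Not at hcon
    have hs : Summable fun m => α (m + n₀) := by
      refine Summable.of_nonneg_of_le (fun m => (hα _).le) (fun m => ?_)
        (((summable_nat_add_iff n₀).2 hsum).mul_left (ε ^ 2)⁻¹)
      have h1 : ε ^ 2 ≤ h (m + n₀) ^ 2 := by
        have := hcon (m + n₀) (Nat.le_add_left _ _)
        gcongr
      rw [inv_mul_eq_div, le_div_iff₀ (by positivity)]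
      exact mul_le_mul_of_nonneg_left h1 (hα _).le
    have hs2 : Summable α := (summable_nat_add_iff n₀).1 hs
    exact not_tendsto_nhds_of_tendsto_atTop hα_sum _ hs2.hasSum.tendsto_sum_nat
  obtain ⟨p, hp, hpε⟩ := hex
  refine ⟨p, fun q hq => ?_⟩
  -- `p'` is the last time up to `q` at which `h < ε`
  have hind : ∃ p', p ≤ p' ∧ p' ≤ q ∧ h p' < ε ∧ (∀ i, p' < i → i ≤ q → ε ≤ h i) ∧
      h q ≤ h p' + ∑ i ∈ Finset.Ico p' q, (δ i + D * α i) := by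
    induction q, hq using Nat.le_induction with
    | base => exact ⟨p, le_rfl, le_rfl, hpε, fun i h1 h2 => by omega, by simp⟩
    | succ q hq ih =>
      rcases lt_or_ge (h (q + 1)) ε with hlt | hge
      · exact ⟨q + 1, by omega, le_rfl, hlt, fun i h1 h2 => by omega, by simp⟩
      · obtain ⟨p', h1, h2, h3, h4, h5⟩ := ih
        refine ⟨p', h1, by omega, h3, fun i hi hi' => ?_, ?_⟩
        · rcases hi'.lt_or_eq with h6 | rfl
          · exact h4 i hi (by omega)
          · exact hge
        · rw [Finset.sum_Ico_succ_top h2]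
          linarith [hstep q]
  obtain ⟨p', h1, h2, h3, h4, h5⟩ := hind
  rw [Real.dist_eq, sub_zero, abs_of_nonneg (hh q)]
  rcases h2.lt_or_eq with h2' | rfl
  · have e1 : ∑ i ∈ Finset.Ico p' q, δ i ≤ ε / 4 := by
      rw [Finset.sum_Ico_eq_sub _ h2]
      have := hn₁ q (by omega) p' (by omega)
      rw [Real.dist_eq] at this
      exact (le_abs_self _).trans this.le
    have e2 : D * α p' ≤ ε / 4 := by
      have := hn₂ p' (by omega)
      rw [lt_div_iff₀ (by positivity)] at this
      nlinarith [hα p']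
    have e3 : D * ∑ i ∈ Finset.Ico (p' + 1) q, α i ≤ ε / 4 := by
      have h6 : ε ^ 2 * ∑ i ∈ Finset.Ico (p' + 1) q, α i ≤ ε ^ 3 / (4 * (D + 1)) := by
        calc _ ≤ ∑ i ∈ Finset.Ico (p' + 1) q, α i * h i ^ 2 := by
              rw [Finset.mul_sum]
              refine Finset.sum_le_sum fun i hi => ?_
              rw [Finset.mem_Ico] at hi
              have := h4 i (by omega) (by omega)
              rw [mul_comm]
              exact mul_le_mul_of_nonneg_left (by gcongr) (hα i).le
          _ ≤ _ := by
              rw [Finset.sum_Ico_eq_sub _ (by omega)]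
              have := hn₃ q (by omega) (p' + 1) (by omega)
              rw [Real.dist_eq] at this
              exact (le_abs_self _).trans this.le
      have h7 : 0 ≤ ∑ i ∈ Finset.Ico (p' + 1) q, α i := Finset.sum_nonneg fun i _ => (hα i).le
      have h8 : (∑ i ∈ Finset.Ico (p' + 1) q, α i) * (4 * (D + 1)) ≤ ε := by
        rw [le_div_iff₀ (by positivity)] at h6
        refine le_of_mul_le_mul_left ?_ (show 0 < ε ^ 2 by positivity)
        linarith
      linarith
    rw [Finset.sum_add_distrib, ← Finset.mul_sum, Finset.sum_eq_sum_Ico_succ_bot h2' α] at h5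
    linarith
  · linarith

end Sequences

/-! ### Sequences with vanishing increments -/

section Increments

variable {X : Type*} [MetricSpace X] {u : ℕ → X} {K : Set X}

lemma eventually_mem_of_forall_mapClusterPt (hK : IsCompact K) (hu : ∀ n, u n ∈ K) {O : Set X}
    (hO : IsOpen O) (h : ∀ z, MapClusterPt z atTop u → z ∈ O) : ∀ᶠ n in atTop, u n ∈ O := by
  by_contra hcon
  rw [not_eventually] at hcon
  obtain ⟨z, hz, hzc⟩ := (hK.diff hO).exists_mapClusterPt_of_frequently
    (hcon.mono fun n hn => ⟨hu n, hn⟩)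
  exact hz.2 (h z hzc)

/-- The cluster points of a sequence in a compact set with vanishing increments form a connected
set. -/
lemma isPreconnected_setOf_mapClusterPt (hK : IsCompact K) (hu : ∀ n, u n ∈ K)
    (hinc : Tendsto (fun n => dist (u (n + 1)) (u n)) atTop (𝓝 0)) :
    IsPreconnected {z | MapClusterPt z atTop u} := by
  intro U V hU hV hUV hLU hLV
  by_contra hcon
  rw [Set.not_nonempty_iff_eq_empty] at hcon
  have hLc : IsClosed {z | MapClusterPt z atTop u} := isClosed_setOfPred_clusterPt
  have hLK : {z | MapClusterPt z atTop u} ⊆ K := fun z hz =>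
    hK.isClosed.mem_of_mapClusterPt hz (Eventually.of_forall hu)
  have hL : IsCompact {z | MapClusterPt z atTop u} := hK.of_isClosed_subset hLc hLK
  have hdisj : Disjoint ({z | MapClusterPt z atTop u} \ V) ({z | MapClusterPt z atTop u} \ U) := by
    rw [Set.disjoint_left]
    rintro z ⟨hz, hzV⟩ ⟨-, hzU⟩
    exact (hUV hz).elim hzU hzV
  obtain ⟨r, hr, hthick⟩ := hdisj.exists_thickenings (hL.diff hV) (hL.diff hU).isClosed
  set P := Metric.thickening (r / 2) ({z | MapClusterPt z atTop u} \ V)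
  set P' := Metric.thickening (r / 2) ({z | MapClusterPt z atTop u} \ U)
  have hmem : ∀ z, MapClusterPt z atTop u → z ∈ P ∪ P' := fun z hz => by
    have h1 : z ∉ U ∩ V := fun h => by
      have : z ∈ {z | MapClusterPt z atTop u} ∩ (U ∩ V) := ⟨hz, h⟩
      rw [hcon] at this
      exact this
    by_cases hzV : z ∈ V
    · exact Or.inr (Metric.self_subset_thickening (half_pos hr) _ ⟨hz, fun h => h1 ⟨h, hzV⟩⟩)
    · exact Or.inl (Metric.self_subset_thickening (half_pos hr) _ ⟨hz, hzV⟩)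
  obtain ⟨n₀, hn₀⟩ := eventually_atTop.1 ((eventually_mem_of_forall_mapClusterPt hK hu
    (Metric.isOpen_thickening.union Metric.isOpen_thickening) hmem).and
    (hinc.eventually (gt_mem_nhds (half_pos hr))))
  -- once near one of the two parts, the sequence stays near it
  have hstay : ∀ n ≥ n₀, u n ∈ P → u (n + 1) ∈ P := by
    intro n hn hP
    refine ((hn₀ (n + 1) (by omega)).1).resolve_right fun hP' => ?_
    obtain ⟨z, hz, hzd⟩ := Metric.mem_thickening_iff.1 hP
    refine Set.disjoint_left.1 hthick (Metric.mem_thickening_iff.2 ⟨z, hz, ?_⟩)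
      (Metric.thickening_mono (half_le_self hr.le) _ hP')
    have := dist_triangle (u (n + 1)) (u n) z
    linarith [(hn₀ n hn).2]
  obtain ⟨a, haL, haU⟩ := hLU
  obtain ⟨b, hbL, hbV⟩ := hLV
  have haV : a ∉ V := fun h => by
    have : a ∈ {z | MapClusterPt z atTop u} ∩ (U ∩ V) := ⟨haL, haU, h⟩
    rw [hcon] at this
    exact this
  have hbU : b ∉ U := fun h => by
    have : b ∈ {z | MapClusterPt z atTop u} ∩ (U ∩ V) := ⟨hbL, h, hbV⟩
    rw [hcon] at this
    exact this
  have hPa : P ∈ 𝓝 a := Metric.isOpen_thickening.mem_nhds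
    (Metric.self_subset_thickening (half_pos hr) _ ⟨haL, haV⟩)
  have hPb : P' ∈ 𝓝 b := Metric.isOpen_thickening.mem_nhds
    (Metric.self_subset_thickening (half_pos hr) _ ⟨hbL, hbU⟩)
  obtain ⟨n₁, hn₁, hP₁⟩ := frequently_atTop.1 (haL.frequently hPa) n₀
  have hall : ∀ n ≥ n₁, u n ∈ P := fun n hn => by
    induction n, hn using Nat.le_induction with
    | base => exact hP₁
    | succ n hn ih => exact hstay n (by omega) ih
  obtain ⟨n₂, hn₂, hP₂⟩ := frequently_atTop.1 (hbL.frequently hPb) n₁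
  exact Set.disjoint_left.1 hthick (Metric.thickening_mono (half_le_self hr.le) _ (hall n₂ hn₂))
    (Metric.thickening_mono (half_le_self hr.le) _ hP₂)

/-- A sequence in a compact set with vanishing increments converges if its cluster points lie in
a totally disconnected set. -/
lemma exists_tendsto_of_totallyDisconnected (hK : IsCompact K) (hu : ∀ n, u n ∈ K)
    (hinc : Tendsto (fun n => dist (u (n + 1)) (u n)) atTop (𝓝 0)) {T : Set X}
    (hT : IsTotallyDisconnected T) (hcl : ∀ z, MapClusterPt z atTop u → z ∈ T) :
    ∃ z, Tendsto u atTop (𝓝 z) := by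
  have hsub := hT _ (fun z hz => hcl z hz) (isPreconnected_setOf_mapClusterPt hK hu hinc)
  obtain ⟨z, -, hz⟩ := hK.exists_mapClusterPt (u := u) (f := atTop)
    (tendsto_principal.2 (Eventually.of_forall hu))
  exact ⟨z, hK.tendsto_nhds_of_unique_mapClusterPt (Eventually.of_forall hu)
    fun w _ hw => hsub hw hz⟩

end Increments

/-! ### The proximal map -/

section Prox

variable {E : Type*} [NormedAddCommGroup E] [InnerProductSpace ℝ E] [CompleteSpace E]
  {f : E → ℝ} {G : E → E} {C : Set E} {L ρ : ℝ}

/-- The first-order condition at a point `y` that minimizes `-f + ρ ‖· - z‖²` over a convex set. -/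
lemma inner_le_of_isMinOn (hC : Convex ℝ C) {z y g : E} (hy : y ∈ C) (hf : HasGradientAt f g y)
    (hmin : ∀ w ∈ C, -f y + ρ * ‖y - z‖ ^ 2 ≤ -f w + ρ * ‖w - z‖ ^ 2) {w : E} (hw : w ∈ C) :
    inner ℝ (g + (2 * ρ) • (z - y)) (w - y) ≤ 0 := by
  have hd := (hf.hasFDerivAt.neg.add ((((hasFDerivAt_id y).sub_const z).norm_sq).const_mul
    ρ)).hasFDerivWithinAt (s := C)
  have hm : IsLocalMinOn (fun y => -f y + ρ * ‖y - z‖ ^ 2) C y :=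
    IsMinOn.localize fun w hw => hmin w hw
  have h := hm.hasFDerivWithinAt_nonneg hd
    (sub_mem_posTangentConeAt_of_segment_subset (hC.segment_subset hy hw))
  simp at h
  rw [inner_add_left, inner_smul_left, inner_sub_left]
  simp only [conj_trivial]
  linarith

omit [InnerProductSpace ℝ E] [CompleteSpace E] in
/-- The minimizers of `-f + ρ ‖· - z‖²` over a compact set. -/
lemma exists_prox (hC : IsCompact C) (hne : C.Nonempty) (hf : ContinuousOn f C) (ρ : ℝ) :
    ∃ Y : E → E, (∀ z, Y z ∈ C) ∧
      ∀ z, ∀ w ∈ C, -f (Y z) + ρ * ‖Y z - z‖ ^ 2 ≤ -f w + ρ * ‖w - z‖ ^ 2 := by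
  have h : ∀ z, ∃ y ∈ C, ∀ w ∈ C, -f y + ρ * ‖y - z‖ ^ 2 ≤ -f w + ρ * ‖w - z‖ ^ 2 := fun z => by
    obtain ⟨y, hy, h⟩ := hC.exists_isMinOn hne (f := fun y => -f y + ρ * ‖y - z‖ ^ 2)
      (hf.neg.add (Continuous.continuousOn (by fun_prop)))
    exact ⟨y, hy, fun w hw => h hw⟩
  choose Y hY hmin using h
  exact ⟨Y, hY, hmin⟩

variable {Y : E → E}

omit [CompleteSpace E] in
/-- With `ρ = 2 L` the proximal map is Lipschitz. -/
lemma norm_prox_sub_le (hL : 0 < L) (hG : ∀ z ∈ C, ∀ w ∈ C, ‖G z - G w‖ ≤ L * ‖z - w‖)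
    (hY : ∀ z, Y z ∈ C)
    (hvi : ∀ z, ∀ w ∈ C, inner ℝ (G (Y z) + (2 * (2 * L)) • (z - Y z)) (w - Y z) ≤ 0) (z z' : E) :
    ‖Y z - Y z'‖ ≤ 2 * ‖z - z'‖ := by
  have key : ∀ z, ∀ w ∈ C, inner ℝ (z + (4 * L)⁻¹ • G (Y z) - Y z) (w - Y z) ≤ 0 := by
    intro z w hw
    have h := hvi z w hw
    have e : z + (4 * L)⁻¹ • G (Y z) - Y z =
        (4 * L)⁻¹ • (G (Y z) + (2 * (2 * L)) • (z - Y z)) := by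
      rw [smul_add, smul_smul, show (4 * L)⁻¹ * (2 * (2 * L)) = 1 by field_simp; norm_num, one_smul]
      abel
    rw [e, inner_smul_left]
    exact mul_nonpos_of_nonneg_of_nonpos (by simp; positivity) h
  have h1 := norm_sub_le_of_variational (key z _ (hY z')) (key z' _ (hY z))
  have h2 : ‖z + (4 * L)⁻¹ • G (Y z) - (z' + (4 * L)⁻¹ • G (Y z'))‖ ≤
      ‖z - z'‖ + 4⁻¹ * ‖Y z - Y z'‖ := by
    calc _ = ‖(z - z') + (4 * L)⁻¹ • (G (Y z) - G (Y z'))‖ := by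
          rw [smul_sub]; congr 1; abel
      _ ≤ ‖z - z'‖ + (4 * L)⁻¹ * ‖G (Y z) - G (Y z')‖ := by
          refine (norm_add_le _ _).trans ?_
          rw [norm_smul, Real.norm_of_nonneg (by positivity)]
      _ ≤ ‖z - z'‖ + (4 * L)⁻¹ * (L * ‖Y z - Y z'‖) := by
          gcongr
          exact hG _ (hY z) _ (hY z')
      _ = _ := by field_simp
  have := norm_nonneg (z - z')
  linarith

omit [CompleteSpace E] in
/-- With `ρ = 2 L` the direction towards the proximal point is an ascent direction of `f`. -/
lemma le_inner_prox_sub (hG : ∀ z ∈ C, ∀ w ∈ C, ‖G z - G w‖ ≤ L * ‖z - w‖)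
    (hY : ∀ z, Y z ∈ C)
    (hvi : ∀ z, ∀ w ∈ C, inner ℝ (G (Y z) + (2 * (2 * L)) • (z - Y z)) (w - Y z) ≤ 0) {z : E}
    (hz : z ∈ C) : 3 * L * ‖z - Y z‖ ^ 2 ≤ inner ℝ (G z) (Y z - z) := by
  have h := hvi z z hz
  rw [inner_add_left, inner_smul_left, real_inner_self_eq_norm_sq] at h
  simp only [conj_trivial] at h
  have h1 : inner ℝ (G (Y z) - G z) (Y z - z) ≤ L * ‖z - Y z‖ ^ 2 := by
    refine (real_inner_le_norm _ _).trans ?_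
    rw [norm_sub_rev z, sq, ← mul_assoc]
    gcongr
    exact hG _ (hY z) _ hz
  rw [inner_sub_left] at h1
  have h2 : inner ℝ (G (Y z)) (z - Y z) = -inner ℝ (G (Y z)) (Y z - z) := by
    rw [← inner_neg_right, neg_sub]
  linarith

end Prox

/-! ### Projected stochastic ascent -/

section Ascent

variable {d : ℕ} {Θ C : Set (EuclideanSpace ℝ (Fin d))}
  {f : EuclideanSpace ℝ (Fin d) → ℝ} {G Hf Y : EuclideanSpace ℝ (Fin d) → EuclideanSpace ℝ (Fin d)}
  {L : ℝ}

lemma tendsto_zero_of_summable_sq {a : ℕ → ℝ} (ha : ∀ m, 0 ≤ a m)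
    (h : Summable fun m => a m ^ 2) : Tendsto a atTop (𝓝 0) := by
  have := (Real.continuous_sqrt.tendsto 0).comp h.tendsto_atTop_zero
  rw [Real.sqrt_zero] at this
  exact this.congr fun m => Real.sqrt_sq (ha m)

lemma norm_proj_add_sub_le (hc : IsClosed Θ) (hconv : Convex ℝ Θ)
    {z : EuclideanSpace ℝ (Fin d)} (hz : z ∈ Θ) (v : EuclideanSpace ℝ (Fin d)) :
    ‖proj Θ (z + v) - z‖ ≤ ‖v‖ := by
  have h := norm_proj_sub_proj_le hc hconv ⟨z, hz⟩ (z + v) z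
  rwa [proj_of_mem hc hconv hz, add_sub_cancel_left] at h

/-- One step of the projected ascent decreases the Moreau envelope of `-f` up to noise. -/
lemma envelope_step (hc : IsClosed Θ) (hconv : Convex ℝ Θ) (hCΘ : C ⊆ Θ) (hL : 0 < L)
    (hG : ∀ z ∈ C, ∀ w ∈ C, ‖G z - G w‖ ≤ L * ‖z - w‖) (hY : ∀ z, Y z ∈ C)
    (hmin : ∀ z, ∀ w ∈ C, -f (Y z) + 2 * L * ‖Y z - z‖ ^ 2 ≤ -f w + 2 * L * ‖w - z‖ ^ 2)
    (hvi : ∀ z, ∀ w ∈ C, inner ℝ (G (Y z) + (2 * (2 * L)) • (z - Y z)) (w - Y z) ≤ 0)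
    {c₀ : ℝ} {a : EuclideanSpace ℝ (Fin d) → ℝ} (hc₀ : 0 < c₀) (ha : ∀ z ∈ C, c₀ ≤ a z)
    (hH : ∀ z ∈ C, Hf z = a z • G z) {z : EuclideanSpace ℝ (Fin d)} (hz : z ∈ C)
    (v : EuclideanSpace ℝ (Fin d)) {s : ℝ} (hs : 0 < s) :
    -f (Y (proj Θ (z + s • v))) + 2 * L * ‖Y (proj Θ (z + s • v)) - proj Θ (z + s • v)‖ ^ 2 +
        12 * L ^ 2 * c₀ * (s * ‖z - Y z‖ ^ 2) ≤
      -f (Y z) + 2 * L * ‖Y z - z‖ ^ 2 +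
        (4 * L * (s * inner ℝ (v - Hf z) (z - Y z)) + 2 * L * (s ^ 2 * ‖v‖ ^ 2)) := by
  have h1 := hmin (proj Θ (z + s • v)) (Y z) (hY z)
  have h2 : ‖Y z - proj Θ (z + s • v)‖ ^ 2 ≤
      ‖z - Y z‖ ^ 2 + 2 * (s * inner ℝ v (z - Y z)) + s ^ 2 * ‖v‖ ^ 2 := by
    have h3 := norm_proj_sub_proj_le hc hconv ⟨z, hCΘ hz⟩ (z + s • v) (Y z)
    rw [proj_of_mem hc hconv (hCΘ (hY z)), norm_sub_rev] at h3
    calc _ ≤ ‖z + s • v - Y z‖ ^ 2 := by gcongr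
      _ = ‖(z - Y z) + s • v‖ ^ 2 := by congr 2; abel
      _ = _ := by
        rw [norm_add_sq_real, inner_smul_right, real_inner_comm, norm_smul, mul_pow,
          Real.norm_eq_abs, sq_abs]
  have h4 := le_inner_prox_sub hG hY hvi hz
  have h5 : inner ℝ v (z - Y z) ≤ inner ℝ (v - Hf z) (z - Y z) - c₀ * (3 * L * ‖z - Y z‖ ^ 2) := by
    have h6 : inner ℝ (Hf z) (z - Y z) = -(a z * inner ℝ (G z) (Y z - z)) := by
      rw [hH z hz, inner_smul_left, ← neg_sub (Y z) z, inner_neg_right]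
      simp
    rw [inner_sub_left, h6]
    have h7 : c₀ * (3 * L * ‖z - Y z‖ ^ 2) ≤ a z * inner ℝ (G z) (Y z - z) :=
      mul_le_mul (ha z hz) h4 (by positivity) (hc₀.le.trans (ha z hz))
    linarith
  have h8 := mul_le_mul_of_nonneg_left h2 (show 0 ≤ 2 * L by positivity)
  have h9 := mul_le_mul_of_nonneg_left h5 (show 0 ≤ 4 * L * s by positivity)
  rw [norm_sub_rev (Y z) z]
  linarith

/-- A run of the projected ascent in a ball whose noise gives convergent series: the distance to
the proximal point tends to zero. -/
theorem tendsto_norm_sub_prox (hc : IsClosed Θ) (hconv : Convex ℝ Θ) (hCΘ : C ⊆ Θ)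
    (hCc : IsCompact C) (hf : ContinuousOn f C) (hL : 0 < L)
    (hG : ∀ z ∈ C, ∀ w ∈ C, ‖G z - G w‖ ≤ L * ‖z - w‖) (hY : ∀ z, Y z ∈ C)
    (hmin : ∀ z, ∀ w ∈ C, -f (Y z) + 2 * L * ‖Y z - z‖ ^ 2 ≤ -f w + 2 * L * ‖w - z‖ ^ 2)
    (hvi : ∀ z, ∀ w ∈ C, inner ℝ (G (Y z) + (2 * (2 * L)) • (z - Y z)) (w - Y z) ≤ 0)
    {c₀ : ℝ} {a : EuclideanSpace ℝ (Fin d) → ℝ} (hc₀ : 0 < c₀) (ha : ∀ z ∈ C, c₀ ≤ a z)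
    (hH : ∀ z ∈ C, Hf z = a z • G z) {α : ℕ → ℝ} (hα : ∀ m, 0 < α m)
    (hα_sum : Tendsto (fun n => ∑ m ∈ Finset.range n, α m) atTop atTop)
    (hα_sq : Summable (fun m => α m ^ 2)) {u v : ℕ → EuclideanSpace ℝ (Fin d)}
    (hu : ∀ m, u m ∈ C) (hupd : ∀ m, u (m + 1) = proj Θ (u m + α m • v m))
    (hn1 : ∃ l, Tendsto (fun n => ∑ i ∈ Finset.range n,
      α i * inner ℝ (v i - Hf (u i)) (u i - Y (u i))) atTop (𝓝 l))
    {e : ℕ → ℝ} {D : ℝ} (he : ∀ i, 0 ≤ e i ∧ e i ≤ D)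
    (hn2 : ∃ l, Tendsto (fun n => ∑ i ∈ Finset.range n, α i * (‖v i‖ - e i)) atTop (𝓝 l))
    (hn3 : Summable fun i => α i ^ 2 * ‖v i‖ ^ 2) :
    Tendsto (fun m => ‖u m - Y (u m)‖) atTop (𝓝 0) := by
  have hD : 0 ≤ D := (he 0).1.trans (he 0).2
  obtain ⟨b, hb⟩ := hCc.bddAbove_image hf
  have hsum : Summable fun m => α m * ‖u m - Y (u m)‖ ^ 2 := by
    have hs : Summable fun m => 12 * L ^ 2 * c₀ * (α m * ‖u m - Y (u m)‖ ^ 2) := by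
      refine summable_of_descent (b := -b)
        (Φ := fun m => -f (Y (u m)) + 2 * L * ‖Y (u m) - u m‖ ^ 2)
        (n := fun m => 4 * L * (α m * inner ℝ (v m - Hf (u m)) (u m - Y (u m))) +
          2 * L * (α m ^ 2 * ‖v m‖ ^ 2))
        (fun m => by have := hα m; positivity) (fun m => ?_) (fun m => ?_) ?_
      · simp only [hupd]
        exact envelope_step hc hconv hCΘ hL hG hY hmin hvi hc₀ ha hH (hu m) (v m) (hα m)
      · have h1 : f (Y (u m)) ≤ b := hb ⟨_, hY _, rfl⟩
        have h2 : 0 ≤ 2 * L * ‖Y (u m) - u m‖ ^ 2 := by positivity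
        linarith
      · obtain ⟨l, hl⟩ := hn1
        refine ⟨_, ((hl.const_mul (4 * L)).add
          ((hn3.hasSum.tendsto_sum_nat).const_mul (2 * L))).congr fun k => ?_⟩
        rw [Finset.sum_add_distrib, Finset.mul_sum, Finset.mul_sum]
    exact (summable_mul_left_iff (by positivity)).1 hs
  refine tendsto_zero_of_summable_mul_sq (D := 3 * D) hα (by positivity) hα_sum
    (tendsto_zero_of_summable_sq (fun m => (hα m).le) hα_sq) (fun m => norm_nonneg _) hsum
    (δ := fun i => 3 * (α i * (‖v i‖ - e i))) ?_ fun m => ?_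
  · obtain ⟨l, hl⟩ := hn2
    exact ⟨_, (hl.const_mul 3).congr fun k => by rw [Finset.mul_sum]⟩
  · have h1 : ‖u (m + 1) - u m‖ ≤ α m * ‖v m‖ := by
      rw [hupd]
      refine (norm_proj_add_sub_le hc hconv (hCΘ (hu m)) _).trans_eq ?_
      rw [norm_smul, Real.norm_of_nonneg (hα m).le]
    have h2 := norm_prox_sub_le hL hG hY hvi (u m) (u (m + 1))
    rw [norm_sub_rev (u m) (u (m + 1))] at h2
    have h3 : ‖u (m + 1) - Y (u (m + 1))‖ ≤
        ‖u (m + 1) - u m‖ + ‖u m - Y (u m)‖ + ‖Y (u m) - Y (u (m + 1))‖ := by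
      refine le_trans (le_of_eq ?_) (norm_add₃_le)
      congr 1
      abel
    have h4 : α m * e m ≤ D * α m := by
      rw [mul_comm D]
      exact mul_le_mul_of_nonneg_left (he m).2 (hα m).le
    linarith

/-- The projected-gradient residual at a point is bounded by the distance to its proximal point, if
the latter lies in the interior of the ball that cuts `C` out of `Θ`. -/
lemma norm_residual_le (hc : IsClosed Θ) (hconv : Convex ℝ Θ) {B : ℝ} (hL : 0 < L)
    (hG : ∀ z ∈ Θ ∩ Metric.closedBall 0 B, ∀ w ∈ Θ ∩ Metric.closedBall 0 B,
      ‖G z - G w‖ ≤ L * ‖z - w‖)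
    (hY : ∀ z, Y z ∈ Θ ∩ Metric.closedBall 0 B)
    (hvi : ∀ z, ∀ w ∈ Θ ∩ Metric.closedBall 0 B,
      inner ℝ (G (Y z) + (2 * (2 * L)) • (z - Y z)) (w - Y z) ≤ 0)
    {z : EuclideanSpace ℝ (Fin d)} (hz : z ∈ Θ ∩ Metric.closedBall 0 B) (hYz : ‖Y z‖ < B) :
    ‖proj Θ (z + G z) - z‖ ≤ (2 + 5 * L) * ‖z - Y z‖ := by
  -- the variational inequality at `Y z` extends from the ball to `Θ` by convexity
  have hvi' : ∀ w ∈ Θ, inner ℝ (Y z + G (Y z) + (2 * (2 * L)) • (z - Y z) - Y z) (w - Y z) ≤ 0 := by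
    intro w hw
    have hcont : Tendsto (fun t : ℝ => ‖Y z + t • (w - Y z)‖) (𝓝[>] 0) (𝓝 ‖Y z‖) := by
      have : Continuous fun t : ℝ => ‖Y z + t • (w - Y z)‖ := by fun_prop
      simpa using (this.tendsto 0).mono_left nhdsWithin_le_nhds
    obtain ⟨t, ht1, ht2⟩ := ((hcont.eventually (gt_mem_nhds hYz)).and
      (Ioo_mem_nhdsGT (show (0 : ℝ) < 1 by norm_num))).exists
    have h := hvi z (Y z + t • (w - Y z)) ⟨hconv.add_smul_sub_mem (hY z).1 hw ⟨ht2.1.le, ht2.2.le⟩,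
      by simpa using ht1.le⟩
    rw [add_sub_cancel_left, inner_smul_right] at h
    rw [add_assoc, add_sub_cancel_left]
    exact nonpos_of_mul_nonpos_right h ht2.1
  have hproj := proj_eq_of_variational hc hconv (hY z).1 hvi'
  have hne : Θ.Nonempty := ⟨_, hz.1⟩
  calc ‖proj Θ (z + G z) - z‖
      ≤ ‖proj Θ (z + G z) - Y z‖ + ‖Y z - z‖ := by
        simpa using norm_add_le (proj Θ (z + G z) - Y z) (Y z - z)
    _ ≤ ‖z + G z - (Y z + G (Y z) + (2 * (2 * L)) • (z - Y z))‖ + ‖z - Y z‖ := by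
        rw [norm_sub_rev (Y z) z]
        gcongr
        have h := norm_proj_sub_proj_le hc hconv hne (z + G z)
          (Y z + G (Y z) + (2 * (2 * L)) • (z - Y z))
        rwa [hproj] at h
    _ ≤ (‖z - Y z‖ + L * ‖z - Y z‖ + 2 * (2 * L) * ‖z - Y z‖) + ‖z - Y z‖ := by
        gcongr
        calc _ = ‖(z - Y z) + (G z - G (Y z)) + -((2 * (2 * L)) • (z - Y z))‖ := by
              congr 1; abel
          _ ≤ _ := by
              refine norm_add₃_le.trans ?_
              rw [norm_neg, norm_smul, Real.norm_of_nonneg (by positivity)]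
              gcongr
              exact hG _ hz _ (hY z)
    _ = _ := by ring

end Ascent

/-! ### Convergence of the algorithm -/

section Convergence

variable {S A : Type*} [MeasurableSpace S] [MeasurableSingletonClass S] [MeasurableSpace A] {d : ℕ}
  {M : MDP S A} {Q : ParamPolicy d S A} {Θ : Set (EuclideanSpace ℝ (Fin d))} {α : ℕ → ℝ} {N : ℕ}
  {θ₀ : EuclideanSpace ℝ (Fin d)} {Ω : Type*} {mΩ : MeasurableSpace Ω} {μ : Measure Ω}
  {ℱ : Filtration ℕ mΩ} {x y : ℕ → Ω → ℕ → S × A} {θ : ℕ → Ω → EuclideanSpace ℝ (Fin d)}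

/-- On the event that the parameters stay in a ball, the projected-gradient residual of the
performance and the increments of the parameters tend to zero. -/
theorem IsRun.ae_tendsto_residual [IsProbabilityMeasure μ]
    (hrun : IsRun M Q Θ α N θ₀ μ ℱ x y θ) (hc : IsClosed Θ) (hconv : Convex ℝ Θ) (hθ₀ : θ₀ ∈ Θ)
    (hΘU : Θ ⊆ Q.U) (hrec : ∀ ϑ ∈ Θ, PositiveRecurrent M Q ϑ)
    (hmom : LocallyBoundedSecondMoments M Q Θ) (hLip : LocallyLipschitzOn Θ (H M Q))
    (hα : ∀ m, 0 < α m) (hα_sum : Tendsto (fun n => ∑ m ∈ Finset.range n, α m) atTop atTop)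
    (hα_sq : Summable fun m => α m ^ 2) (hN : 0 < N) (B : ℝ) :
    ∀ᵐ ω ∂μ, (∀ m, ‖θ m ω‖ ≤ B) →
      Tendsto (fun m => proj Θ (θ m ω + gradient (J M Q) (θ m ω)) - θ m ω) atTop (𝓝 0) ∧
      Tendsto (fun m => dist (θ (m + 1) ω) (θ m ω)) atTop (𝓝 0) := by
  -- otherwise the event is empty, and the set `C` below may be empty too
  by_cases hB : ‖θ₀‖ ≤ B
  swap
  · exact .of_forall fun ω h => absurd (hrun.init ω ▸ h 0) hB
  -- the radius exceeds `B` so that the proximal points are eventually inside the open ball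
  set C := Θ ∩ Metric.closedBall (0 : EuclideanSpace ℝ (Fin d)) (B + 1) with hC
  have hCΘ : C ⊆ Θ := Set.inter_subset_left
  have hCc : IsCompact C := (isCompact_closedBall 0 (B + 1)).inter_left hc
  have hCconv : Convex ℝ C := hconv.inter (convex_closedBall 0 (B + 1))
  have hθ₀C : θ₀ ∈ C := ⟨hθ₀, by simpa using hB.trans (by linarith)⟩
  obtain ⟨L, hL, hG⟩ := exists_lipschitz_gradient_J hmom hΘU hrec hLip hCc hCconv hCΘ
  have hgrad : ∀ ϑ ∈ C, HasGradientAt (J M Q) (gradient (J M Q) ϑ) ϑ := fun ϑ hϑ =>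
    (hasGradientAt_J hmom (hCΘ hϑ) (hΘU (hCΘ hϑ))
      (hrec ϑ (hCΘ hϑ))).differentiableAt.hasGradientAt
  have hJ : ContinuousOn (J M Q) C := fun ϑ hϑ => (hgrad ϑ hϑ).continuousAt.continuousWithinAt
  obtain ⟨Y, hY, hmin⟩ := exists_prox hCc ⟨θ₀, hθ₀C⟩ hJ (2 * L)
  have hvi : ∀ z, ∀ w ∈ C,
      inner ℝ (gradient (J M Q) (Y z) + (2 * (2 * L)) • (z - Y z)) (w - Y z) ≤ 0 :=
    fun z w hw => inner_le_of_isMinOn hCconv (hY z) (hgrad _ (hY z)) (hmin z) hw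
  have hYm : Measurable Y := by
    refine (LipschitzWith.of_dist_le_mul (K := 2) fun z z' => ?_).continuous.measurable
    simpa [dist_eq_norm] using norm_prox_sub_le hL hG hY hvi z z'
  have hγ : 0 < 1 - M.γ := sub_pos.2 M.γ_lt_one
  obtain ⟨D, hD⟩ := hrun.ae_noise hc hθ₀ hΘU hrec hmom hα_sq hN B (φ := fun ϑ => ϑ - Y ϑ)
    (measurable_id.sub hYm) (R := B + (B + 1)) fun ϑ _ hϑ =>
      (norm_sub_le _ _).trans (add_le_add hϑ (by simpa using (hY ϑ).2))
  filter_upwards [hD] with ω hω hb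
  obtain ⟨hn1, ⟨e, he, hn2⟩, hn3⟩ := hω hb
  have huC : ∀ m, θ m ω ∈ C := fun m =>
    ⟨hrun.mem hc hθ₀ m ω, by simpa using (hb m).trans (by linarith)⟩
  have hprox := tendsto_norm_sub_prox (Hf := H M Q)
    (a := fun ϑ => (1 - M.γ) * meanT M Q ϑ ^ 2) hc hconv hCΘ hCc hJ hL hG hY hmin hvi hγ
    (fun ϑ hϑ => le_mul_of_one_le_right hγ.le
      (one_le_pow₀ (one_le_meanT (lintegral_absCost_lt_top hmom (hCΘ hϑ)))))
    (fun ϑ hϑ => H_eq_smul_gradient hmom (hCΘ hϑ) (hΘU (hCΘ hϑ)) (hrec _ (hCΘ hϑ)))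
    hα hα_sum hα_sq huC (fun m => hrun.update m ω) hn1 he hn2 hn3
  constructor
  · have hev : ∀ᶠ m in atTop, ‖Y (θ m ω)‖ < B + 1 := by
      filter_upwards [hprox.eventually (gt_mem_nhds zero_lt_one)] with m hm
      have := norm_le_norm_add_norm_sub' (Y (θ m ω)) (θ m ω)
      rw [norm_sub_rev] at this
      linarith [hb m]
    refine squeeze_zero_norm' (a := fun m => (2 + 5 * L) * ‖θ m ω - Y (θ m ω)‖) ?_ ?_
    · filter_upwards [hev] with m hm
      exact norm_residual_le hc hconv hL hG hY hvi (huC m) hm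
    · simpa using hprox.const_mul (2 + 5 * L)
  · have h0 : Tendsto (fun m => α m * ‖estH M Q N (θ m ω) (x m ω) (y m ω)‖) atTop (𝓝 0) :=
      tendsto_zero_of_summable_sq (fun m => mul_nonneg (hα m).le (norm_nonneg _))
        (by simpa only [mul_pow] using hn3)
    refine squeeze_zero (fun m => dist_nonneg) (fun m => ?_) h0
    rw [dist_eq_norm, hrun.update m ω]
    refine (norm_proj_add_sub_le hc hconv (hCΘ (huC m)) _).trans_eq ?_
    rw [norm_smul, Real.norm_of_nonneg (hα m).le]

/-- A bounded sequence in `Θ` with vanishing increments and vanishing projected-gradient residuals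
converges to a stationary point, if the stationary points form a totally disconnected set. -/
theorem exists_tendsto_isStationaryOn (hc : IsClosed Θ) (hconv : Convex ℝ Θ)
    {f : EuclideanSpace ℝ (Fin d) → ℝ}
    (hG : ∀ B : ℝ, ContinuousOn (gradient f) (Θ ∩ Metric.closedBall 0 B))
    {u : ℕ → EuclideanSpace ℝ (Fin d)} (hu : ∀ m, u m ∈ Θ) {B : ℝ} (hB : ∀ m, ‖u m‖ ≤ B)
    (hres : Tendsto (fun m => proj Θ (u m + gradient f (u m)) - u m) atTop (𝓝 0))
    (hinc : Tendsto (fun m => dist (u (m + 1)) (u m)) atTop (𝓝 0))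
    (hT : IsTotallyDisconnected {ϑ | IsStationaryOn f Θ ϑ}) :
    ∃ z, IsStationaryOn f Θ z ∧ Tendsto u atTop (𝓝 z) ∧
      Tendsto (fun m => gradient f (u m)) atTop (𝓝 (gradient f z)) := by
  have hne : Θ.Nonempty := ⟨_, hu 0⟩
  have huC : ∀ m, u m ∈ Θ ∩ Metric.closedBall 0 B := fun m => ⟨hu m, by simpa using hB m⟩
  have hCc : IsCompact (Θ ∩ Metric.closedBall 0 B) := (isCompact_closedBall 0 B).inter_left hc
  have hproj : Continuous (proj Θ) :=
    (LipschitzWith.of_dist_le_mul (K := 1) fun z z' => by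
      simpa [dist_eq_norm] using norm_proj_sub_proj_le hc hconv hne z z').continuous
  have hlim : ∀ z, MapClusterPt z atTop u → IsStationaryOn f Θ z := by
    intro z hz
    have hzC := hCc.isClosed.mem_of_mapClusterPt hz (Eventually.of_forall huC)
    obtain ⟨ψ, hψ, hlim⟩ := hz.tendsto_subseq
    have hlimC : Tendsto (u ∘ ψ) atTop (𝓝[Θ ∩ Metric.closedBall 0 B] z) :=
      tendsto_nhdsWithin_iff.2 ⟨hlim, Eventually.of_forall fun n => huC _⟩
    have h1 := (hproj.tendsto _).comp (hlim.add ((hG B z hzC).tendsto.comp hlimC))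
    have h2 := tendsto_nhds_unique (h1.sub hlim) (hres.comp hψ.tendsto_atTop)
    refine ⟨hzC.1, fun w hw => ?_⟩
    have h3 := inner_sub_proj_le hc hconv hne (z + gradient f z) hw
    rwa [sub_eq_zero.1 h2, add_sub_cancel_left] at h3
  obtain ⟨z, hz⟩ := exists_tendsto_of_totallyDisconnected hCc huC hinc hT hlim
  have hzC := hCc.isClosed.mem_of_tendsto hz (Eventually.of_forall huC)
  exact ⟨z, hlim z hz.mapClusterPt, hz, (hG B z hzC).tendsto.comp
    (tendsto_nhdsWithin_iff.2 ⟨hz, Eventually.of_forall huC⟩)⟩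

omit [MeasurableSpace S] [MeasurableSingletonClass S] [MeasurableSpace A] in
lemma IsStationaryOn.gradient_eq_zero {f : EuclideanSpace ℝ (Fin d) → ℝ}
    {z : EuclideanSpace ℝ (Fin d)} (h : IsStationaryOn f Θ z) (hz : z ∈ interior Θ) :
    gradient f z = 0 := by
  have hcont : Tendsto (fun t : ℝ => z + t • gradient f z) (𝓝[>] 0) (𝓝 z) := by
    have : Continuous fun t : ℝ => z + t • gradient f z := by fun_prop
    simpa using (this.tendsto 0).mono_left nhdsWithin_le_nhds
  obtain ⟨t, ht1, ht2⟩ := ((hcont.eventually (mem_interior_iff_mem_nhds.1 hz)).and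
    self_mem_nhdsWithin).exists
  have h1 := h.2 _ ht1
  rw [add_sub_cancel_left, inner_smul_right, real_inner_self_eq_norm_sq] at h1
  have h2 := nonpos_of_mul_nonpos_right h1 ht2
  rw [← norm_eq_zero]
  exact pow_eq_zero_iff two_ne_zero |>.1 (le_antisymm h2 (sq_nonneg _))

end Convergence

end RMC

end

theorem corollary1 {S A : Type*} [MeasurableSpace S] [MeasurableSingletonClass S]
    [MeasurableSpace A] {d : ℕ} (M : RMC.MDP S A) (Q : RMC.ParamPolicy d S A)
    (Θ : Set (EuclideanSpace ℝ (Fin d))) (hΘ_closed : IsClosed Θ) (hΘ_convex : Convex ℝ Θ)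
    (hΘU : Θ ⊆ Q.U)
    (hrec : ∀ θ ∈ Θ, RMC.PositiveRecurrent M Q θ)
    (hmom : RMC.LocallyBoundedSecondMoments M Q Θ)
    (hLip : LocallyLipschitzOn Θ (RMC.H M Q))
    (α : ℕ → ℝ) (hα : ∀ m, 0 < α m)
    (hα_sum : Tendsto (fun n => ∑ m ∈ Finset.range n, α m) atTop atTop)
    (hα_sq : Summable (fun m => α m ^ 2))
    (N : ℕ) (hN : 0 < N) (θ₀ : EuclideanSpace ℝ (Fin d)) (hθ₀ : θ₀ ∈ Θ)
    {Ω : Type*} {mΩ : MeasurableSpace Ω} (μ : Measure Ω) [IsProbabilityMeasure μ]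
    (ℱ : Filtration ℕ mΩ) (x y : ℕ → Ω → ℕ → S × A) (θ : ℕ → Ω → EuclideanSpace ℝ (Fin d))
    (hrun : RMC.IsRun M Q Θ α N θ₀ μ ℱ x y θ)
    (hbdd : ∀ᵐ ω ∂μ, Bornology.IsBounded (Set.range fun m => θ m ω)) :
    (∀ ϑ ∈ Θ, DifferentiableAt ℝ (RMC.J M Q) ϑ) ∧
    (∀ᵐ ω ∂μ, Tendsto
      (fun m => RMC.proj Θ (θ m ω + gradient (RMC.J M Q) (θ m ω)) - θ m ω) atTop (𝓝 0)) ∧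
    (Θ = Set.univ →
      ∀ᵐ ω ∂μ, Tendsto (fun m => gradient (RMC.J M Q) (θ m ω)) atTop (𝓝 0)) ∧
    (IsTotallyDisconnected {ϑ | RMC.IsStationaryOn (RMC.J M Q) Θ ϑ} →
      ∀ᵐ ω ∂μ, ∃ θstar, RMC.IsStationaryOn (RMC.J M Q) Θ θstar ∧
        (θstar ∈ interior Θ → gradient (RMC.J M Q) θstar = 0) ∧
        Tendsto (fun m => θ m ω) atTop (𝓝 θstar) ∧
        Tendsto (fun m => gradient (RMC.J M Q) (θ m ω)) atTop
          (𝓝 (gradient (RMC.J M Q) θstar))) := by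
  have hgrad : ∀ ϑ ∈ Θ, DifferentiableAt ℝ (RMC.J M Q) ϑ := fun ϑ hϑ =>
    (RMC.hasGradientAt_J hmom hϑ (hΘU hϑ) (hrec ϑ hϑ)).differentiableAt
  have hcont : ∀ B : ℝ,
      ContinuousOn (gradient (RMC.J M Q)) (Θ ∩ Metric.closedBall 0 B) := by
    intro B
    obtain ⟨L, hL, hG⟩ := RMC.exists_lipschitz_gradient_J hmom hΘU hrec hLip
      ((isCompact_closedBall 0 B).inter_left hΘ_closed)
      (hΘ_convex.inter (convex_closedBall 0 B)) Set.inter_subset_left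
    refine (LipschitzOnWith.of_dist_le_mul (K := ⟨L, hL.le⟩) fun z hz w hw => ?_).continuousOn
    rw [dist_eq_norm, dist_eq_norm]
    exact hG z hz w hw
  have hbound : ∀ᵐ ω ∂μ, ∃ B : ℕ, ∀ m, ‖θ m ω‖ ≤ B := by
    filter_upwards [hbdd] with ω hω
    obtain ⟨R, hR⟩ := hω.exists_norm_le
    obtain ⟨B, hB⟩ := exists_nat_ge R
    exact ⟨B, fun m => (hR _ ⟨m, rfl⟩).trans hB⟩
  have hmain := ae_all_iff.2 fun B : ℕ => hrun.ae_tendsto_residual hΘ_closed hΘ_convex hθ₀ hΘU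
    hrec hmom hLip hα hα_sum hα_sq hN (B : ℝ)
  have hres : ∀ᵐ ω ∂μ, Tendsto
      (fun m => RMC.proj Θ (θ m ω + gradient (RMC.J M Q) (θ m ω)) - θ m ω) atTop (𝓝 0) := by
    filter_upwards [hmain, hbound] with ω h1 ⟨B, hB⟩
    exact (h1 B hB).1
  refine ⟨hgrad, hres, fun hΘ => ?_, fun hT => ?_⟩
  · filter_upwards [hres] with ω hω
    refine hω.congr fun m => ?_
    rw [RMC.proj_of_mem hΘ_closed hΘ_convex (hΘ ▸ Set.mem_univ _), add_sub_cancel_left]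
  · filter_upwards [hmain, hbound] with ω h1 ⟨B, hB⟩
    obtain ⟨z, hz, hlim, hlimG⟩ := RMC.exists_tendsto_isStationaryOn hΘ_closed hΘ_convex hcont
      (fun m => hrun.mem hΘ_closed hθ₀ m ω) hB (h1 B hB).1 (h1 B hB).2 hT
    exact ⟨z, hz, hz.gradient_eq_zero, hlim, hlimG⟩
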